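/- Let $(M,g)$ be a smooth pseudo-Riemannian manifold of dimension $n>2$ which is a null Ricci Walker metric: there is a smooth vector distribution $\mathcal N\subset TM$ of rank $p>0$ that is totally null, parallel with respect to the Levi-Civita connection $\nabla$ of $g$, and contains the image of the Schouten tensor $\mathsf P=\frac{1}{n-2}\big(\mathrm{Ric}-\frac{\mathrm{Scal}}{2(n-1)}g\big)$. Let $\epsilon>0$, let $g(\rho)$, $\rho\in(-\epsilon,\epsilon)$, be a smooth family of pseudo-Riemannian metrics on $M$ with $g(0)=g$, and let $\widetilde g=2\,dt\,d(\rho t)+t^2 g(\rho)$ on $(0,\infty)\times M\times(-\epsilon,\epsilon)$. We say that $\widetilde g$ solves the Fefferman–Graham equations for $g$ if, along $\rho=0$, $\mathrm{Ric}(\widetilde g)=O(\rho^\infty)$ when $n$ is odd and $\mathrm{Ric}(\widetilde g)=O(\rho^{n/2-1})$ when $n$ is even. It is an ambient metric in normal form with respect to $g$ if moreover, when $n$ is even, $\mathrm{tr}_g\big(\rho^{1-n/2}\mathrm{Ric}(\widetilde g)|_{TM\otimes TM}\big)=0$ along $\rho=0$. For $n$ even the obstruction tensor is $\mathcal O=c_n\big(\rho^{1-n/2}\,\mathrm{Ric}(\widetilde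 g)|_{TM\otimes TM}\big)\big|_{\rho=0}$, where $c_n\neq0$ is a normalising constant. Write $h(\rho)=g(\rho)-g$ and $h^{(m)}=\partial_\rho^m h|_{\rho=0}$, so that $h\sim\sum_{m\ge1}\frac1{m!}h^{(m)}\rho^m$; images and divergences of symmetric $(0,2)$-tensors are taken with respect to $g$. Consider the properties $$\mathrm{Im}\,h^{(m)}\subset\mathcal N,\qquad \nabla_k\,(h^{(m)})_i{}^{k}=0.\qquad(*)$$ 1. For every solution $\widetilde g$ of the Fefferman–Graham equations for $g$, in particular for every ambient metric in normal form with respect to $g$: (a) if $n$ is odd, then $(*)$ holds for all $m\ge1$; (b) if $n$ is even, then $(*)$ holds for all $1\le m\le\frac n2-1$, and $\mathrm{Im}\,\mathcal O\subset\mathcal N$. 2. If $n$ is even, there is an ambient metric in normal form with respect to $g$ for which $(*)$ holds for all $m\ge1$. -/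

import Mathlib

open scoped Manifold ContDiff

noncomputable section

namespace AmbientWalker

/-! ## Coordinate tensor calculus on `ℝ^ι`

A (pseudo-Riemannian) metric on an open subset of `ℝ^ι` is given by its matrix of components
`G : (ι → ℝ) → Matrix ι ι ℝ`. -/

section Coordinates

variable {ι : Type*} [Fintype ι] [DecidableEq ι]

/-- The partial derivative `∂_k f` at `y`. -/
def pderiv (k : ι) (f : (ι → ℝ) → ℝ) (y : ι → ℝ) : ℝ :=
  fderiv ℝ f y (Pi.single k 1)

/-- The Christoffel symbols
`Γ^k_{ij} = ½ g^{kl} (∂_i g_{jl} + ∂_j g_{il} - ∂_l g_{ij})` of the Levi-Civita connection. -/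
def christoffel (G : (ι → ℝ) → Matrix ι ι ℝ) (k i j : ι) (y : ι → ℝ) : ℝ :=
  (1 / 2) * ∑ l, (G y)⁻¹ k l *
    (pderiv i (fun z => G z j l) y + pderiv j (fun z => G z i l) y
      - pderiv l (fun z => G z i j) y)

/-- The components
`R_{ij} = ∂_k Γ^k_{ij} - ∂_j Γ^k_{ik} + Γ^k_{kl} Γ^l_{ij} - Γ^k_{jl} Γ^l_{ik}` of the Ricci tensor
(with the sign for which round spheres have positive Ricci curvature). -/
def ricci (G : (ι → ℝ) → Matrix ι ι ℝ) (y : ι → ℝ) : Matrix ι ι ℝ :=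
  Matrix.of fun i j =>
    ∑ k, (pderiv k (christoffel G k i j) y - pderiv j (christoffel G k i k) y
      + ∑ l, (christoffel G k k l y * christoffel G l i j y
        - christoffel G k j l y * christoffel G l i k y))

/-- The trace `g^{ij} T_{ij}`. -/
def metricTrace (G T : Matrix ι ι ℝ) : ℝ :=
  ∑ i, ∑ j, G⁻¹ i j * T i j

/-- The Schouten tensor `P = 1/(n-2) (Ric - Scal/(2(n-1)) g)`, where `n` is the dimension. -/
def schouten (G : (ι → ℝ) → Matrix ι ι ℝ) (y : ι → ℝ) : Matrix ι ι ℝ :=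
  (1 / ((Fintype.card ι : ℝ) - 2)) •
    (ricci G y
      - (metricTrace (G y) (ricci G y) / (2 * ((Fintype.card ι : ℝ) - 1))) • G y)

/-- The covariant derivative `∇_k V^i = ∂_k V^i + Γ^i_{kj} V^j` of a vector field. -/
def covDerivVec (G : (ι → ℝ) → Matrix ι ι ℝ) (V : (ι → ℝ) → ι → ℝ) (k i : ι)
    (y : ι → ℝ) : ℝ :=
  pderiv k (fun z => V z i) y + ∑ j, christoffel G i k j y * V y j

/-- The covariant derivative
`∇_k T_{ij} = ∂_k T_{ij} - Γ^l_{ki} T_{lj} - Γ^l_{kj} T_{il}` of a `(0,2)`-tensor field. -/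
def covDerivTensor (G T : (ι → ℝ) → Matrix ι ι ℝ) (k i j : ι) (y : ι → ℝ) : ℝ :=
  pderiv k (fun z => T z i j) y
    - ∑ l, (christoffel G l k i y * T y l j + christoffel G l k j y * T y i l)

/-- The divergence `∇_k T_i^k = g^{kl} ∇_k T_{il}` of a `(0,2)`-tensor field. -/
def divergence (G T : (ι → ℝ) → Matrix ι ι ℝ) (i : ι) (y : ι → ℝ) : ℝ :=
  ∑ k, ∑ l, (G y)⁻¹ k l * covDerivTensor G T k i l y

end Coordinates

/-! ## Tensor fields and distributions on a manifold, and their components in charts -/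

section Manifold

variable {n : ℕ} {M : Type*} [TopologicalSpace M] [ChartedSpace (EuclideanSpace ℝ (Fin n)) M]

/-- A (not necessarily smooth) field of bilinear forms on the tangent spaces of `M`. -/
abbrev TensorField (n : ℕ) (M : Type*) [TopologicalSpace M]
    [ChartedSpace (EuclideanSpace ℝ (Fin n)) M] : Type _ :=
  ∀ x : M, LinearMap.BilinForm ℝ (TangentSpace (𝓡 n) x)

/-- A (not necessarily smooth) field of linear subspaces of the tangent spaces of `M`. -/
abbrev SubspaceField (n : ℕ) (M : Type*) [TopologicalSpace M]
    [ChartedSpace (EuclideanSpace ℝ (Fin n)) M] : Type _ :=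
  ∀ x : M, Submodule ℝ (TangentSpace (𝓡 n) x)

/-- The coordinate charts of `M`. -/
abbrev Chart (n : ℕ) (M : Type*) [TopologicalSpace M] : Type _ :=
  OpenPartialHomeomorph M (EuclideanSpace ℝ (Fin n))

/-- The open subset of `ℝⁿ` on which the coordinates of the chart `e` live. -/
def domain (e : Chart n M) : Set (Fin n → ℝ) :=
  {y | WithLp.toLp 2 y ∈ e.target}

/-- The point of `M` with coordinates `y` in the chart `e`. -/
def point (e : Chart n M) (y : Fin n → ℝ) : M :=
  e.symm (WithLp.toLp 2 y)

/-- The tangent vector `v^i ∂_i` at the point with coordinates `y` in the chart `e`. -/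
def coordVec (e : Chart n M) (y v : Fin n → ℝ) : TangentSpace (𝓡 n) (point e y) :=
  mfderiv (𝓡 n) (𝓡 n) e.symm (WithLp.toLp 2 y) (WithLp.toLp 2 v)

/-- The components `T_{ij} = T(∂_i, ∂_j)` in the chart `e`. -/
def comp (e : Chart n M) (T : TensorField n M) (y : Fin n → ℝ) : Matrix (Fin n) (Fin n) ℝ :=
  Matrix.of fun i j =>
    T (point e y) (coordVec e y (Pi.single i 1)) (coordVec e y (Pi.single j 1))

/-- `g` is a smooth pseudo-Riemannian metric on `M`. -/
structure IsPseudoRiemannian (g : TensorField n M) : Prop where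
  symm : ∀ x v w, g x v w = g x w v
  nondegenerate : ∀ x v, (∀ w, g x v w = 0) → v = 0
  smooth : ∀ e ∈ atlas (EuclideanSpace ℝ (Fin n)) M, ∀ i j,
    ContDiffOn ℝ ∞ (fun y => comp e g y i j) (domain e)

/-- `N` is a smooth vector distribution of rank `p`: locally it has a smooth frame of `p` vector
fields. -/
def IsSmoothDistribution (N : SubspaceField n M) (p : ℕ) : Prop :=
  ∀ e ∈ atlas (EuclideanSpace ℝ (Fin n)) M, ∀ y₀ ∈ domain e,
    ∃ W : Set (Fin n → ℝ), IsOpen W ∧ y₀ ∈ W ∧ W ⊆ domain e ∧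
      ∃ V : Fin p → (Fin n → ℝ) → (Fin n → ℝ),
        (∀ a, ContDiffOn ℝ ∞ (V a) W) ∧
        ∀ y ∈ W, LinearIndependent ℝ (fun a => V a y) ∧
          ∀ v, coordVec e y v ∈ N (point e y) ↔
            v ∈ Submodule.span ℝ (Set.range fun a => V a y)

/-- `N` is totally null for `g`. -/
def IsTotallyNull (g : TensorField n M) (N : SubspaceField n M) : Prop :=
  ∀ x, ∀ v ∈ N x, ∀ w ∈ N x, g x v w = 0

/-- `N` is parallel for the Levi-Civita connection of `g`: covariant derivatives of local smooth
sections of `N` are again sections of `N`. -/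
def IsParallel (g : TensorField n M) (N : SubspaceField n M) : Prop :=
  ∀ e ∈ atlas (EuclideanSpace ℝ (Fin n)) M, ∀ W : Set (Fin n → ℝ), IsOpen W → W ⊆ domain e →
    ∀ V : (Fin n → ℝ) → (Fin n → ℝ), ContDiffOn ℝ ∞ V W →
      (∀ y ∈ W, coordVec e y (V y) ∈ N (point e y)) →
      ∀ y ∈ W, ∀ k, coordVec e y (fun i => covDerivVec (comp e g) V k i y) ∈ N (point e y)

/-- The image of the symmetric `(0,2)`-tensor with components `T e y` in the chart `e`, that is, of
the endomorphism `v^i ↦ g^{kl} T_{li} v^i`, is contained in `N`. -/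
def ImageIn (g : TensorField n M) (N : SubspaceField n M)
    (T : Chart n M → (Fin n → ℝ) → Matrix (Fin n) (Fin n) ℝ) : Prop :=
  ∀ e ∈ atlas (EuclideanSpace ℝ (Fin n)) M, ∀ y ∈ domain e, ∀ v : Fin n → ℝ,
    coordVec e y (((comp e g y)⁻¹ * T e y).mulVec v) ∈ N (point e y)

/-- The `(0,2)`-tensor with components `T e y` in the chart `e` is divergence-free for `g`. -/
def DivergenceFree (g : TensorField n M)
    (T : Chart n M → (Fin n → ℝ) → Matrix (Fin n) (Fin n) ℝ) : Prop :=
  ∀ e ∈ atlas (EuclideanSpace ℝ (Fin n)) M, ∀ y ∈ domain e, ∀ i,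
    divergence (comp e g) (T e) i y = 0

/-- `g` is a null Ricci Walker metric with parallel null distribution `N` of rank `p`. -/
structure IsNullRicciWalker (g : TensorField n M) (N : SubspaceField n M) (p : ℕ) : Prop where
  metric : IsPseudoRiemannian g
  rank_pos : 0 < p
  distribution : IsSmoothDistribution N p
  null : IsTotallyNull g N
  parallel : IsParallel g N
  schouten_image : ImageIn g N (fun e => schouten (comp e g))

/-! ## The ambient metric

`G ρ` is a one-parameter family of bilinear forms on `M`; the associated metric on
`(0,∞) × M × (-ε,ε)` is `2 dt d(ρt) + t² G ρ`. A chart `e` of `M` gives the coordinates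
`(t, x, ρ)`, indexed by `Unit ⊕ Fin n ⊕ Unit`. -/

/-- The point with coordinates `(t, y, ρ)`. -/
def ambientPoint (t : ℝ) (y : Fin n → ℝ) (ρ : ℝ) : Unit ⊕ Fin n ⊕ Unit → ℝ :=
  Sum.elim (fun _ => t) (Sum.elim y (fun _ => ρ))

/-- The components of
`2 dt d(ρt) + t² G ρ = 2ρ dt² + 2t dt dρ + t² (G ρ)_{ij} dx^i dx^j`. -/
def ambientComp (e : Chart n M) (G : ℝ → TensorField n M) (z : Unit ⊕ Fin n ⊕ Unit → ℝ) :
    Matrix (Unit ⊕ Fin n ⊕ Unit) (Unit ⊕ Fin n ⊕ Unit) ℝ :=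
  let t : ℝ := z (Sum.inl ())
  let y : Fin n → ℝ := fun i => z (Sum.inr (Sum.inl i))
  let ρ : ℝ := z (Sum.inr (Sum.inr ()))
  Matrix.of fun a b =>
    match a, b with
    | Sum.inl _, Sum.inl _ => 2 * ρ
    | Sum.inl _, Sum.inr (Sum.inr _) => t
    | Sum.inr (Sum.inr _), Sum.inl _ => t
    | Sum.inr (Sum.inl i), Sum.inr (Sum.inl j) => t ^ 2 * comp e (G ρ) y i j
    | _, _ => 0

/-- The components of the Ricci tensor of `2 dt d(ρt) + t² G ρ` at `(t, y, ρ)`. -/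
def ambientRicci (e : Chart n M) (G : ℝ → TensorField n M) (t : ℝ) (y : Fin n → ℝ) (ρ : ℝ) :
    Matrix (Unit ⊕ Fin n ⊕ Unit) (Unit ⊕ Fin n ⊕ Unit) ℝ :=
  ricci (ambientComp e G) (ambientPoint t y ρ)

/-- `∂_ρ^k Ric` of `2 dt d(ρt) + t² G ρ` vanishes along `ρ = 0`. For `Ric` smooth,
`Ric = O(ρ^m)` means that this holds for all `k < m`. -/
def RicciDerivVanishes (G : ℝ → TensorField n M) (k : ℕ) : Prop :=
  ∀ e ∈ atlas (EuclideanSpace ℝ (Fin n)) M, ∀ t : ℝ, 0 < t → ∀ y ∈ domain e, ∀ a b,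
    iteratedDeriv k (fun ρ => ambientRicci e G t y ρ a b) 0 = 0

/-- The components of `(ρ^{1-n/2} Ric|_{TM ⊗ TM})|_{ρ=0}` for `n` even, at `(t, y)`: the Taylor
coefficient of order `n/2 - 1` in `ρ` of the `TM ⊗ TM` part of the Ricci tensor of
`2 dt d(ρt) + t² G ρ`. -/
def leadingRicci (e : Chart n M) (G : ℝ → TensorField n M) (t : ℝ) (y : Fin n → ℝ) :
    Matrix (Fin n) (Fin n) ℝ :=
  Matrix.of fun i j =>
    ((n / 2 - 1).factorial : ℝ)⁻¹ * iteratedDeriv (n / 2 - 1)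
      (fun ρ => ambientRicci e G t y ρ (Sum.inr (Sum.inl i)) (Sum.inr (Sum.inl j))) 0

/-- `2 dt d(ρt) + t² G ρ` is a metric on `(0,∞) × M × (-ε,ε)` with `G 0 = g` which solves the
Fefferman-Graham equations: `Ric = O(ρ^∞)` for `n` odd and `Ric = O(ρ^{n/2-1})` for `n` even. -/
structure SolvesFeffermanGraham (g : TensorField n M) (ε : ℝ) (G : ℝ → TensorField n M) :
    Prop where
  initial : G 0 = g
  symm : ∀ ρ ∈ Set.Ioo (-ε) ε, ∀ x v w, G ρ x v w = G ρ x w v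
  nondegenerate : ∀ ρ ∈ Set.Ioo (-ε) ε, ∀ x v, (∀ w, G ρ x v w = 0) → v = 0
  smooth : ∀ e ∈ atlas (EuclideanSpace ℝ (Fin n)) M, ∀ i j,
    ContDiffOn ℝ ∞ (fun q : ℝ × (Fin n → ℝ) => comp e (G q.1) q.2 i j)
      (Set.Ioo (-ε) ε ×ˢ domain e)
  ricci_odd : Odd n → ∀ k, RicciDerivVanishes G k
  ricci_even : Even n → ∀ k < n / 2 - 1, RicciDerivVanishes G k

/-- `2 dt d(ρt) + t² G ρ` on `(0,∞) × M × (-ε,ε)` is an ambient metric in normal form with respect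
to `g`: for `n` even, `ρ^{1-n/2} Ric|_{TM ⊗ TM}` is in addition trace-free along `ρ = 0`. -/
structure IsAmbientMetric (g : TensorField n M) (ε : ℝ) (G : ℝ → TensorField n M) : Prop
    extends SolvesFeffermanGraham g ε G where
  trace_even : Even n → ∀ e ∈ atlas (EuclideanSpace ℝ (Fin n)) M, ∀ t : ℝ, 0 < t →
    ∀ y ∈ domain e, metricTrace (comp e g y) (leadingRicci e G t y) = 0

/-- The components of the obstruction tensor `c (ρ^{1-n/2} Ric|_{TM ⊗ TM})|_{ρ=0}` (`n` even) with
normalising constant `c`, where `TM` is embedded at `t = 1`, `ρ = 0`. -/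
def obstruction (c : ℝ) (G : ℝ → TensorField n M) (e : Chart n M) (y : Fin n → ℝ) :
    Matrix (Fin n) (Fin n) ℝ :=
  c • leadingRicci e G 1 y

/-- The components of `∂_ρ^m H|_{ρ=0}`, the coefficient of `ρ^m / m!` in the Taylor expansion at
`ρ = 0` of a family `H ρ` of bilinear forms. -/
def taylorCoeff (H : ℝ → TensorField n M) (m : ℕ) (e : Chart n M) (y : Fin n → ℝ) :
    Matrix (Fin n) (Fin n) ℝ :=
  Matrix.of fun i j => iteratedDeriv m (fun ρ => comp e (H ρ) y i j) 0

end Manifold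

end AmbientWalker

end

/-!
Let `g` be a null Ricci Walker metric with distribution `N`, and `g(ρ) = g + h(ρ)`. In a chart the
family is regarded as a matrix `g₁ = g + g S` over the commutative ring `R` of smooth functions on
`(0, ∞) × W × (-ε, ε)`, with the commuting derivations `∂_t, ∂_i, ∂_ρ`. All the geometry is done
over an abstract ring with commuting derivations. This has the advantage that "up to terms of
order `ρ^k`" becomes equality in the quotient by the ideal `vanIdeal ∂_ρ Z k` of functions
vanishing to order `k` along `ρ = 0`, which is again a ring with the derivations `∂_i`.

Call an endomorphism null if it is `g`-symmetric with image in `N`. Since `N` is totally null,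
null endomorphisms compose to zero and are trace-free, and since `N` is parallel, their covariant
derivatives are null. So if `S` is null, then `g + g S` has inverse `g⁻¹ - S g⁻¹`, and the
difference of the Levi-Civita connections of `g + g S` and `g` is explicit and changes neither
traces nor divergences of null tensors. The central fact is `nullEnd_ric_add_diffConn`: if
moreover `S` is divergence-free and `Ric g` is null, then `Ric (g + g S)` is null. Its reason is
that the terms which could leave `N` are either products of null endomorphisms or, after commuting
covariant derivatives (`sum_hess`), contractions `S^{kp} R_{kipj}`, which are null because the
curvature preserves the orthogonal complement of `N`. The scalar curvature of `g` vanishes, so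
that the hypothesis on the Schouten tensor is the same as one on the Ricci tensor
(`ricci_image_of_schouten_image`).

The components of the Ricci tensor of `2 dt d(ρt) + t² g(ρ)` are computed in `IsAmbient.ric_t`,
`IsAmbient.ric_ij`, `IsAmbient.ric_ir` and `IsAmbient.ric_rr`. With `' = ∂_ρ` they are

* `ρ g'' - ρ g' g⁻¹ g' + ½ ρ tr(g⁻¹ g') g' - (n/2 - 1) g' - ½ tr(g⁻¹ g') g + Ric g` in the
  directions of `M`,
* half of `div(g⁻¹ g') - d tr(g⁻¹ g')` in the mixed directions, and an expression in the trace of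
  `g⁻¹ g'`, its derivative and the trace of `(g⁻¹ g')²` in the direction `ρρ`.

*Every solution is null.* Suppose `S` is null and divergence-free modulo order `k + 1` and the
equations hold modulo order `k + 1` (`IsFGFamily.step`). The trace of the first equation along
`ρ = 0`, the `ρρ` equation and the fact that null endomorphisms compose to zero give `tr(g⁻¹ g') = 0`
modulo order `k + 1`. By the central fact applied in the quotient ring, the part of the first
equation transverse to `N` then reads `(ρ ∂_ρ - (n/2 - 1)) X = 0`, where `X` is the derivative of
the transverse part of `S`. The indicial operator `ρ ∂_ρ - (n/2 - 1)` is injective on Taylor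
coefficients below the order `n/2 - 1`, so `S` is null to one order more. The mixed equation then
says that `S` is also divergence-free to one order more. If `n` is odd, `n/2 - 1` is not an
integer and the induction never stops; if `n` is even, it stops at the critical order `n/2 - 1`,
where the indicial operator kills the leading coefficient of `X`, so that what remains of the
equation, the obstruction, is null (`IsFGFamily.obstruction_mem`).

*A null ambient metric for even `n`.* If `S` is exactly null and divergence-free, the equations
reduce to the first one, which becomes `ρ g'' - (n/2 - 1) g' + Ric g = 0`
(`IsFGFamily.ambBlock_eq_of_null`, `IsFGFamily.ambRic_eq_zero`). It is solved to order `n/2 - 1`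
by adding terms `ρ^(k+1) c` to a polynomial in `ρ`, where `c` is a nonzero multiple of the `k`-th
derivative of `Ric g(ρ)` at `ρ = 0`. This coefficient is null by the central fact, divergence-free
by the contracted Bianchi identity (`two_mul_divg_ric`), and globally defined because the Ricci
tensor is covariant under coordinate changes (`isTensorial_ricci`). So the perturbation remains
null and divergence-free. The remaining Ricci tensor is null, hence trace-free, which is the last
condition for an ambient metric in normal form.
-/

open Matrix

set_option linter.unusedSectionVars false
set_option linter.unusedSimpArgs false

noncomputable section

namespace AmbientWalker

/-! ### Riemannian geometry over a ring with commuting derivations -/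

section Algebra

variable {ι R : Type*} [Fintype ι] [DecidableEq ι] [CommRing R] [Algebra ℝ R]

/-- The entrywise derivative of a matrix. -/
def dmat (δ : Derivation ℝ R R) (A : Matrix ι ι R) : Matrix ι ι R := A.map δ

@[simp] lemma dmat_apply (δ : Derivation ℝ R R) (A : Matrix ι ι R) (i j : ι) :
    dmat δ A i j = δ (A i j) := rfl

lemma dmat_mul (δ : Derivation ℝ R R) (A B : Matrix ι ι R) :
    dmat δ (A * B) = dmat δ A * B + A * dmat δ B := by
  ext i j
  simp only [dmat_apply, mul_apply, Matrix.add_apply, map_sum, Derivation.leibniz, smul_eq_mul,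
    ← Finset.sum_add_distrib]
  exact Finset.sum_congr rfl fun k _ => by ring

lemma dmat_add (δ : Derivation ℝ R R) (A B : Matrix ι ι R) :
    dmat δ (A + B) = dmat δ A + dmat δ B := by
  ext i j; simp

lemma dmat_sub (δ : Derivation ℝ R R) (A B : Matrix ι ι R) :
    dmat δ (A - B) = dmat δ A - dmat δ B := by
  ext i j; simp

lemma dmat_transpose (δ : Derivation ℝ R R) (A : Matrix ι ι R) :
    dmat δ Aᵀ = (dmat δ A)ᵀ := by
  ext i j; simp

lemma dmat_one (δ : Derivation ℝ R R) : dmat δ (1 : Matrix ι ι R) = 0 := by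
  ext i j
  by_cases h : i = j <;> simp [h]

/-- Connection matrices `(Γ k) i j = Γ^i_{kj}` of the Levi-Civita connection of the metric `g`:
torsion-free and compatible with `g`. -/
structure IsLeviCivita (D : ι → Derivation ℝ R R) (g : Matrix ι ι R) (Γ : ι → Matrix ι ι R) :
    Prop where
  symm : ∀ k i j, Γ k i j = Γ j i k
  compat : ∀ k, dmat (D k) g = (Γ k)ᵀ * g + g * Γ k

/-- The Christoffel symbols of `g`, with inverse `gi`, as connection matrices. -/
def chr (D : ι → Derivation ℝ R R) (g gi : Matrix ι ι R) (k : ι) : Matrix ι ι R :=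
  Matrix.of fun i j =>
    (1 / 2 : ℝ) • ∑ l, gi i l * (D k (g j l) + D j (g k l) - D l (g k j))

/-- The curvature matrices `∂_k Γ_l - ∂_l Γ_k + [Γ_k, Γ_l]` of a connection. -/
def curv (D : ι → Derivation ℝ R R) (Γ : ι → Matrix ι ι R) (k l : ι) : Matrix ι ι R :=
  dmat (D k) (Γ l) - dmat (D l) (Γ k) + Γ k * Γ l - Γ l * Γ k

/-- The Ricci tensor `Ric_ij = R^k_{i k j}` of a connection. -/
def ric (D : ι → Derivation ℝ R R) (Γ : ι → Matrix ι ι R) : Matrix ι ι R :=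
  Matrix.of fun i j => ∑ k, curv D Γ k j k i

/-- The covariant derivative `∂_k A + [Γ_k, A]` of a field of endomorphisms. -/
def cov (D : ι → Derivation ℝ R R) (Γ : ι → Matrix ι ι R) (k : ι) (A : Matrix ι ι R) :
    Matrix ι ι R :=
  dmat (D k) A + Γ k * A - A * Γ k

/- `R` is an `ℝ`-algebra, so that `2` can be cancelled without further assumptions. -/
lemma half_smul_mul_two (a : R) : (1 / 2 : ℝ) • (2 * a) = a := by
  rw [two_mul, ← two_smul ℝ a, smul_smul]; norm_num

lemma eq_of_two_mul_eq {a b : R} (h : 2 * a = 2 * b) : a = b := by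
  rw [← half_smul_mul_two a, h, half_smul_mul_two]

/-- The Koszul formula. -/
lemma IsLeviCivita.koszul {D : ι → Derivation ℝ R R} {g : Matrix ι ι R} {Γ : ι → Matrix ι ι R}
    (hg : gᵀ = g) (h : IsLeviCivita D g Γ) (k i j : ι) :
    2 * (g * Γ k) i j = D k (g i j) + D j (g i k) - D i (g k j) := by
  have hc : ∀ k i j, D k (g i j) = (g * Γ k) j i + (g * Γ k) i j := by
    intro k i j
    have := congrFun (congrFun (h.compat k) i) j
    have h2 : (Γ k)ᵀ * g = (g * Γ k)ᵀ := by rw [transpose_mul, hg]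
    rw [h2] at this
    exact this
  have hs : ∀ k i j, (g * Γ k) i j = (g * Γ j) i k := by
    intro k i j
    simp only [mul_apply]
    exact Finset.sum_congr rfl fun m _ => by rw [h.symm k m j]
  rw [hc k i j, hc j i k, hc i k j, hs k j i, hs j k i, hs j i k]
  ring

/-- A metric has at most one Levi-Civita connection. Here `gi` is the inverse of `g`. -/
lemma IsLeviCivita.unique {D : ι → Derivation ℝ R R} {g gi : Matrix ι ι R}
    {Γ Γ' : ι → Matrix ι ι R} (hg : gᵀ = g) (hgi : gi * g = 1) (h : IsLeviCivita D g Γ)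
    (h' : IsLeviCivita D g Γ') : Γ = Γ' := by
  funext k
  have : g * Γ k = g * Γ' k := by
    ext i j
    exact eq_of_two_mul_eq ((h.koszul hg k i j).trans (h'.koszul hg k i j).symm)
  calc Γ k = gi * (g * Γ k) := by rw [← mul_assoc, hgi, one_mul]
    _ = gi * (g * Γ' k) := by rw [this]
    _ = Γ' k := by rw [← mul_assoc, hgi, one_mul]

lemma isLeviCivita_chr (D : ι → Derivation ℝ R R) {g gi : Matrix ι ι R} (hg : gᵀ = g)
    (hgi : g * gi = 1) : IsLeviCivita D g (chr D g gi) := by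
  have hs : ∀ i j, g i j = g j i := fun i j => by conv_lhs => rw [← hg, transpose_apply]
  -- lowering the upper index turns the definition of the symbols into the Koszul formula
  have hlow : ∀ k i j, (g * chr D g gi k) i j =
      (1 / 2 : ℝ) • (D k (g i j) + D j (g i k) - D i (g k j)) := by
    intro k i j
    set u : Matrix ι ι R := Matrix.of fun l _ => D k (g j l) + D j (g k l) - D l (g k j) with hu
    have : (g * chr D g gi k) i j = (1 / 2 : ℝ) • (g * (gi * u)) i i := by
      rw [mul_apply, mul_apply, Finset.smul_sum]
      refine Finset.sum_congr rfl fun m _ => ?_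
      simp [chr, hu, mul_apply]
    rw [this, ← mul_assoc, hgi, one_mul, hu, of_apply, hs j i, hs k i]
  refine ⟨fun k i j => ?_, fun k => ?_⟩
  · simp only [chr, of_apply]
    congr 1
    refine Finset.sum_congr rfl fun l _ => ?_
    rw [hs k j]; ring
  · ext i j
    have h2 : (chr D g gi k)ᵀ * g = (g * chr D g gi k)ᵀ := by rw [transpose_mul, hg]
    rw [h2, Matrix.add_apply, transpose_apply, hlow, hlow, dmat_apply, ← smul_add, hs j i, hs k j,
      hs i k]
    conv_lhs => rw [← half_smul_mul_two (D k (g i j))]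
    congr 1
    ring

section Connection

variable {D : ι → Derivation ℝ R R} {g gi : Matrix ι ι R} {Γ : ι → Matrix ι ι R}

lemma dmat_inv (hgi : gi * g = 1) (hgi' : g * gi = 1) (h : IsLeviCivita D g Γ) (k : ι) :
    dmat (D k) gi = -(gi * (Γ k)ᵀ) - Γ k * gi := by
  have h1 : dmat (D k) gi * g + gi * dmat (D k) g = 0 := by
    rw [← dmat_mul, hgi, dmat_one]
  have h2 : dmat (D k) gi = -(gi * dmat (D k) g * gi) := by
    calc dmat (D k) gi = (dmat (D k) gi * g) * gi := by rw [mul_assoc, hgi', mul_one]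
      _ = -(gi * dmat (D k) g) * gi := by rw [eq_neg_of_add_eq_zero_left h1]
      _ = _ := by rw [neg_mul]
  rw [h2, h.compat]
  have : gi * ((Γ k)ᵀ * g + g * Γ k) * gi = gi * (Γ k)ᵀ * (g * gi) + (gi * g) * Γ k * gi := by
    noncomm_ring
  rw [this, hgi, hgi']
  noncomm_ring

lemma curv_antisymm (k l : ι) : curv D Γ l k = - curv D Γ k l := by
  simp only [curv]; noncomm_ring

lemma dmat_comm (hD : ∀ i j a, D i (D j a) = D j (D i a)) (k l : ι) (A : Matrix ι ι R) :
    dmat (D k) (dmat (D l) A) = dmat (D l) (dmat (D k) A) := by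
  ext i j; exact hD _ _ _

/-- The Ricci identity for endomorphisms. -/
lemma cov_cov_sub (hD : ∀ i j a, D i (D j a) = D j (D i a)) (k l : ι) (A : Matrix ι ι R) :
    cov D Γ k (cov D Γ l A) - cov D Γ l (cov D Γ k A) = curv D Γ k l * A - A * curv D Γ k l := by
  simp only [cov, curv, dmat_add, dmat_sub, dmat_mul, dmat_comm hD k l A]
  noncomm_ring

lemma second_bianchi (hD : ∀ i j a, D i (D j a) = D j (D i a)) (k l m : ι) :
    cov D Γ m (curv D Γ k l) + cov D Γ k (curv D Γ l m) + cov D Γ l (curv D Γ m k) = 0 := by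
  simp only [cov, curv, dmat_add, dmat_sub, dmat_mul]
  rw [dmat_comm hD m k (Γ l), dmat_comm hD m l (Γ k), dmat_comm hD k l (Γ m)]
  noncomm_ring

lemma first_bianchi (hs : ∀ k i j, Γ k i j = Γ j i k) (k l m p : ι) :
    curv D Γ k l p m + curv D Γ l m p k + curv D Γ m k p l = 0 := by
  have h1 : ∀ k l m, (Γ k * Γ l) p m = (Γ k * Γ m) p l := by
    intro k l m
    simp only [mul_apply]
    exact Finset.sum_congr rfl fun q _ => by rw [hs l q m]
  simp only [curv, Matrix.add_apply, Matrix.sub_apply, dmat_apply]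
  rw [hs l p m, hs k p m, hs k p l, h1 k l m, h1 l k m, h1 m l k]
  ring

/-- Metric compatibility makes the curvature skew for the metric. -/
lemma curv_skew (hg : gᵀ = g) (hD : ∀ i j a, D i (D j a) = D j (D i a))
    (h : IsLeviCivita D g Γ) (k l : ι) :
    (g * curv D Γ k l)ᵀ = -(g * curv D Γ k l) := by
  have h1 := dmat_comm hD k l g
  rw [h.compat k, h.compat l, dmat_add, dmat_add, dmat_mul, dmat_mul, dmat_mul, dmat_mul,
    h.compat k, h.compat l, dmat_transpose, dmat_transpose] at h1
  rw [transpose_mul, hg, eq_neg_iff_add_eq_zero]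
  simp only [curv, transpose_add, transpose_sub, transpose_mul]
  rw [← sub_eq_zero] at h1
  rw [← h1]
  noncomm_ring

/-- Pair symmetry of the Riemann tensor. -/
lemma curv_pair (hg : gᵀ = g) (hD : ∀ i j a, D i (D j a) = D j (D i a))
    (h : IsLeviCivita D g Γ) (i j k l : ι) :
    (g * curv D Γ k l) i j = (g * curv D Γ i j) k l := by
  have ha : ∀ k l i j, (g * curv D Γ k l) i j = -(g * curv D Γ l k) i j := by
    intro k l i j
    rw [curv_antisymm k l, mul_neg, Matrix.neg_apply, neg_neg]
  have hb : ∀ k l i j, (g * curv D Γ k l) i j = -(g * curv D Γ k l) j i := by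
    intro k l i j
    have := congrFun (congrFun (curv_skew hg hD h k l) j) i
    simpa using this
  have hc : ∀ p k l m, (g * curv D Γ k l) p m + (g * curv D Γ l m) p k
      + (g * curv D Γ m k) p l = 0 := by
    intro p k l m
    simp only [mul_apply, ← Finset.sum_add_distrib, ← mul_add]
    exact Finset.sum_eq_zero fun q _ => by rw [first_bianchi h.symm, mul_zero]
  -- the octahedron argument
  have e1 := hc i k l j
  have e2 := hc j k l i
  have e3 := hc k i j l
  have e4 := hc l i j k
  rw [hb k l j i] at e2
  rw [hb j l k i, ha j l i k, hb l i k j] at e3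
  rw [hb i j l k, hb j k l i, hb k i l j, ha k i j l] at e4
  apply eq_of_two_mul_eq
  linear_combination e1 - e2 - e3 + e4

end Connection

end Algebra

/-! ### Totally null parallel distributions -/

section Null

variable {ι R : Type*} [Fintype ι] [DecidableEq ι] [CommRing R] [Algebra ℝ R]

/-- The metric `g` with inverse `gi` and Levi-Civita connection `Γ` has a totally null parallel
distribution, given as the image of the projector `E`. -/
structure IsWalker (D : ι → Derivation ℝ R R) (g gi : Matrix ι ι R) (Γ : ι → Matrix ι ι R)
    (E : Matrix ι ι R) : Prop where
  comm : ∀ i j a, D i (D j a) = D j (D i a)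
  symm : gᵀ = g
  mul_inv : g * gi = 1
  inv_mul : gi * g = 1
  lc : IsLeviCivita D g Γ
  idem : E * E = E
  null : Eᵀ * g * E = 0
  parallel : ∀ k, E * (dmat (D k) E + Γ k * E) = dmat (D k) E + Γ k * E

/-- The endomorphism `S` is `g`-symmetric with image in the image of the projector `E`. -/
structure NullEnd (g E S : Matrix ι ι R) : Prop where
  image : E * S = S
  symm : (g * S)ᵀ = g * S

namespace NullEnd

variable {g E S S' : Matrix ι ι R}

lemma add (h : NullEnd g E S) (h' : NullEnd g E S') : NullEnd g E (S + S') :=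
  ⟨by rw [mul_add, h.image, h'.image], by rw [mul_add, transpose_add, h.symm, h'.symm]⟩

lemma sub (h : NullEnd g E S) (h' : NullEnd g E S') : NullEnd g E (S - S') :=
  ⟨by rw [mul_sub, h.image, h'.image], by rw [mul_sub, transpose_sub, h.symm, h'.symm]⟩

lemma smul (a : R) (h : NullEnd g E S) : NullEnd g E (a • S) :=
  ⟨by rw [Matrix.mul_smul, h.image], by rw [Matrix.mul_smul, transpose_smul, h.symm]⟩

lemma sum {α : Type*} {s : Finset α} {f : α → Matrix ι ι R} (h : ∀ a ∈ s, NullEnd g E (f a)) :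
    NullEnd g E (∑ a ∈ s, f a) := by
  constructor
  · rw [Matrix.mul_sum]; exact Finset.sum_congr rfl fun a ha => (h a ha).image
  · rw [Matrix.mul_sum, transpose_sum]; exact Finset.sum_congr rfl fun a ha => (h a ha).symm

end NullEnd

section

variable {D : ι → Derivation ℝ R R} {g gi E S S' : Matrix ι ι R} {Γ : ι → Matrix ι ι R}

lemma inv_symm_of_symm (hs : gᵀ = g) (hgi : g * gi = 1) : giᵀ = gi := by
  calc giᵀ = giᵀ * (g * gi) := by rw [hgi, mul_one]
    _ = (g * gi)ᵀ * gi := by rw [transpose_mul, hs]; noncomm_ring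
    _ = gi := by rw [hgi, transpose_one, one_mul]

lemma IsWalker.inv_symm (w : IsWalker D g gi Γ E) : giᵀ = gi := inv_symm_of_symm w.symm w.mul_inv

lemma NullEnd.transpose_eq (w : IsWalker D g gi Γ E) (h : NullEnd g E S) : Sᵀ * g = g * S := by
  rw [← h.symm, transpose_mul, w.symm]

lemma NullEnd.eq (w : IsWalker D g gi Γ E) (h : NullEnd g E S) : S = gi * Sᵀ * g := by
  rw [mul_assoc, h.transpose_eq w, ← mul_assoc, w.inv_mul, one_mul]

lemma NullEnd.mul_inv (w : IsWalker D g gi Γ E) (h : NullEnd g E S) : S * gi = gi * Sᵀ := by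
  conv_lhs => rw [h.eq w]
  rw [mul_assoc, w.mul_inv, mul_one]

lemma NullEnd.mul_proj (w : IsWalker D g gi Γ E) (h : NullEnd g E S) : S * E = 0 := by
  rw [h.eq w]
  nth_rw 1 [← h.image]
  rw [transpose_mul]
  calc gi * (Sᵀ * Eᵀ) * g * E = gi * Sᵀ * (Eᵀ * g * E) := by noncomm_ring
    _ = 0 := by rw [w.null, mul_zero]

/-- Two endomorphisms with image in a totally null distribution compose to zero. -/
lemma NullEnd.mul_eq_zero (w : IsWalker D g gi Γ E) (h : NullEnd g E S) {A : Matrix ι ι R}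
    (hA : E * A = A) : S * A = 0 := by
  rw [← hA, ← mul_assoc, h.mul_proj w, zero_mul]

lemma NullEnd.trace_eq_zero (w : IsWalker D g gi Γ E) (h : NullEnd g E S) : S.trace = 0 := by
  rw [← h.image, trace_mul_comm, h.mul_proj w, trace_zero]

/-- The columns of `gi * (1 - E)ᵀ` span the orthogonal complement of the distribution, on which
null endomorphisms vanish. -/
lemma NullEnd.mul_perp (w : IsWalker D g gi Γ E) (h : NullEnd g E S) :
    S * (gi * (1 - E)ᵀ) = 0 := by
  rw [← mul_assoc, h.mul_inv w, mul_assoc, ← transpose_mul, sub_mul, one_mul, h.image, sub_self,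
    transpose_zero, mul_zero]

/-- A symmetric bilinear form vanishing on the orthogonal complement of the distribution has
image in the distribution. -/
lemma nullEnd_of_perp (w : IsWalker D g gi Γ E) {T : Matrix ι ι R} (hT : Tᵀ = T)
    (h : T * (gi * (1 - E)ᵀ) = 0) : NullEnd g E (gi * T) := by
  constructor
  · have h2 : ((1 - E) * (gi * T)) = 0 := by
      rw [← transpose_eq_zero, transpose_mul, transpose_mul, hT, w.inv_symm, mul_assoc, h]
    rw [sub_mul, one_mul, sub_eq_zero] at h2
    exact h2.symm
  · rw [← mul_assoc, w.mul_inv, one_mul, hT]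

/-- The distribution being parallel, covariant derivatives of null endomorphisms are null. -/
lemma NullEnd.cov (w : IsWalker D g gi Γ E) (h : NullEnd g E S) (k : ι) :
    NullEnd g E (cov D Γ k S) := by
  constructor
  · have h1 : AmbientWalker.cov D Γ k S =
        (dmat (D k) E + Γ k * E) * S + E * dmat (D k) S - E * (S * Γ k) := by
      have : dmat (D k) S = dmat (D k) E * S + E * dmat (D k) S := by
        rw [← dmat_mul, h.image]
      calc AmbientWalker.cov D Γ k S
          = (dmat (D k) E * S + E * dmat (D k) S) + Γ k * (E * S) - (E * S) * Γ k := by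
            rw [← this, h.image, AmbientWalker.cov]
        _ = _ := by noncomm_ring
    rw [h1, mul_sub, mul_add, ← mul_assoc, w.parallel, ← mul_assoc E E, ← mul_assoc E E, w.idem]
  · have h1 : g * AmbientWalker.cov D Γ k S
        = dmat (D k) (g * S) - (Γ k)ᵀ * (g * S) - g * S * Γ k := by
      rw [AmbientWalker.cov, dmat_mul, w.lc.compat]; noncomm_ring
    rw [h1, transpose_sub, transpose_sub, ← dmat_transpose, transpose_mul (Γ k)ᵀ,
      transpose_mul (g * S), h.symm, transpose_transpose]
    noncomm_ring

/-- Curvature endomorphisms preserve the orthogonal complement of the distribution. -/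
lemma NullEnd.mul_curv_mul_perp (w : IsWalker D g gi Γ E) (h : NullEnd g E S) (k l : ι) :
    S * curv D Γ k l * (gi * (1 - E)ᵀ) = 0 := by
  have h1 := ((h.cov w l).cov w k).sub ((h.cov w k).cov w l)
  rw [cov_cov_sub w.comm] at h1
  -- by the Ricci identity, the curvature preserves the distribution
  have h2 : E * (curv D Γ k l * S) = curv D Γ k l * S := by
    have := h1.image
    rw [mul_sub, ← mul_assoc E S, h.image] at this
    exact sub_left_injective this
  have h3 : (1 - E) * curv D Γ k l * (S * gi) = 0 := by
    calc (1 - E) * curv D Γ k l * (S * gi)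
        = (curv D Γ k l * S - E * (curv D Γ k l * S)) * gi := by noncomm_ring
      _ = 0 := by rw [h2, sub_self, zero_mul]
  have h4 := curv_skew w.symm w.comm w.lc k l
  rw [transpose_mul, w.symm] at h4
  have h5 : curv D Γ k l * gi = - (gi * (curv D Γ k l)ᵀ) := by
    calc curv D Γ k l * gi = gi * (g * curv D Γ k l) * gi := by
          rw [← mul_assoc, w.inv_mul, one_mul]
      _ = gi * (-((curv D Γ k l)ᵀ * g)) * gi := by rw [h4, neg_neg]
      _ = -(gi * (curv D Γ k l)ᵀ * (g * gi)) := by noncomm_ring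
      _ = _ := by rw [w.mul_inv, mul_one]
  have h6 : Sᵀ = g * S * gi := by
    rw [← h.transpose_eq w, mul_assoc, w.mul_inv, mul_one]
  -- transposing, it preserves the orthogonal complement, as it is skew
  have h7 := congrArg transpose h3
  rw [transpose_mul, transpose_mul, transpose_zero, w.inv_symm, ← h.mul_inv w, transpose_mul] at h7
  calc S * curv D Γ k l * (gi * (1 - E)ᵀ) = S * (curv D Γ k l * gi) * (1 - E)ᵀ := by noncomm_ring
    _ = -(S * gi * ((curv D Γ k l)ᵀ * (1 - E)ᵀ)) := by rw [h5]; noncomm_ring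
    _ = 0 := by rw [h7, neg_zero]

end

end Null

/-! ### Perturbing the metric by a divergence-free null tensor -/

section Perturbation

variable {ι R : Type*} [Fintype ι] [DecidableEq ι] [CommRing R] [Algebra ℝ R]
  (D : ι → Derivation ℝ R R) (g gi : Matrix ι ι R) (Γ : ι → Matrix ι ι R) (S : Matrix ι ι R)

/-- The divergence `∇_k S^k_i` of an endomorphism. -/
def divg (i : ι) : R := ∑ k, cov D Γ k S k i

/-- For `S` null, the difference between the Levi-Civita connections of `g + g S` and of `g`. The
metric `g + g S` has inverse `gi - S gi`. -/
def diffConn (i : ι) : Matrix ι ι R :=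
  Matrix.of fun k j => (1 / 2 : ℝ) • (cov D Γ i S k j + cov D Γ j S k i
    - ∑ l, (gi - S * gi) k l * (g * cov D Γ l S) i j)

/-- The second covariant derivative `∇_k ∇_l S` of an endomorphism. -/
def hess (k l : ι) : Matrix ι ι R :=
  cov D Γ k (cov D Γ l S) - ∑ m, Γ k m l • cov D Γ m S

variable {D g gi Γ S} {E U : Matrix ι ι R}

lemma NullEnd.cov_symm_apply (w : IsWalker D g gi Γ E) (h : NullEnd g E S) (l i j : ι) :
    (g * AmbientWalker.cov D Γ l S) i j = (g * AmbientWalker.cov D Γ l S) j i := by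
  conv_lhs => rw [← (h.cov w l).symm, transpose_apply]

lemma NullEnd.perturb_mul_inv (w : IsWalker D g gi Γ E) (h : NullEnd g E S) :
    (g + g * S) * (gi - S * gi) = 1 := by
  calc (g + g * S) * (gi - S * gi) = g * gi - g * (S * S) * gi := by noncomm_ring
    _ = 1 := by rw [h.mul_eq_zero w h.image, w.mul_inv]; simp

lemma diffConn_symm (w : IsWalker D g gi Γ E) (h : NullEnd g E S) (k i j : ι) :
    diffConn D g gi Γ S k i j = diffConn D g gi Γ S j i k := by
  simp only [diffConn, of_apply]
  congr 1
  rw [add_comm]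
  congr 1
  exact Finset.sum_congr rfl fun l _ => by rw [h.cov_symm_apply w]

/-- `Γ + diffConn` is the Levi-Civita connection of `g + g S`. -/
lemma isLeviCivita_add_diffConn (w : IsWalker D g gi Γ E) (h : NullEnd g E S) :
    IsLeviCivita D (g + g * S) (fun k => Γ k + diffConn D g gi Γ S k) := by
  have hlow : ∀ k i j, ((g + g * S) * diffConn D g gi Γ S k) i j =
      (1 / 2 : ℝ) • ((g * cov D Γ k S) i j + (g * cov D Γ j S) i k - (g * cov D Γ i S) k j) := by
    intro k i j
    -- `S * cov D Γ l S = 0`, as both factors are null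
    have e : ∀ l, (g + g * S) * cov D Γ l S = g * cov D Γ l S := by
      intro l
      rw [add_mul, mul_assoc g S, h.mul_eq_zero w (h.cov w l).image, mul_zero, add_zero]
    set u : Matrix ι ι R := Matrix.of fun l _ => (g * cov D Γ l S) k j with hu
    set v : Matrix ι ι R := Matrix.of fun m _ => cov D Γ j S m k with hv
    have : ((g + g * S) * diffConn D g gi Γ S k) i j = (1 / 2 : ℝ) •
        (((g + g * S) * cov D Γ k S) i j + ((g + g * S) * v) i j
          - ((g + g * S) * ((gi - S * gi) * u)) i j) := by
      simp only [mul_apply (M := g + g * S), ← Finset.sum_add_distrib, ← Finset.sum_sub_distrib,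
        Finset.smul_sum]
      refine Finset.sum_congr rfl fun m _ => ?_
      rw [← mul_add, ← mul_sub, ← mul_smul_comm]
      simp only [diffConn, of_apply, hv, hu, mul_apply (M := gi - S * gi)]
    have hv' : ((g + g * S) * v) i j = (g * cov D Γ j S) i k := by
      rw [← e]
      simp only [mul_apply (M := g + g * S), hv, of_apply]
    rw [this, ← mul_assoc, h.perturb_mul_inv w, one_mul, e, hv', hu, of_apply]
  refine ⟨fun k i j => ?_, fun k => ?_⟩
  · simp only [Matrix.add_apply]
    rw [w.lc.symm k i j, diffConn_symm w h]
  · have hsym : (g + g * S)ᵀ = g + g * S := by rw [transpose_add, w.symm, h.symm]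
    have e1 : dmat (D k) (g + g * S)
        = (Γ k)ᵀ * (g + g * S) + (g + g * S) * Γ k + g * cov D Γ k S := by
      rw [dmat_add, dmat_mul, w.lc.compat, cov]; noncomm_ring
    have e2 : g * cov D Γ k S = ((g + g * S) * diffConn D g gi Γ S k)ᵀ
        + (g + g * S) * diffConn D g gi Γ S k := by
      ext i j
      rw [Matrix.add_apply, transpose_apply, hlow, hlow, ← smul_add, h.cov_symm_apply w k j i,
        h.cov_symm_apply w i j k, h.cov_symm_apply w j k i]
      conv_lhs => rw [← half_smul_mul_two ((g * cov D Γ k S) i j)]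
      congr 1
      ring
    rw [e1, e2, transpose_mul, hsym, transpose_add]
    noncomm_ring

/-- The metrics `g + g S` and `g` have the same volume form. -/
lemma trace_diffConn (w : IsWalker D g gi Γ E) (h : NullEnd g E S) (i : ι) :
    (diffConn D g gi Γ S i).trace = 0 := by
  have e : ∀ l, (gi - S * gi) * (g * cov D Γ l S) = cov D Γ l S := by
    intro l
    calc (gi - S * gi) * (g * cov D Γ l S)
        = gi * g * cov D Γ l S - S * (gi * g) * cov D Γ l S := by noncomm_ring
      _ = _ := by
        rw [w.inv_mul, one_mul, mul_one, h.mul_eq_zero w (h.cov w l).image, sub_zero]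
  have hP : (gi - S * gi)ᵀ = gi - S * gi :=
    inv_symm_of_symm (by rw [transpose_add, w.symm, h.symm]) (h.perturb_mul_inv w)
  have h3 : ∑ k, ∑ l, (gi - S * gi) k l * (g * cov D Γ l S) i k = ∑ k, cov D Γ k S k i := by
    rw [Finset.sum_comm]
    refine Finset.sum_congr rfl fun l _ => ?_
    conv_rhs => rw [← e l, mul_apply]
    refine Finset.sum_congr rfl fun k _ => ?_
    rw [h.cov_symm_apply w l i k]
    congr 1
    conv_lhs => rw [← hP, transpose_apply]
  have h4 := (h.cov w i).trace_eq_zero w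
  simp only [trace, diag_apply] at h4
  simp only [trace, diag_apply, diffConn, of_apply, ← Finset.smul_sum, Finset.sum_sub_distrib,
    Finset.sum_add_distrib, h3, h4]
  simp

lemma trace_mul_diffConn (w : IsWalker D g gi Γ E) (h : NullEnd g E S) (hU : NullEnd g E U)
    (i : ι) : (U * diffConn D g gi Γ S i).trace = 0 := by
  have h1 : (U * cov D Γ i S).trace = 0 := by
    rw [hU.mul_eq_zero w (h.cov w i).image, trace_zero]
  have h2 : ∀ j, (U * cov D Γ j S) j i = 0 := fun j => by
    rw [hU.mul_eq_zero w (h.cov w j).image, Matrix.zero_apply]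
  have h3 : ∀ l k, ∑ j, U j k * (g * cov D Γ l S) i j = 0 := by
    intro l k
    have : (g * cov D Γ l S * U) i k = 0 := by
      rw [mul_assoc, (h.cov w l).mul_eq_zero w hU.image, mul_zero, Matrix.zero_apply]
    rw [mul_apply] at this
    rw [← this]
    exact Finset.sum_congr rfl fun j _ => mul_comm _ _
  have h4 : (U * diffConn D g gi Γ S i).trace = (1 / 2 : ℝ) • ((U * cov D Γ i S).trace
      + ∑ j, (U * cov D Γ j S) j i
      - ∑ k, ∑ l, (gi - S * gi) k l * ∑ j, U j k * (g * cov D Γ l S) i j) := by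
    have e : ∑ k, ∑ l, (gi - S * gi) k l * ∑ j, U j k * (g * cov D Γ l S) i j =
        ∑ j, ∑ k, U j k * ∑ l, (gi - S * gi) k l * (g * cov D Γ l S) i j := by
      simp only [Finset.mul_sum]
      rw [Finset.sum_comm (γ := ι) (s := Finset.univ (α := ι)) (t := Finset.univ (α := ι))
        (f := fun j k => ∑ l, U j k * ((gi - S * gi) k l * (g * cov D Γ l S) i j))]
      refine Finset.sum_congr rfl fun k _ => ?_
      rw [Finset.sum_comm]
      exact Finset.sum_congr rfl fun l _ => Finset.sum_congr rfl fun j _ => by ring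
    rw [e]
    simp only [trace, diag_apply, mul_apply (M := U), ← Finset.sum_add_distrib,
      ← Finset.sum_sub_distrib, Finset.smul_sum]
    refine Finset.sum_congr rfl fun j _ => Finset.sum_congr rfl fun k _ => ?_
    rw [← mul_add, ← mul_sub, ← mul_smul_comm]
    simp only [diffConn, of_apply]
  rw [h4, h1]
  simp [h2, h3]

/-- On null tensors the divergences for `g + g S` and `g` agree. -/
lemma divg_add_diffConn (w : IsWalker D g gi Γ E) (h : NullEnd g E S) (hU : NullEnd g E U)
    (i : ι) : divg D (fun k => Γ k + diffConn D g gi Γ S k) U i = divg D Γ U i := by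
  have h1 : ∑ k, (diffConn D g gi Γ S k * U) k i = 0 := by
    simp only [mul_apply]
    rw [Finset.sum_comm]
    refine Finset.sum_eq_zero fun m _ => ?_
    rw [← Finset.sum_mul]
    have := trace_diffConn w h m
    simp only [trace, diag_apply] at this
    rw [Finset.sum_congr rfl fun k _ => diffConn_symm w h k k m, this, zero_mul]
  have h2 : ∑ k, (U * diffConn D g gi Γ S k) k i = 0 := by
    have := trace_mul_diffConn w h hU i
    simp only [trace, diag_apply] at this
    rw [← this]
    refine Finset.sum_congr rfl fun k _ => ?_
    simp only [mul_apply]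
    exact Finset.sum_congr rfl fun m _ => by rw [diffConn_symm w h]
  simp only [divg, cov, add_mul, mul_add, Matrix.add_apply, Matrix.sub_apply,
    Finset.sum_add_distrib, Finset.sum_sub_distrib, h1, h2]
  simp

end Perturbation

/-! ### The Ricci tensor of the perturbed metric -/

section RicciPerturbation

variable {ι R : Type*} [Fintype ι] [DecidableEq ι] [CommRing R] [Algebra ℝ R]
  {D : ι → Derivation ℝ R R} {g gi : Matrix ι ι R} {Γ : ι → Matrix ι ι R} {S : Matrix ι ι R}
  {E U : Matrix ι ι R}

/-- Change of the Ricci tensor under a symmetric trace-free change `C` of the connection. -/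
lemma ric_add {C : ι → Matrix ι ι R}
    (hC : ∀ k i j, C k i j = C j i k) (htr : ∀ i, (C i).trace = 0) (i j : ι) :
    ric D (fun k => Γ k + C k) i j = ric D Γ i j + ∑ k, cov D Γ k (C j) k i
      - (Γ j * C i).trace - (C j * C i).trace := by
  have h0 : ∀ k l, curv D (fun k => Γ k + C k) k l
      = curv D Γ k l + cov D Γ k (C l) - cov D Γ l (C k) + C k * C l - C l * C k := by
    intro k l
    simp only [curv, cov, dmat_add]
    noncomm_ring
  have htr' : ∀ m, ∑ k, C k k m = 0 := by
    intro m
    rw [← htr m]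
    simp only [trace, diag_apply]
    exact Finset.sum_congr rfl fun k _ => hC _ _ _
  have hz : ∀ A : Matrix ι ι R, ∀ a, ∑ k, (C k * A) k a = 0 := by
    intro A a
    simp only [mul_apply]
    rw [Finset.sum_comm]
    refine Finset.sum_eq_zero fun m _ => ?_
    rw [← Finset.sum_mul, htr', zero_mul]
  have ht : ∀ A : Matrix ι ι R, ∑ k, (A * C k) k i = (A * C i).trace := by
    intro A
    simp only [trace, diag_apply, mul_apply]
    exact Finset.sum_congr rfl fun k _ => Finset.sum_congr rfl fun m _ => by rw [hC]
  have hd : ∑ k, (dmat (D j) (C k)) k i = 0 := by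
    simp only [dmat_apply]
    rw [← map_sum, htr', map_zero]
  have h1 : ∑ k, cov D Γ j (C k) k i = (Γ j * C i).trace := by
    simp only [cov, Matrix.add_apply, Matrix.sub_apply, Finset.sum_add_distrib,
      Finset.sum_sub_distrib, hd, ht, hz]
    ring
  simp only [ric, of_apply, h0, Matrix.add_apply, Matrix.sub_apply, Finset.sum_add_distrib,
      Finset.sum_sub_distrib, h1, ht, hz]
  ring

/-- The Ricci tensor of a Levi-Civita connection is symmetric. -/
lemma ric_symm (hg : gᵀ = g) (hgi : gi * g = 1) (hgi' : g * gi = 1)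
    (hD : ∀ i j a, D i (D j a) = D j (D i a))
    (h : IsLeviCivita D g Γ) : (ric D Γ)ᵀ = ric D Γ := by
  have e : ∀ i j, ric D Γ i j = ∑ k, ∑ p, gi k p * (g * curv D Γ k j) p i := by
    intro i j
    simp only [ric, of_apply]
    refine Finset.sum_congr rfl fun k _ => ?_
    conv_lhs => rw [← one_mul (curv D Γ k j), ← hgi, mul_assoc, mul_apply]
  have hs : ∀ k p, gi k p = gi p k := fun k p => by
    conv_lhs => rw [← inv_symm_of_symm hg hgi', transpose_apply]
  ext i j
  rw [transpose_apply, e, e, Finset.sum_comm]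
  refine Finset.sum_congr rfl fun p _ => Finset.sum_congr rfl fun k _ => ?_
  rw [curv_pair hg hD h p j k i, hs k p]

lemma cov_apply (k : ι) (A : Matrix ι ι R) (a b : ι) :
    cov D Γ k A a b = D k (A a b) + (Γ k * A) a b - (A * Γ k) a b := rfl

lemma hess_apply (k l a b : ι) :
    hess D Γ S k l a b = D k (cov D Γ l S a b) + (Γ k * cov D Γ l S) a b
      - (cov D Γ l S * Γ k) a b - ∑ m, Γ k m l * cov D Γ m S a b := by
  rw [hess, Matrix.sub_apply, cov_apply, Matrix.sum_apply]
  simp only [Matrix.smul_apply, smul_eq_mul]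

lemma NullEnd.hess (w : IsWalker D g gi Γ E) (h : NullEnd g E S) (k l : ι) :
    NullEnd g E (hess D Γ S k l) :=
  ((h.cov w l).cov w k).sub (NullEnd.sum fun m _ => (h.cov w m).smul _)

lemma hess_sub (w : IsWalker D g gi Γ E) (k l : ι) :
    hess D Γ S k l = hess D Γ S l k + (curv D Γ k l * S - S * curv D Γ k l) := by
  rw [← cov_cov_sub w.comm]
  have : ∀ m, Γ k m l = Γ l m k := fun m => w.lc.symm _ _ _
  simp only [hess, this]
  abel

/-- Commuting covariant derivatives in the divergence of a divergence-free null endomorphism. -/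
lemma sum_hess (w : IsWalker D g gi Γ E) (h : NullEnd g E S)
    (hdiv : ∀ i, divg D Γ S i = 0) (hRic : E * (gi * ric D Γ) = gi * ric D Γ) (i j : ι) :
    ∑ k, hess D Γ S k j k i = - ∑ k, (S * curv D Γ k j) k i := by
  have h1 : ∑ k, hess D Γ S j k k i = 0 := by
    have hd : ∑ k, D j (cov D Γ k S k i) = 0 := by
      rw [← map_sum]
      exact (congrArg (D j) (hdiv i)).trans (map_zero _)
    have h2 : ∑ k, (cov D Γ k S * Γ j) k i = 0 := by
      simp only [mul_apply]
      rw [Finset.sum_comm]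
      refine Finset.sum_eq_zero fun m _ => ?_
      rw [← Finset.sum_mul]
      exact mul_eq_zero_of_left (hdiv m) _
    have h3 : ∑ k, (Γ j * cov D Γ k S) k i = ∑ k, ∑ m, Γ j m k * cov D Γ m S k i := by
      simp only [mul_apply]
      rw [Finset.sum_comm]
    simp only [hess_apply, Finset.sum_add_distrib, Finset.sum_sub_distrib, hd, h2, h3]
    rw [Finset.sum_comm]
    ring
  have h2 : ∑ k, (curv D Γ k j * S) k i = 0 := by
    have : ∑ k, (curv D Γ k j * S) k i = (Sᵀ * ric D Γ) i j := by
      simp only [mul_apply, ric, of_apply, transpose_apply, Finset.mul_sum]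
      rw [Finset.sum_comm]
      exact Finset.sum_congr rfl fun k _ => Finset.sum_congr rfl fun m _ => mul_comm _ _
    rw [this]
    have : Sᵀ * ric D Γ = g * (S * (gi * ric D Γ)) := by
      calc Sᵀ * ric D Γ = Sᵀ * (g * gi) * ric D Γ := by rw [w.mul_inv, mul_one]
        _ = (Sᵀ * g) * gi * ric D Γ := by noncomm_ring
        _ = _ := by rw [h.transpose_eq w]; noncomm_ring
    rw [this, h.mul_eq_zero w hRic, mul_zero, Matrix.zero_apply]
  have h3 : ∀ k, hess D Γ S k j k i = hess D Γ S j k k i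
      + ((curv D Γ k j * S) k i - (S * curv D Γ k j) k i) := by
    intro k
    rw [hess_sub w k j]
    rfl
  rw [Finset.sum_congr rfl fun k _ => h3 k, Finset.sum_add_distrib, h1, Finset.sum_sub_distrib, h2]
  ring

/-- The first-derivative terms of the divergence of the difference of connections. -/
lemma sum_cov_diffConn (w : IsWalker D g gi Γ E) (h : NullEnd g E S)
    (hdiv : ∀ i, divg D Γ S i = 0) (i j : ι) :
    ∑ k, cov D Γ k (diffConn D g gi Γ S j) k i - (Γ j * diffConn D g gi Γ S i).trace
      = (1 / 2 : ℝ) • (∑ k, hess D Γ S k j k i + ∑ k, hess D Γ S k i k j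
        - ∑ k, ∑ l, (gi - S * gi) k l * (g * hess D Γ S k l) i j) := by
  set P := gi - S * gi with hP
  set s : ι → Matrix ι ι R := fun l => cov D Γ l S with hs
  set B : ι → Matrix ι ι R := fun j => Matrix.of fun k i => s i k j with hB
  set Y : ι → Matrix ι ι R := fun j => Matrix.of fun k i => ∑ l, P k l * (g * s l) j i with hY
  have hΓ := w.lc.symm
  have hC : ∀ j, diffConn D g gi Γ S j = (1 / 2 : ℝ) • (s j + B j - Y j) := by
    intro j; ext k i; rfl
  have hcov : ∀ k, cov D Γ k (diffConn D g gi Γ S j)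
      = (1 / 2 : ℝ) • (cov D Γ k (s j) + cov D Γ k (B j) - cov D Γ k (Y j)) := by
    intro k
    have : dmat (D k) ((1 / 2 : ℝ) • (s j + B j - Y j))
        = (1 / 2 : ℝ) • (dmat (D k) (s j) + dmat (D k) (B j) - dmat (D k) (Y j)) := by
      rw [← dmat_add, ← dmat_sub]
      ext a b
      simp only [dmat_apply, Matrix.smul_apply, Derivation.map_smul]
    rw [hC, cov, this, Matrix.mul_smul, Matrix.smul_mul, ← smul_add, ← smul_sub]
    congr 1
    simp only [cov]; noncomm_ring
  have h1 : ∑ k, cov D Γ k (s j) k i = ∑ k, hess D Γ S k j k i + (Γ j * B i).trace := by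
    have : (Γ j * B i).trace = ∑ k, ∑ m, Γ k m j * s m k i := by
      simp only [trace, diag_apply, mul_apply, hB, of_apply]
      rw [Finset.sum_comm]
      exact Finset.sum_congr rfl fun k _ => Finset.sum_congr rfl fun m _ => by rw [hΓ k m j]
    rw [this, ← Finset.sum_add_distrib]
    refine Finset.sum_congr rfl fun k _ => ?_
    simp only [AmbientWalker.hess, Matrix.sub_apply, Matrix.sum_apply, Matrix.smul_apply,
      smul_eq_mul, hs]
    ring
  have h2 : ∑ k, cov D Γ k (B j) k i = ∑ k, hess D Γ S k i k j + (Γ j * s i).trace := by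
    have : (Γ j * s i).trace = ∑ k, (s i * Γ k) k j := by
      rw [trace_mul_comm]
      simp only [trace, diag_apply, mul_apply]
      exact Finset.sum_congr rfl fun k _ => Finset.sum_congr rfl fun m _ => by rw [hΓ j m k]
    rw [this, ← Finset.sum_add_distrib]
    refine Finset.sum_congr rfl fun k _ => ?_
    have e1 : ∑ m, Γ k m i * s m k j = (B j * Γ k) k i := by
      simp only [mul_apply, hB, of_apply]
      exact Finset.sum_congr rfl fun m _ => mul_comm _ _
    have e2 : (Γ k * B j) k i = (Γ k * s i) k j := by
      simp only [mul_apply, hB, of_apply]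
    rw [hess_apply, cov_apply, e2]
    change D k (s i k j) + _ - _ = D k (s i k j) + (Γ k * s i) k j - (s i * Γ k) k j
      - ∑ m, Γ k m i * s m k j + _
    rw [e1]
    ring
  have h3 : ∑ k, cov D Γ k (Y j) k i = ∑ k, ∑ l, P k l * (g * hess D Γ S k l) i j
      + (Γ j * Y i).trace := by
    have hsym : ∀ l i j, (g * s l) i j = (g * s l) j i := fun l i j => h.cov_symm_apply w l i j
    have hdP : ∀ k, dmat (D k) P = -(Γ k * P) - P * (Γ k)ᵀ - s k * gi := by
      intro k
      rw [hP, dmat_sub, dmat_mul, dmat_inv w.inv_mul w.mul_inv w.lc]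
      simp only [hs, cov]
      noncomm_ring
    have hdg : ∀ k l, dmat (D k) (g * s l) = (Γ k)ᵀ * (g * s l) + g * s l * Γ k
        + g * hess D Γ S k l + ∑ m, Γ k m l • (g * s m) := by
      intro k l
      have : g * hess D Γ S k l = g * cov D Γ k (s l) - ∑ m, Γ k m l • (g * s m) := by
        rw [AmbientWalker.hess, mul_sub, Matrix.mul_sum]
        simp only [Matrix.mul_smul, hs]
      rw [this, dmat_mul, w.lc.compat, cov]
      noncomm_ring
    have hz : ∀ X : ι → R, ∑ k, ∑ l, (s k * gi) k l * X l = 0 := by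
      intro X
      rw [Finset.sum_comm]
      refine Finset.sum_eq_zero fun l _ => ?_
      rw [← Finset.sum_mul]
      refine mul_eq_zero_of_left ?_ _
      simp only [mul_apply]
      rw [Finset.sum_comm]
      refine Finset.sum_eq_zero fun m _ => ?_
      rw [← Finset.sum_mul]
      exact mul_eq_zero_of_left (hdiv m) _
    have ht : (Γ j * Y i).trace = ∑ k, ∑ l, P k l * (g * s l * Γ k) i j := by
      rw [trace_mul_comm]
      simp only [trace, diag_apply]
      refine Finset.sum_congr rfl fun k _ => ?_
      rw [mul_apply]
      simp only [hY, of_apply, Finset.sum_mul, mul_apply (N := Γ k), Finset.mul_sum]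
      rw [Finset.sum_comm]
      exact Finset.sum_congr rfl fun l _ => Finset.sum_congr rfl fun m _ => by
        rw [hΓ j m k, mul_assoc]
    have hk : ∀ k, cov D Γ k (Y j) k i = ∑ l, P k l * (g * hess D Γ S k l) i j
        + ∑ l, P k l * (g * s l * Γ k) i j - ∑ l, (s k * gi) k l * (g * s l) i j := by
      intro k
      have e0 : dmat (D k) (Y j) k i = ∑ l, (dmat (D k) P k l * (g * s l) i j
          + P k l * dmat (D k) (g * s l) i j) := by
        simp only [dmat_apply, hY, of_apply, map_sum, Derivation.leibniz, smul_eq_mul]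
        refine Finset.sum_congr rfl fun l _ => ?_
        rw [hsym l j i]; ring
      have e1 : (Γ k * Y j) k i = ∑ l, (Γ k * P) k l * (g * s l) i j := by
        simp only [mul_apply (M := Γ k), hY, of_apply, Finset.mul_sum, Finset.sum_mul]
        rw [Finset.sum_comm]
        exact Finset.sum_congr rfl fun l _ => Finset.sum_congr rfl fun m _ => by
          rw [hsym l j i, mul_assoc]
      have e2 : (Y j * Γ k) k i = ∑ l, P k l * ((Γ k)ᵀ * (g * s l)) i j := by
        rw [mul_apply]
        simp only [mul_apply (M := (Γ k)ᵀ), hY, of_apply, Finset.mul_sum,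
          Finset.sum_mul, transpose_apply]
        rw [Finset.sum_comm]
        exact Finset.sum_congr rfl fun l _ => Finset.sum_congr rfl fun m _ => by
          rw [hsym l j m]; ring
      have e3 : ∑ l, P k l * (∑ m, Γ k m l • (g * s m)) i j
          = ∑ l, (P * (Γ k)ᵀ) k l * (g * s l) i j := by
        simp only [Matrix.sum_apply, Matrix.smul_apply, smul_eq_mul, mul_apply (M := P),
          transpose_apply, Finset.mul_sum, Finset.sum_mul]
        rw [Finset.sum_comm]
        exact Finset.sum_congr rfl fun l _ => Finset.sum_congr rfl fun m _ => by ring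
      simp only [cov, Matrix.add_apply, Matrix.sub_apply]
      rw [e0, e1, e2]
      simp only [hdP, hdg, Matrix.add_apply, Matrix.sub_apply, Matrix.neg_apply, mul_add, sub_mul,
        neg_mul, Finset.sum_add_distrib, Finset.sum_sub_distrib, Finset.sum_neg_distrib, e3]
      ring
    rw [Finset.sum_congr rfl fun k _ => hk k, Finset.sum_sub_distrib, Finset.sum_add_distrib, hz,
      ht]
    ring
  have h4 : ∑ k, cov D Γ k (diffConn D g gi Γ S j) k i = (1 / 2 : ℝ) •
      (∑ k, cov D Γ k (s j) k i + ∑ k, cov D Γ k (B j) k i - ∑ k, cov D Γ k (Y j) k i) := by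
    simp only [hcov, Matrix.smul_apply, Matrix.add_apply, Matrix.sub_apply, ← Finset.smul_sum,
      Finset.sum_add_distrib, Finset.sum_sub_distrib]
  have h5 : (Γ j * diffConn D g gi Γ S i).trace = (1 / 2 : ℝ) • ((Γ j * s i).trace
      + (Γ j * B i).trace - (Γ j * Y i).trace) := by
    rw [hC, Matrix.mul_smul, trace_smul, mul_sub, mul_add, trace_sub, trace_add]
  rw [h4, h5, ← smul_sub, h1, h2, h3]
  congr 1
  ring

/-- Perturbing a null Ricci Walker metric by a divergence-free null tensor gives a metric whose
Ricci tensor again has image in the distribution. -/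
theorem nullEnd_ric_add_diffConn (w : IsWalker D g gi Γ E) (h : NullEnd g E S)
    (hdiv : ∀ i, divg D Γ S i = 0) (hRic : E * (gi * ric D Γ) = gi * ric D Γ) :
    NullEnd g E (gi * ric D (fun k => Γ k + diffConn D g gi Γ S k)) := by
  set C := diffConn D g gi Γ S with hC
  -- the contraction of `S` with the curvature, the terms quadratic in the difference of the
  -- connections, and the Laplacian of `S`
  set Z : Matrix ι ι R := Matrix.of fun i j => ∑ k, (S * curv D Γ k i) k j with hZ
  set W : Matrix ι ι R := Matrix.of fun i j => (C j * C i).trace with hW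
  set H : Matrix ι ι R := ∑ k, ∑ l, (gi - S * gi) k l • hess D Γ S k l with hH
  have hric : ric D (fun k => Γ k + C k)
      = ric D Γ + ((1 / 2 : ℝ) • (-Zᵀ - Z - g * H) - W) := by
    ext i j
    rw [ric_add (diffConn_symm w h) (trace_diffConn w h) i j]
    have h1 := sum_cov_diffConn w h hdiv i j
    rw [sum_hess w h hdiv hRic, sum_hess w h hdiv hRic] at h1
    have h2 : ∑ k, ∑ l, (gi - S * gi) k l * (g * hess D Γ S k l) i j = (g * H) i j := by
      simp only [hH, Matrix.mul_sum, Matrix.mul_smul, Matrix.sum_apply, Matrix.smul_apply,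
        smul_eq_mul]
    rw [h2] at h1
    rw [add_sub_assoc, h1]
    simp only [hW, hZ, Matrix.add_apply, Matrix.sub_apply, Matrix.neg_apply, Matrix.smul_apply,
      transpose_apply, of_apply]
    rw [sub_eq_add_neg (-∑ k, (S * curv D Γ k j) k i)]
    ring
  -- The three terms are null separately.
  have hHn : NullEnd g E H :=
    NullEnd.sum fun k _ => NullEnd.sum fun l _ => (h.hess w k l).smul _
  have hZsymm : Zᵀ = Z := by
    have e : ∀ i j, Z i j = ∑ k, ∑ p, (S * gi) k p * (g * curv D Γ k i) p j := by
      intro i j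
      simp only [hZ, of_apply]
      refine Finset.sum_congr rfl fun k _ => ?_
      rw [← mul_apply]
      rw [mul_assoc, ← mul_assoc gi, w.inv_mul, one_mul]
    have hs : ∀ k p, (S * gi) k p = (S * gi) p k := fun k p => by
      have : (S * gi)ᵀ = S * gi := by rw [transpose_mul, w.inv_symm, h.mul_inv w]
      conv_lhs => rw [← this, transpose_apply]
    ext i j
    rw [transpose_apply, e, e, Finset.sum_comm]
    refine Finset.sum_congr rfl fun p _ => Finset.sum_congr rfl fun k _ => ?_
    rw [curv_pair w.symm w.comm w.lc p i k j, hs k p]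
  have hZn : NullEnd g E (gi * Z) := by
    refine nullEnd_of_perp w hZsymm ?_
    ext i a
    rw [mul_apply]
    simp only [hZ, of_apply, Finset.sum_mul]
    rw [Finset.sum_comm, Matrix.zero_apply]
    refine Finset.sum_eq_zero fun k _ => ?_
    rw [← mul_apply, h.mul_curv_mul_perp w, Matrix.zero_apply]
  have hWn : NullEnd g E (gi * W) := by
    refine nullEnd_of_perp w ?_ ?_
    · ext i j
      simp only [hW, transpose_apply, of_apply]
      exact trace_mul_comm _ _
    · ext i a
      set q := gi * (1 - E)ᵀ with hq
      set X : Matrix ι ι R := ∑ j, q j a • cov D Γ j S with hX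
      have hXn : NullEnd g E X := NullEnd.sum fun j _ => (h.cov w j).smul _
      -- On the orthogonal complement the difference of the connections is a null endomorphism, and
      -- the trace of its product with any `C i` vanishes.
      have e : ∑ j, q j a • C j = (1 / 2 : ℝ) • X := by
        have e1 : ∀ l k, ∑ j, q j a * cov D Γ l S k j = 0 := by
          intro l k
          have := congrFun (congrFun ((h.cov w l).mul_perp w) k) a
          rw [mul_apply, Matrix.zero_apply] at this
          rw [← this]
          exact Finset.sum_congr rfl fun j _ => mul_comm _ _
        have e2 : ∀ l i, ∑ j, q j a * (g * cov D Γ l S) j i = 0 := by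
          intro l i
          have : (g * cov D Γ l S * q) i a = 0 := by
            rw [mul_assoc, (h.cov w l).mul_perp w, mul_zero, Matrix.zero_apply]
          rw [mul_apply] at this
          rw [← this]
          exact Finset.sum_congr rfl fun j _ => by rw [h.cov_symm_apply w l j i, mul_comm]
        ext k i
        have e3 : ∑ j, q j a * ∑ l, (gi - S * gi) k l * (g * cov D Γ l S) j i = 0 := by
          simp only [Finset.mul_sum]
          rw [Finset.sum_comm]
          refine Finset.sum_eq_zero fun l _ => ?_
          calc ∑ j, q j a * ((gi - S * gi) k l * (g * cov D Γ l S) j i)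
              = (gi - S * gi) k l * ∑ j, q j a * (g * cov D Γ l S) j i := by
                rw [Finset.mul_sum]
                exact Finset.sum_congr rfl fun j _ => by ring
            _ = 0 := by rw [e2, mul_zero]
        simp only [hX, hC, diffConn, Matrix.sum_apply, Matrix.smul_apply, of_apply, smul_eq_mul,
          mul_smul_comm, ← Finset.smul_sum, mul_add, mul_sub, Finset.sum_add_distrib,
          Finset.sum_sub_distrib, e1, e3]
        simp
      have e' : (W * q) i a = ((∑ j, q j a • C j) * C i).trace := by
        rw [mul_apply]
        simp only [hW, of_apply, Matrix.sum_mul, Matrix.smul_mul, trace_sum,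
          trace_smul, smul_eq_mul]
        exact Finset.sum_congr rfl fun j _ => mul_comm _ _
      rw [e', e, Matrix.smul_mul, trace_smul, trace_mul_diffConn w h hXn, smul_zero,
        Matrix.zero_apply]
  have hRn : NullEnd g E (gi * ric D Γ) :=
    ⟨hRic, by rw [← mul_assoc, w.mul_inv, one_mul,
      ric_symm w.symm w.inv_mul w.mul_inv w.comm w.lc]⟩
  have hgH : gi * (g * H) = H := by rw [← mul_assoc, w.inv_mul, one_mul]
  have key : gi * ric D (fun k => Γ k + C k) = gi * ric D Γ
      + ((algebraMap ℝ R (1 / 2)) • ((gi * Z) • (-1 : Matrix ι ι R) - gi * Z - H) - gi * W) := by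
    rw [hric, hZsymm, mul_add, mul_sub, Matrix.mul_smul, mul_sub, mul_sub, hgH, mul_neg,
      algebraMap_smul]
    congr 4
    simp
  rw [key]
  have hneg : NullEnd g E ((gi * Z) • (-1 : Matrix ι ι R)) := by
    have := hZn.smul (-1 : R)
    convert this using 1
    simp
  exact hRn.add ((((hneg.sub hZn).sub hHn).smul _).sub hWn)

end RicciPerturbation

/-! ### The contracted Bianchi identity -/

section ContractedBianchi

variable {ι R : Type*} [Fintype ι] [DecidableEq ι] [CommRing R] [Algebra ℝ R]
  {D : ι → Derivation ℝ R R} {g gi : Matrix ι ι R} {Γ : ι → Matrix ι ι R}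

/-- The contracted Bianchi identity `∇_k Ric^k_m = ½ ∂_m Scal`. -/
theorem two_mul_divg_ric (hg : gᵀ = g) (hgi : gi * g = 1) (hgi' : g * gi = 1)
    (hD : ∀ i j a, D i (D j a) = D j (D i a)) (h : IsLeviCivita D g Γ) (m : ι) :
    2 * divg D Γ (gi * ric D Γ) m = D m (gi * ric D Γ).trace := by
  have hgis := inv_symm_of_symm hg hgi'
  set Rc := gi * ric D Γ with hRc
  -- The curvature with its second endomorphism index raised is skew.
  set K : ι → ι → Matrix ι ι R := fun k l => curv D Γ k l * gi with hK
  have hskew : ∀ k l a b, K k l a b = - K k l b a := by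
    intro k l a b
    have h1 := curv_skew hg hD h k l
    rw [transpose_mul, hg] at h1
    have h2 : (K k l)ᵀ = - K k l := by
      calc (K k l)ᵀ = gi * ((curv D Γ k l)ᵀ * g) * gi := by
            rw [hK, transpose_mul, hgis, mul_assoc, mul_assoc, hgi', mul_one]
        _ = -((gi * g) * K k l) := by rw [h1, hK]; noncomm_ring
        _ = _ := by rw [hgi, one_mul]
    have := congrFun (congrFun h2 b) a
    simpa using this
  have hanti : ∀ k l, K l k = - K k l := fun k l => by
    simp only [hK, curv_antisymm k l, neg_mul]
  have hsum1 : ∀ l p, ∑ k, K k l k p = Rc p l := by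
    intro l p
    have : ∀ i, gi i p = gi p i := fun i => by
      conv_lhs => rw [← hgis, transpose_apply]
    simp only [hK, hRc, mul_apply, ric, of_apply, Finset.mul_sum]
    rw [Finset.sum_comm]
    exact Finset.sum_congr rfl fun i _ => Finset.sum_congr rfl fun k _ => by
      rw [this i, mul_comm]
  have hsum2 : ∀ m k, ∑ l, K l m k l = - Rc k m := by
    intro m k
    rw [← hsum1, ← Finset.sum_neg_distrib]
    exact Finset.sum_congr rfl fun l _ => hskew _ _ _ _
  have hsum3 : ∀ m k, ∑ l, K m l k l = Rc k m := by
    intro m k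
    rw [← neg_neg (Rc k m), ← hsum2, ← Finset.sum_neg_distrib]
    exact Finset.sum_congr rfl fun l _ => by rw [hanti l m, Matrix.neg_apply]
  have hsum4 : ∀ m l, ∑ k, K m k k l = - Rc l m := by
    intro m l
    rw [← hsum1, ← Finset.sum_neg_distrib]
    exact Finset.sum_congr rfl fun k _ => by rw [hanti k m, Matrix.neg_apply]
  have hcov : ∀ m k l, cov D Γ m (curv D Γ k l) * gi
      = dmat (D m) (K k l) + Γ m * K k l + K k l * (Γ m)ᵀ := by
    intro m k l
    simp only [hK, dmat_mul, dmat_inv hgi hgi' h, cov]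
    noncomm_ring
  have hzero : ∀ C : ι → Matrix ι ι R, (∀ l, ∑ k, ∑ p, C k l p * K l m k p = 0) →
      ∑ k, ∑ l, ∑ p, C k l p * K l m k p = 0 := by
    intro C hC
    rw [Finset.sum_comm]
    exact Finset.sum_eq_zero fun l _ => hC l
  -- `Γ k l p` is symmetric and `K l m k p` is skew in `k` and `p`
  have hz : ∀ l, ∑ k, ∑ p, Γ k l p * K l m k p = 0 := by
    intro l
    have h1 : ∑ k, ∑ p, Γ k l p * K l m k p = - ∑ k, ∑ p, Γ k l p * K l m k p := by
      conv_lhs => rw [Finset.sum_comm]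
      rw [← Finset.sum_neg_distrib]
      refine Finset.sum_congr rfl fun p _ => ?_
      rw [← Finset.sum_neg_distrib]
      exact Finset.sum_congr rfl fun k _ => by rw [hskew l m k p, h.symm k l p]; ring
    apply eq_of_two_mul_eq
    linear_combination h1
  -- the second Bianchi identity, to be summed over `k` and `l`
  have hb : ∀ k l, (dmat (D m) (K k l) + Γ m * K k l + K k l * (Γ m)ᵀ) k l
      + (dmat (D k) (K l m) + Γ k * K l m + K l m * (Γ k)ᵀ) k l
      + (dmat (D l) (K m k) + Γ l * K m k + K m k * (Γ l)ᵀ) k l = 0 := by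
    intro k l
    rw [← hcov, ← hcov, ← hcov, ← Matrix.add_apply, ← Matrix.add_apply, ← add_mul, ← add_mul,
      second_bianchi hD, zero_mul, Matrix.zero_apply]
  have hτ : ∑ k, (Rc * Γ k) k m = (Γ m * Rc).trace := by
    rw [trace_mul_comm]
    simp only [trace, diag_apply, mul_apply]
    exact Finset.sum_congr rfl fun k _ => Finset.sum_congr rfl fun p _ => by rw [h.symm k p m]
  have a1 : ∑ k, ∑ l, D m (K k l k l) = D m Rc.trace := by
    simp only [← map_sum]
    rw [Finset.sum_comm]
    simp only [hsum1, trace, diag_apply]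
  have a2 : ∑ k, ∑ l, (Γ m * K k l) k l = (Γ m * Rc).trace := by
    simp only [trace, diag_apply, mul_apply]
    refine Finset.sum_congr rfl fun k _ => ?_
    rw [Finset.sum_comm]
    exact Finset.sum_congr rfl fun p _ => by rw [← Finset.mul_sum, hsum3]
  have a3 : ∑ k, ∑ l, (K k l * (Γ m)ᵀ) k l = (Γ m * Rc).trace := by
    rw [Finset.sum_comm]
    simp only [trace, diag_apply, mul_apply, transpose_apply]
    refine Finset.sum_congr rfl fun l _ => ?_
    rw [Finset.sum_comm]
    exact Finset.sum_congr rfl fun p _ => by rw [← Finset.sum_mul, hsum1, mul_comm]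
  have b1 : ∑ k, ∑ l, D k (K l m k l) = - ∑ k, D k (Rc k m) := by
    simp only [← map_sum, hsum2, map_neg, Finset.sum_neg_distrib]
  have b2 : ∑ k, ∑ l, (Γ k * K l m) k l = - ∑ k, (Γ k * Rc) k m := by
    simp only [mul_apply]
    rw [← Finset.sum_neg_distrib]
    refine Finset.sum_congr rfl fun k _ => ?_
    rw [Finset.sum_comm, ← Finset.sum_neg_distrib]
    exact Finset.sum_congr rfl fun p _ => by rw [← Finset.mul_sum, hsum2, mul_neg]
  have b3 : ∑ k, ∑ l, (K l m * (Γ k)ᵀ) k l = 0 := by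
    rw [← hzero Γ hz]
    simp only [mul_apply, transpose_apply]
    exact Finset.sum_congr rfl fun k _ => Finset.sum_congr rfl fun l _ =>
      Finset.sum_congr rfl fun p _ => mul_comm _ _
  have c1 : ∑ k, ∑ l, D l (K m k k l) = - ∑ k, D k (Rc k m) := by
    rw [Finset.sum_comm]
    simp only [← map_sum, hsum4, map_neg, Finset.sum_neg_distrib]
  have c2 : ∑ k, ∑ l, (Γ l * K m k) k l = 0 := by
    refine Finset.sum_eq_zero fun k _ => ?_
    rw [← hz k]
    simp only [mul_apply]
    refine Finset.sum_congr rfl fun l _ => Finset.sum_congr rfl fun p _ => ?_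
    rw [hanti k m, Matrix.neg_apply, hskew k m p l, neg_neg]
  have c3 : ∑ k, ∑ l, (K m k * (Γ l)ᵀ) k l = - ∑ k, (Γ k * Rc) k m := by
    rw [Finset.sum_comm, ← Finset.sum_neg_distrib]
    refine Finset.sum_congr rfl fun l _ => ?_
    simp only [mul_apply, transpose_apply]
    rw [Finset.sum_comm, ← Finset.sum_neg_distrib]
    exact Finset.sum_congr rfl fun p _ => by rw [← Finset.sum_mul, hsum4]; ring
  have htot := Finset.sum_eq_zero fun k (_ : k ∈ Finset.univ) =>
    Finset.sum_eq_zero fun l (_ : l ∈ Finset.univ) => hb k l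
  simp only [Matrix.add_apply, dmat_apply, Finset.sum_add_distrib, a1, a2, a3, b1, b2, b3, c1, c2,
    c3] at htot
  simp only [divg, cov_apply, Finset.sum_add_distrib, Finset.sum_sub_distrib, hτ]
  linear_combination -htot

end ContractedBianchi

/-! ### The Ricci tensor of the ambient metric -/

section Ambient

variable {ι R : Type*} [Fintype ι] [DecidableEq ι] [CommRing R] [Algebra ℝ R]

lemma ric_apply (D : ι → Derivation ℝ R R) (Γ : ι → Matrix ι ι R) (i j : ι) :
    ric D Γ i j = ∑ k, (D k (Γ j k i) - D j (Γ k k i)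
      + ∑ l, (Γ k k l * Γ j l i - Γ j k l * Γ k l i)) := by
  simp only [ric, of_apply, curv, Matrix.add_apply, Matrix.sub_apply, dmat_apply, mul_apply,
    Finset.sum_sub_distrib, Finset.sum_add_distrib]
  ring

lemma dmat_of_inv (δ : Derivation ℝ R R) {g gi : Matrix ι ι R} (hgi : gi * g = 1)
    (hgi' : g * gi = 1) : dmat δ gi = -(gi * dmat δ g * gi) := by
  have h1 : dmat δ gi * g + gi * dmat δ g = 0 := by
    rw [← dmat_mul, hgi, dmat_one]
  calc dmat δ gi = (dmat δ gi * g) * gi := by rw [mul_assoc, hgi', mul_one]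
    _ = -(gi * dmat δ g) * gi := by rw [eq_neg_of_add_eq_zero_left h1]
    _ = _ := by rw [neg_mul]

lemma trace_dmat (δ : Derivation ℝ R R) (A : Matrix ι ι R) : (dmat δ A).trace = δ A.trace := by
  simp [trace]

lemma derivation_two (δ : Derivation ℝ R R) : δ 2 = 0 := by
  simpa using δ.map_natCast 2

variable (R) in
/-- The scalar `1/2`. -/
def half : R := algebraMap ℝ R (1 / 2)

lemma two_mul_half : 2 * half R = 1 := by
  rw [half, ← map_ofNat (algebraMap ℝ R) 2, ← map_mul]; norm_num

@[simp] lemma derivation_half (δ : Derivation ℝ R R) : δ (half R) = 0 := δ.map_algebraMap _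

/-- The components of `2 dt d(rt) + t² g`. -/
def ambMat (t r : R) (g : Matrix ι ι R) : Matrix (Unit ⊕ ι ⊕ Unit) (Unit ⊕ ι ⊕ Unit) R :=
  Matrix.of fun a b =>
    match a, b with
    | Sum.inl _, Sum.inl _ => 2 * r
    | Sum.inl _, Sum.inr (Sum.inr _) => t
    | Sum.inr (Sum.inr _), Sum.inl _ => t
    | Sum.inr (Sum.inl i), Sum.inr (Sum.inl j) => t ^ 2 * g i j
    | _, _ => 0

/-- The inverse of `2 dt d(rt) + t² g`, where `ti` and `gi` are inverse to `t` and `g`. -/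
def ambInv (ti r : R) (gi : Matrix ι ι R) : Matrix (Unit ⊕ ι ⊕ Unit) (Unit ⊕ ι ⊕ Unit) R :=
  Matrix.of fun a b =>
    match a, b with
    | Sum.inl _, Sum.inr (Sum.inr _) => ti
    | Sum.inr (Sum.inr _), Sum.inl _ => ti
    | Sum.inr (Sum.inr _), Sum.inr (Sum.inr _) => -(2 * r * ti ^ 2)
    | Sum.inr (Sum.inl i), Sum.inr (Sum.inl j) => ti ^ 2 * gi i j
    | _, _ => 0

/-- The connection matrices of `2 dt d(rt) + t² g`, where `Γ` is the Levi-Civita connection of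
`g`, `g'` the derivative of `g` in the direction of `r`, and `K = gi g'`. -/
def ambConn (t ti r : R) (g g' K : Matrix ι ι R) (Γ : ι → Matrix ι ι R) (c : Unit ⊕ ι ⊕ Unit) :
    Matrix (Unit ⊕ ι ⊕ Unit) (Unit ⊕ ι ⊕ Unit) R :=
  Matrix.of fun a b =>
    match a, c, b with
    | Sum.inl _, Sum.inr (Sum.inl i), Sum.inr (Sum.inl j) => -(half R * t * g' i j)
    | Sum.inr (Sum.inl k), Sum.inl _, Sum.inr (Sum.inl j) => if k = j then ti else 0
    | Sum.inr (Sum.inl k), Sum.inr (Sum.inl j), Sum.inl _ => if k = j then ti else 0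
    | Sum.inr (Sum.inl k), Sum.inr (Sum.inl i), Sum.inr (Sum.inl j) => Γ i k j
    | Sum.inr (Sum.inl k), Sum.inr (Sum.inl i), Sum.inr (Sum.inr _) => half R * K k i
    | Sum.inr (Sum.inl k), Sum.inr (Sum.inr _), Sum.inr (Sum.inl i) => half R * K k i
    | Sum.inr (Sum.inr _), Sum.inl _, Sum.inr (Sum.inr _) => ti
    | Sum.inr (Sum.inr _), Sum.inr (Sum.inr _), Sum.inl _ => ti
    | Sum.inr (Sum.inr _), Sum.inr (Sum.inl i), Sum.inr (Sum.inl j) => -g i j + r * g' i j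
    | _, _, _ => 0

/-- The data of a family of metrics `g`, depending on `r` but not on `t`, with its Levi-Civita
connection. -/
structure IsAmbient (D : Unit ⊕ ι ⊕ Unit → Derivation ℝ R R) (t ti r : R)
    (g gi : Matrix ι ι R) (Γ : ι → Matrix ι ι R) : Prop where
  comm : ∀ a b f, D a (D b f) = D b (D a f)
  t_mul : t * ti = 1
  D_t_t : D (Sum.inl ()) t = 1
  D_i_t : ∀ i, D (Sum.inr (Sum.inl i)) t = 0
  D_r_t : D (Sum.inr (Sum.inr ())) t = 0
  D_t_r : D (Sum.inl ()) r = 0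
  D_i_r : ∀ i, D (Sum.inr (Sum.inl i)) r = 0
  D_r_r : D (Sum.inr (Sum.inr ())) r = 1
  D_t_g : ∀ i j, D (Sum.inl ()) (g i j) = 0
  symm : gᵀ = g
  mul_inv : g * gi = 1
  inv_mul : gi * g = 1
  lc : IsLeviCivita (fun i => D (Sum.inr (Sum.inl i))) g Γ

variable {D : Unit ⊕ ι ⊕ Unit → Derivation ℝ R R} {t ti r : R} {g gi : Matrix ι ι R}
  {Γ : ι → Matrix ι ι R}

lemma ambMat_transpose (hg : gᵀ = g) : (ambMat t r g)ᵀ = ambMat t r g := by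
  have hs : ∀ i j, g i j = g j i := fun i j => by conv_lhs => rw [← hg, transpose_apply]
  ext (_ | i | _) (_ | j | _)
  case inr.inl.inr.inl => simp only [ambMat, of_apply, transpose_apply, hs i j]
  all_goals simp only [ambMat, of_apply, transpose_apply]

lemma ambMat_mul_ambInv (ht : t * ti = 1) (h : g * gi = 1) :
    ambMat t r g * ambInv ti r gi = 1 := by
  have h1 : ∀ i j, ∑ x, g i x * gi x j = (1 : Matrix ι ι R) i j := fun i j => by
    rw [← h, mul_apply]
  ext (_ | i | _) (_ | j | _)
  case inr.inl.inr.inl =>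
    simp only [ambMat, ambInv, mul_apply, Fintype.sum_sum_type, of_apply, Finset.univ_unique,
      Finset.sum_singleton, Matrix.one_apply, mul_zero, zero_add, add_zero, Sum.inr.injEq,
      Sum.inl.injEq]
    have : ∀ x, t ^ 2 * g i x * (ti ^ 2 * gi x j) = (t * ti) ^ 2 * (g i x * gi x j) :=
      fun x => by ring
    simp only [this, ht, one_pow, one_mul, h1, Matrix.one_apply]
  all_goals
    simp [ambMat, ambInv, mul_apply, Fintype.sum_sum_type, ht]
    try linear_combination (-2 * r * ti) * ht

lemma ambInv_mul_ambMat (ht : t * ti = 1) (h : gi * g = 1) :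
    ambInv ti r gi * ambMat t r g = 1 := by
  have h1 : ∀ i j, ∑ x, gi i x * g x j = (1 : Matrix ι ι R) i j := fun i j => by
    rw [← h, mul_apply]
  have ht' : ti * t = 1 := by rw [mul_comm, ht]
  ext (_ | i | _) (_ | j | _)
  case inr.inl.inr.inl =>
    simp only [ambMat, ambInv, mul_apply, Fintype.sum_sum_type, of_apply, Finset.univ_unique,
      Finset.sum_singleton, Matrix.one_apply, mul_zero, zero_add, add_zero, Sum.inr.injEq,
      Sum.inl.injEq]
    have : ∀ x, ti ^ 2 * gi i x * (t ^ 2 * g x j) = (t * ti) ^ 2 * (gi i x * g x j) :=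
      fun x => by ring
    simp only [this, ht, one_pow, one_mul, h1, Matrix.one_apply]
  all_goals
    simp [ambMat, ambInv, mul_apply, Fintype.sum_sum_type, ht']
    try linear_combination (-2 * r * ti) * ht

namespace IsAmbient

variable (A : IsAmbient D t ti r g gi Γ)
include A

set_option maxHeartbeats 1000000 in
lemma isLeviCivita_ambConn :
    IsLeviCivita D (ambMat t r g) (ambConn t ti r g (dmat (D (Sum.inr (Sum.inr ()))) g)
      (gi * dmat (D (Sum.inr (Sum.inr ()))) g) Γ) := by
  set d := D (Sum.inr (Sum.inr ())) with hd
  have hs : ∀ i j, g i j = g j i := fun i j => by conv_lhs => rw [← A.symm, transpose_apply]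
  have hlow : ∀ i j, ∑ x, g i x * (gi * dmat d g) x j = d (g i j) := by
    intro i j
    rw [← mul_apply, ← mul_assoc, A.mul_inv, one_mul, dmat_apply]
  have hlow' : ∀ i j, ∑ x, (gi * dmat d g) x i * g x j = d (g i j) := by
    intro i j
    rw [hs i j, ← hlow]
    exact Finset.sum_congr rfl fun x _ => by rw [hs x j, mul_comm]
  have hc : ∀ k i j, D (Sum.inr (Sum.inl k)) (g i j)
      = ∑ x, Γ k x i * g x j + ∑ x, g i x * Γ k x j := by
    intro k i j
    have := congrFun (congrFun (A.lc.compat k) i) j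
    simpa [mul_apply] using this
  have ht' : ti * t = 1 := by rw [mul_comm, A.t_mul]
  have h2 : half R * 2 = 1 := by rw [mul_comm, two_mul_half]
  have hsd : ∀ i j, d (g i j) = d (g j i) := fun i j => by rw [hs i j]
  have hp : ∀ x, d (t ^ 2 * x) = t ^ 2 * d x := fun x => by
    simp [Derivation.leibniz, Derivation.leibniz_pow, A.D_r_t, hd]
  have hpi : ∀ k x, D (Sum.inr (Sum.inl k)) (t ^ 2 * x) = t ^ 2 * D (Sum.inr (Sum.inl k)) x :=
    fun k x => by simp [Derivation.leibniz, Derivation.leibniz_pow, A.D_i_t]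
  have hp0 : ∀ i j, D (Sum.inl ()) (t ^ 2 * g i j) = 2 * t * g i j :=
    fun i j => by simp [Derivation.leibniz, Derivation.leibniz_pow, A.D_t_t, A.D_t_g]; ring
  generalize gi * dmat d g = K at *
  have hL : ∀ i j, ∑ x, t ^ 2 * g i x * (half R * K x j) = t ^ 2 * half R * d (g i j) := by
    intro i j
    rw [← hlow, Finset.mul_sum]
    exact Finset.sum_congr rfl fun x _ => by ring
  have hL' : ∀ i j, ∑ x, half R * K x i * (t ^ 2 * g x j) = t ^ 2 * half R * d (g i j) := by
    intro i j
    rw [← hlow', Finset.mul_sum]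
    exact Finset.sum_congr rfl fun x _ => by ring
  refine ⟨?_, ?_⟩
  · rintro (_ | k | _) (_ | i | _) (_ | j | _) <;>
      simp only [ambConn, of_apply, eq_comm, dmat_apply]
    · rw [hs k j]
    · exact A.lc.symm k i j
    · rw [hs k j]
  · rintro (_ | k | _) <;> ext (_ | i | _) (_ | j | _) <;>
      simp only [ambConn, ambMat, of_apply, mul_apply, Fintype.sum_sum_type, Matrix.add_apply,
        transpose_apply, Finset.univ_unique, Finset.sum_singleton, mul_zero, zero_mul, add_zero,
        zero_add, Finset.sum_const_zero, map_zero, dmat_apply, ite_mul, mul_ite, A.D_t_t, A.D_i_t,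
        Finset.sum_ite_eq', Finset.mem_univ, if_true, ← hd, hp, hpi,
        hp0]
    case inl.inl.inl => simp [A.D_t_r, derivation_two]
    case inl.inl.inr.inr => rw [A.t_mul]
    case inl.inr.inl.inr.inl => linear_combination (-2 * t * g i j) * A.t_mul
    case inl.inr.inr.inl => rw [ht']
    case inr.inl.inl.inl => simp [A.D_i_r, derivation_two]
    case inr.inl.inl.inr.inl =>
      linear_combination (-t * g k j) * A.t_mul + (r * t * d (g k j)) * h2
    case inr.inl.inr.inl.inl =>
      rw [hs i k]
      linear_combination (-t * g k i) * A.t_mul + (r * t * d (g k i)) * h2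
    case inr.inl.inr.inl.inr.inl =>
      rw [hc, mul_add, Finset.mul_sum, Finset.mul_sum]
      congr 1
      · exact Finset.sum_congr rfl fun x _ => by ring
      · exact Finset.sum_congr rfl fun x _ => by ring
    case inr.inl.inr.inl.inr.inr => rw [hL, hs i k]; ring
    case inr.inl.inr.inr.inr.inl => rw [hL', hs k j]; ring
    case inr.inr.inl.inl =>
      simp [A.D_r_r, hd, derivation_two]
      linear_combination (-2) * A.t_mul
    case inr.inr.inl.inr.inr => exact A.D_r_t
    case inr.inr.inr.inr.inl => exact A.D_r_t
    case inr.inr.inr.inl.inr.inl =>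
      rw [hL, hL']
      linear_combination (-t ^ 2 * d (g i j)) * h2

lemma D_ti (a : Unit ⊕ ι ⊕ Unit) : D a ti = - ti ^ 2 * D a t := by
  have h1 := congrArg (D a) A.t_mul
  rw [Derivation.leibniz, Derivation.map_one_eq_zero, smul_eq_mul, smul_eq_mul] at h1
  linear_combination ti * h1 - D a ti * A.t_mul

/-- Both sides are mixed derivatives of the logarithm of the volume density. -/
lemma D_r_trace (i : ι) : D (Sum.inr (Sum.inr ())) (Γ i).trace
    = half R * D (Sum.inr (Sum.inl i)) (gi * dmat (D (Sum.inr (Sum.inr ()))) g).trace := by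
  set d := D (Sum.inr (Sum.inr ())) with hd
  set e := D (Sum.inr (Sum.inl i)) with he
  have h1 : 2 * (Γ i).trace = (gi * dmat e g).trace := by
    rw [A.lc.compat i, mul_add, trace_add, ← mul_assoc gi g, A.inv_mul, one_mul, ← mul_assoc,
      trace_mul_comm, ← mul_assoc, A.mul_inv, one_mul, trace_transpose, two_mul]
  have h2 : d (2 * (Γ i).trace) = e (gi * dmat d g).trace := by
    have hc : dmat d (dmat e g) = dmat e (dmat d g) := by
      ext a b; exact A.comm _ _ _
    rw [h1, ← trace_dmat, ← trace_dmat, dmat_mul, dmat_mul, dmat_of_inv _ A.inv_mul A.mul_inv,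
      dmat_of_inv _ A.inv_mul A.mul_inv, trace_add, trace_add, hc]
    congr 1
    rw [neg_mul, neg_mul, trace_neg, trace_neg, mul_assoc, trace_mul_comm]
    simp only [mul_assoc]
  rw [← h2, Derivation.leibniz, derivation_two, smul_zero, add_zero, smul_eq_mul, ← mul_assoc,
    mul_comm (half R), two_mul_half, one_mul]

/-- The `TM ⊗ TM` components of the ambient Ricci tensor. -/
lemma ric_ij (i j : ι) {K g' : Matrix ι ι R}
    (hg' : g' = dmat (D (Sum.inr (Sum.inr ()))) g) (hK : K = gi * g') :
    ric D (ambConn t ti r g g' K Γ) (Sum.inr (Sum.inl i)) (Sum.inr (Sum.inl j))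
      = r * D (Sum.inr (Sum.inr ())) (g' i j) - r * (g' * K) i j
        + half R * r * K.trace * g' i j - (half R * (Fintype.card ι : R) - 1) * g' i j
        - half R * K.trace * g i j
        + ric (fun i => D (Sum.inr (Sum.inl i))) Γ i j := by
  simp only [ric_apply, ambConn, of_apply, Fintype.sum_sum_type, Finset.univ_unique,
    Finset.sum_singleton, mul_zero, zero_mul, add_zero, zero_add, Finset.sum_const_zero, map_zero,
    ite_mul, mul_ite, sub_zero, zero_sub, Finset.sum_add_distrib, Finset.sum_sub_distrib,
    Finset.sum_ite_eq', Finset.sum_ite_eq, Finset.mem_univ, if_true, neg_zero]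
  set d := D (Sum.inr (Sum.inr ())) with hd
  have hs : ∀ i j, g i j = g j i := fun i j => by conv_lhs => rw [← A.symm, transpose_apply]
  have hs' : g'ᵀ = g' := by rw [hg', ← dmat_transpose, A.symm]
  have hsa : ∀ i j, g' i j = g' j i := fun i j => by conv_lhs => rw [← hs', transpose_apply]
  have hgK : g * K = g' := by rw [hK, ← mul_assoc, A.mul_inv, one_mul]
  have hKg : Kᵀ * g = g' := by
    rw [← hs', ← hgK, transpose_mul, A.symm]
  have hKg' : Kᵀ * g' = g' * K := by
    rw [← hgK, ← mul_assoc, hKg, hgK]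
  have e1 : D (Sum.inl ()) (-(half R * t * g' j i)) = -(half R * g' i j) := by
    have : D (Sum.inl ()) (g' i j) = 0 := by
      rw [hg', dmat_apply, A.comm, A.D_t_g, map_zero]
    simp [A.D_t_t, this, hsa j i, mul_comm]
  have e2 : d (-g j i + r * g' j i) = r * d (g' i j) := by
    have h1 : d (g i j) = g' i j := by rw [hg']; rfl
    rw [hs j i, hsa j i, map_add, map_neg, Derivation.leibniz, A.D_r_r, h1]
    simp
  have e3 : ∀ c, ∑ x, half R * K x x * c = half R * K.trace * c := by
    intro c
    simp only [trace, diag_apply, Finset.mul_sum, Finset.sum_mul]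
  have e4 : ∑ x, (-g j x + r * g' j x) * (half R * K x i)
      = half R * (-(g * K) j i + r * (g' * K) j i) := by
    simp only [mul_apply, Finset.mul_sum, ← Finset.sum_neg_distrib, ← Finset.sum_add_distrib]
    exact Finset.sum_congr rfl fun x _ => by ring
  have e5 : ∑ x, half R * K x j * (-g x i + r * g' x i)
      = half R * (-(Kᵀ * g) j i + r * (Kᵀ * g') j i) := by
    simp only [mul_apply, transpose_apply, Finset.mul_sum, ← Finset.sum_neg_distrib,
      ← Finset.sum_add_distrib]
    exact Finset.sum_congr rfl fun x _ => by ring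
  have e6 : (g' * K) j i = (g' * K) i j := by
    conv_lhs => rw [← transpose_apply (g' * K), transpose_mul, hs', hKg']
  rw [e4, e5, hgK, hKg, hKg', e6, e3]
  change D (Sum.inl ()) _ + (_ + d _) - _ + _ = _
  rw [e1, e2, Finset.sum_const, Finset.card_univ, nsmul_eq_mul, hsa j i, hs j i]
  linear_combination (- half R * g' i j * (Fintype.card ι + 1) + 2 * half R * g' i j) * A.t_mul
    + (g' i j - r * (g' * K) i j) * two_mul_half (R := R)

/-- The mixed components of the ambient Ricci tensor. -/
lemma ric_ir (i : ι) {K g' : Matrix ι ι R}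
    (hg' : g' = dmat (D (Sum.inr (Sum.inr ()))) g) (hK : K = gi * g') :
    ric D (ambConn t ti r g g' K Γ) (Sum.inr (Sum.inl i)) (Sum.inr (Sum.inr ()))
      = half R * (divg (fun i => D (Sum.inr (Sum.inl i))) Γ K i
        - D (Sum.inr (Sum.inl i)) K.trace) := by
  simp only [ric_apply, ambConn, of_apply, Fintype.sum_sum_type, Finset.univ_unique,
    Finset.sum_singleton, mul_zero, zero_mul, add_zero, zero_add, Finset.sum_const_zero, map_zero,
    ite_mul, mul_ite, sub_zero, zero_sub, Finset.sum_add_distrib, Finset.sum_sub_distrib,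
    Finset.sum_ite_eq', Finset.sum_ite_eq, Finset.mem_univ, if_true, neg_zero]
  have e1 : ∑ x, D (Sum.inr (Sum.inr default)) (Γ x x i)
      = half R * D (Sum.inr (Sum.inl i)) K.trace := by
    rw [hK, hg', ← A.D_r_trace i, ← map_sum]
    simp only [trace, diag_apply]
    exact congrArg _ (Finset.sum_congr rfl fun x _ => A.lc.symm _ _ _)
  have e2 : ∑ x, ∑ y, Γ x x y * (half R * K y i) = half R * ∑ x, (Γ x * K) x i := by
    simp only [mul_apply, Finset.mul_sum]
    exact Finset.sum_congr rfl fun x _ => Finset.sum_congr rfl fun y _ => by ring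
  have e3 : ∑ x, ∑ y, half R * K x y * Γ x y i = half R * ∑ x, (K * Γ x) x i := by
    simp only [mul_apply, Finset.mul_sum]
    exact Finset.sum_congr rfl fun x _ => Finset.sum_congr rfl fun y _ => by ring
  have e4 : ∑ x, D (Sum.inr (Sum.inl x)) (half R * K x i)
      = half R * ∑ x, D (Sum.inr (Sum.inl x)) (K x i) := by
    simp [Derivation.leibniz, Finset.mul_sum]
  rw [e1, e2, e3, e4]
  simp only [divg, cov_apply, Finset.sum_add_distrib, Finset.sum_sub_distrib]
  ring

/-- The component of the ambient Ricci tensor in the direction of `r`. -/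
lemma ric_rr {K g' : Matrix ι ι R} :
    ric D (ambConn t ti r g g' K Γ) (Sum.inr (Sum.inr ())) (Sum.inr (Sum.inr ()))
      = - half R * D (Sum.inr (Sum.inr ())) K.trace - half R ^ 2 * (K * K).trace := by
  simp only [ric_apply, ambConn, of_apply, Fintype.sum_sum_type, Finset.univ_unique,
    Finset.sum_singleton, mul_zero, zero_mul, add_zero, zero_add, Finset.sum_const_zero, map_zero,
    ite_mul, mul_ite, sub_zero, zero_sub, Finset.sum_add_distrib, Finset.sum_sub_distrib,
    Finset.sum_ite_eq', Finset.sum_ite_eq, Finset.mem_univ, if_true, neg_zero]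
  have e1 : ∑ x, -D (Sum.inr (Sum.inr ())) (half R * K x x)
      = - half R * D (Sum.inr (Sum.inr ())) K.trace := by
    simp [Derivation.leibniz, Finset.mul_sum, trace]
  have e2 : ∑ x, ∑ y, -(half R * K x y * (half R * K y x)) = - (half R ^ 2 * (K * K).trace) := by
    simp only [trace, diag_apply, mul_apply, Finset.mul_sum, ← Finset.sum_neg_distrib]
    exact Finset.sum_congr rfl fun x _ => Finset.sum_congr rfl fun y _ => by ring
  rw [e1, e2]
  ring

/-- The ambient Ricci tensor has no components in the direction of `t`. -/
lemma ric_t {K g' : Matrix ι ι R} (b : Unit ⊕ ι ⊕ Unit) :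
    ric D (ambConn t ti r g g' K Γ) (Sum.inl ()) b = 0 := by
  have h0 := A.D_ti (Sum.inl ())
  have hi := fun i => A.D_ti (Sum.inr (Sum.inl i))
  have hr := A.D_ti (Sum.inr (Sum.inr ()))
  rw [A.D_t_t, mul_one] at h0
  simp only [A.D_i_t, mul_zero] at hi
  rw [A.D_r_t, mul_zero] at hr
  rcases b with _ | i | _
  · simp only [ric_apply, ambConn, of_apply, Fintype.sum_sum_type, Finset.univ_unique,
      Finset.sum_singleton, mul_zero, zero_mul, add_zero, zero_add, Finset.sum_const_zero, map_zero,
      ite_mul, mul_ite, sub_zero, zero_sub, Finset.sum_add_distrib, Finset.sum_sub_distrib,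
      Finset.sum_ite_eq', Finset.sum_ite_eq, Finset.mem_univ, if_true, neg_zero]
    change ∑ x : ι, -D (Sum.inl ()) ti + -D (Sum.inl ()) ti + _ = _
    simp only [h0, Finset.sum_neg_distrib, Finset.sum_ite_eq', Finset.sum_ite_eq,
      Finset.mem_univ, if_true, Finset.sum_const]
    ring
  · simp only [ric_apply, ambConn, of_apply, Fintype.sum_sum_type, Finset.univ_unique,
      Finset.sum_singleton, mul_zero, zero_mul, add_zero, zero_add, Finset.sum_const_zero, map_zero,
      ite_mul, mul_ite, sub_zero, zero_sub, Finset.sum_add_distrib, Finset.sum_sub_distrib,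
      Finset.sum_ite_eq', Finset.sum_ite_eq, Finset.mem_univ, if_true, neg_zero]
    have e : ∀ x, D (Sum.inr (Sum.inl x)) (if x = i then ti else 0) = 0 := by
      intro x
      split_ifs
      · exact hi x
      · exact map_zero _
    simp only [hi, e, A.lc.symm i, Finset.sum_const_zero]
    ring
  · simp only [ric_apply, ambConn, of_apply, Fintype.sum_sum_type, Finset.univ_unique,
      Finset.sum_singleton, mul_zero, zero_mul, add_zero, zero_add, Finset.sum_const_zero, map_zero,
      ite_mul, mul_ite, sub_zero, zero_sub, Finset.sum_add_distrib, Finset.sum_sub_distrib,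
      Finset.sum_ite_eq', Finset.sum_ite_eq, Finset.mem_univ, if_true, neg_zero]
    change D (Sum.inr (Sum.inr ())) ti - (∑ x : ι, D (Sum.inr (Sum.inr ())) ti
      + D (Sum.inr (Sum.inr ())) ti) + _ = _
    simp [hr]

end IsAmbient

end Ambient

/-! ### The ring of smooth functions on an open subset of a coordinate space -/

section SmoothFunctions

open TopologicalSpace

variable {κ : Type*} [Fintype κ] [DecidableEq κ]

/-- The algebra of smooth functions on an open subset of `ℝ^κ`. -/
def SmoothFn (Ω : Opens (κ → ℝ)) : Subalgebra ℝ (Ω → ℝ) where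
  carrier := {f | ∃ F : (κ → ℝ) → ℝ, ContDiffOn ℝ ∞ F Ω ∧ ∀ z : Ω, f z = F z}
  mul_mem' := by
    rintro f f' ⟨F, hF, h⟩ ⟨F', hF', h'⟩
    exact ⟨fun z => F z * F' z, hF.mul hF', fun z => by simp [h, h']⟩
  add_mem' := by
    rintro f f' ⟨F, hF, h⟩ ⟨F', hF', h'⟩
    exact ⟨fun z => F z + F' z, hF.add hF', fun z => by simp [h, h']⟩
  algebraMap_mem' c := ⟨fun _ => c, contDiffOn_const, fun _ => rfl⟩

variable {Ω : Opens (κ → ℝ)}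

/-- The smooth function on `Ω` given by a function on the whole space which is smooth on `Ω`. -/
def SmoothFn.of (F : (κ → ℝ) → ℝ) (hF : ContDiffOn ℝ ∞ F Ω) : SmoothFn Ω :=
  ⟨fun z => F z, F, hF, fun _ => rfl⟩

/-- Extension of a function on `Ω` by zero. -/
def extendZero (f : SmoothFn Ω) : (κ → ℝ) → ℝ := Function.extend Subtype.val f.1 0

lemma extendZero_apply (f : SmoothFn Ω) {z : κ → ℝ} (hz : z ∈ Ω) :
    extendZero f z = f.1 ⟨z, hz⟩ :=
  Subtype.val_injective.extend_apply f.1 0 ⟨z, hz⟩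

lemma contDiffOn_extendZero (f : SmoothFn Ω) : ContDiffOn ℝ ∞ (extendZero f) Ω := by
  obtain ⟨F, hF, h⟩ := f.2
  exact hF.congr fun z hz => by rw [extendZero_apply f hz, h]

lemma pderiv_congr {k : κ} {F F' : (κ → ℝ) → ℝ} {z : κ → ℝ} (h : F =ᶠ[nhds z] F') :
    pderiv k F z = pderiv k F' z := by
  rw [pderiv, pderiv, h.fderiv_eq]

lemma contDiffOn_pderiv {k : κ} {F : (κ → ℝ) → ℝ} (hF : ContDiffOn ℝ ∞ F Ω) :
    ContDiffOn ℝ ∞ (pderiv k F) Ω :=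
  (hF.fderiv_of_isOpen Ω.2 (by simp)).clm_apply contDiffOn_const

lemma eventuallyEq_of_forall_mem {F F' : (κ → ℝ) → ℝ} (h : ∀ z ∈ Ω, F z = F' z) {z : κ → ℝ}
    (hz : z ∈ Ω) : F =ᶠ[nhds z] F' := by
  filter_upwards [Ω.2.mem_nhds hz] with w hw using h w hw

lemma differentiableAt_extendZero (f : SmoothFn Ω) {z : κ → ℝ} (hz : z ∈ Ω) :
    DifferentiableAt ℝ (extendZero f) z :=
  ((contDiffOn_extendZero f).contDiffAt (Ω.2.mem_nhds hz)).differentiableAt (by simp)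

/-- The partial derivative as a derivation of the ring of smooth functions. -/
def partialD (k : κ) : Derivation ℝ (SmoothFn Ω) (SmoothFn Ω) :=
  Derivation.mk'
    { toFun := fun f => SmoothFn.of (pderiv k (extendZero f))
        (contDiffOn_pderiv (contDiffOn_extendZero f))
      map_add' := by
        intro f f'
        refine Subtype.ext (funext fun z => ?_)
        change pderiv k _ _ = pderiv k _ _ + pderiv k _ _
        rw [pderiv_congr (F' := extendZero f + extendZero f') (eventuallyEq_of_forall_mem
          (fun w hw => by simp [extendZero_apply _ hw]) z.2)]
        simp only [pderiv]
        rw [fderiv_add (differentiableAt_extendZero f z.2) (differentiableAt_extendZero f' z.2)]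
        rfl
      map_smul' := by
        intro c f
        refine Subtype.ext (funext fun z => ?_)
        change pderiv k _ _ = c * pderiv k _ _
        rw [pderiv_congr (F' := c • extendZero f) (eventuallyEq_of_forall_mem
          (fun w hw => by simp [extendZero_apply _ hw]) z.2)]
        simp only [pderiv]
        rw [fderiv_const_smul (differentiableAt_extendZero f z.2)]
        rfl }
    (by
      intro f f'
      refine Subtype.ext (funext fun z => ?_)
      change pderiv k _ _ = f.1 z * pderiv k _ _ + f'.1 z * pderiv k _ _
      rw [pderiv_congr (F' := extendZero f * extendZero f') (eventuallyEq_of_forall_mem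
          (fun w hw => by simp [extendZero_apply _ hw]) z.2)]
      simp only [pderiv]
      rw [fderiv_mul (differentiableAt_extendZero f z.2) (differentiableAt_extendZero f' z.2),
        extendZero_apply f z.2, extendZero_apply f' z.2]
      rfl)

lemma partialD_apply (k : κ) (f : SmoothFn Ω) (z : Ω) :
    (partialD k f).1 z = pderiv k (extendZero f) z := rfl

lemma partialD_comm (k l : κ) (f : SmoothFn Ω) :
    partialD k (partialD l f) = partialD l (partialD k f) := by
  refine Subtype.ext (funext fun z => ?_)
  have h2 : ∀ k l, (partialD k (partialD l f)).1 z =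
      fderiv ℝ (fderiv ℝ (extendZero f)) z (Pi.single k 1) (Pi.single l 1) := by
    intro k l
    rw [partialD_apply, pderiv_congr (F' := pderiv l (extendZero f)) (eventuallyEq_of_forall_mem
      (fun w hw => by rw [extendZero_apply _ hw, partialD_apply]) z.2)]
    have hd : DifferentiableAt ℝ (fderiv ℝ (extendZero f)) z :=
      (((contDiffOn_extendZero f).fderiv_of_isOpen (m := ∞) Ω.2 (by simp)).contDiffAt
        (Ω.2.mem_nhds z.2)).differentiableAt (by simp)
    have : pderiv l (extendZero f) = fun w => fderiv ℝ (extendZero f) w (Pi.single l 1) := rfl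
    rw [pderiv, this, fderiv_clm_apply hd (differentiableAt_const _)]
    simp
  rw [h2, h2]
  exact ((contDiffOn_extendZero f).contDiffAt (Ω.2.mem_nhds z.2)).isSymmSndFDerivAt
    (by simp [ENat.LEInfty.out]) _ _

/-- Evaluation at a point. -/
def ev (z : Ω) : SmoothFn Ω →ₐ[ℝ] ℝ := (Pi.evalAlgHom ℝ _ z).comp (SmoothFn Ω).val

lemma ev_apply (z : Ω) (f : SmoothFn Ω) : ev z f = f.1 z := rfl

lemma SmoothFn.ext_ev {f f' : SmoothFn Ω} (h : ∀ z, ev z f = ev z f') : f = f' :=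
  Subtype.ext (funext h)

variable {ι : Type*} [Fintype ι] [DecidableEq ι]

/-- `s` is an affine embedding sending the coordinate directions `k` to the coordinate directions
`σ k`. -/
def IsSlice (s : (ι → ℝ) → (κ → ℝ)) (σ : ι → κ) : Prop :=
  ∀ y, ∃ L : (ι → ℝ) →L[ℝ] (κ → ℝ), HasFDerivAt s L y ∧
    ∀ k, L (Pi.single k 1) = Pi.single (σ k) 1

variable (Ω) in
/-- The partial derivatives in the coordinate directions `σ i`. -/
def sliceD (σ : ι → κ) (i : ι) : Derivation ℝ (SmoothFn Ω) (SmoothFn Ω) := partialD (σ i)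

variable {s : (ι → ℝ) → (κ → ℝ)} {σ : ι → κ}

lemma IsSlice.continuous (hs : IsSlice s σ) : Continuous s :=
  continuous_iff_continuousAt.2 fun y => (hs y).choose_spec.1.continuousAt

lemma IsSlice.pderiv_eq (hs : IsSlice s σ) {F : (ι → ℝ) → ℝ} {f : SmoothFn Ω}
    (h : ∀ y (hy : s y ∈ Ω), F y = ev ⟨s y, hy⟩ f) {y : ι → ℝ} (hy : s y ∈ Ω) (k : ι) :
    pderiv k F y = ev ⟨s y, hy⟩ (partialD (σ k) f) := by
  obtain ⟨L, hL, hk⟩ := hs y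
  have h1 : F =ᶠ[nhds y] extendZero f ∘ s := by
    filter_upwards [(Ω.2.preimage hs.continuous).mem_nhds hy] with w hw
    rw [h w hw, Function.comp, extendZero_apply f hw, ev_apply]
  have h2 := (differentiableAt_extendZero f hy).hasFDerivAt.comp y hL
  rw [pderiv_congr h1, pderiv, h2.fderiv, ContinuousLinearMap.comp_apply, hk]
  rfl

variable {G : (ι → ℝ) → Matrix ι ι ℝ} {g gi : Matrix ι ι (SmoothFn Ω)}

lemma inv_eq_map_ev (hgi : g * gi = 1) (z : Ω) : (g.map (ev z))⁻¹ = gi.map (ev z) := by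
  apply Matrix.inv_eq_right_inv
  rw [← Matrix.map_mul, hgi, Matrix.map_one _ (map_zero _) (map_one _)]

lemma IsSlice.christoffel_eq (hs : IsSlice s σ)
    (h : ∀ y (hy : s y ∈ Ω), G y = g.map (ev ⟨s y, hy⟩)) (hgi : g * gi = 1)
    {y : ι → ℝ} (hy : s y ∈ Ω) (k i j : ι) :
    christoffel G k i j y = ev ⟨s y, hy⟩ (chr (sliceD Ω σ) g gi i k j) := by
  have hp : ∀ i j l, pderiv l (fun z => G z i j) y = ev ⟨s y, hy⟩ (sliceD Ω σ l (g i j)) :=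
    fun i j l => hs.pderiv_eq (F := fun z => G z i j) (f := g i j)
      (fun w hw => by rw [h w hw]; rfl) hy l
  simp only [christoffel, chr, of_apply, hp, h y hy, inv_eq_map_ev hgi, Matrix.map_apply, map_smul,
    map_sum, map_mul, map_add, map_sub, smul_eq_mul]

lemma IsSlice.ricci_eq (hs : IsSlice s σ)
    (h : ∀ y (hy : s y ∈ Ω), G y = g.map (ev ⟨s y, hy⟩)) (hg : gᵀ = g) (hgi : g * gi = 1)
    {y : ι → ℝ} (hy : s y ∈ Ω) :
    ricci G y = (ric (sliceD Ω σ) (chr (sliceD Ω σ) g gi)).map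
      (ev ⟨s y, hy⟩) := by
  have hsym := (isLeviCivita_chr (sliceD Ω σ) hg hgi).symm
  ext i j
  have hc : ∀ k i j, christoffel G k i j y
      = ev ⟨s y, hy⟩ (chr (sliceD Ω σ) g gi i k j) :=
    fun k i j => hs.christoffel_eq h hgi hy k i j
  have hp : ∀ k i j l, pderiv l (christoffel G k i j) y
      = ev ⟨s y, hy⟩ (sliceD Ω σ l (chr (sliceD Ω σ) g gi i k j)) :=
    fun k i j l => hs.pderiv_eq (F := christoffel G k i j)
      (f := chr (sliceD Ω σ) g gi i k j)
      (fun w hw => hs.christoffel_eq h hgi hw k i j) hy l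
  rw [Matrix.map_apply, ric_apply]
  simp only [ricci, of_apply, hp, hc, map_sum, map_add, map_sub, map_mul]
  refine Finset.sum_congr rfl fun k _ => ?_
  rw [hsym i k j, hsym i k k]
  congr 1
  exact Finset.sum_congr rfl fun l _ => by rw [hsym i l j, hsym i l k]

lemma sum_cov_lower {R : Type*} [CommRing R] [Algebra ℝ R] {D : ι → Derivation ℝ R R}
    {g gi T : Matrix ι ι R} {Γ : ι → Matrix ι ι R} (hgi : g * gi = 1) (hgi' : gi * g = 1)
    (h : IsLeviCivita D g Γ) (hT : Tᵀ = T) (i : ι) :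
    ∑ k, ∑ l, gi k l * (D k (T i l) - ∑ m, (Γ k m i * T m l + Γ k m l * T i m))
      = divg D Γ (gi * T) i := by
  have hs : ∀ i j, T i j = T j i := fun i j => by conv_lhs => rw [← hT, transpose_apply]
  refine Finset.sum_congr rfl fun k _ => ?_
  have : cov D Γ k (gi * T) = gi * (dmat (D k) T - (Γ k)ᵀ * T - T * Γ k) := by
    rw [cov, dmat_mul, dmat_inv hgi' hgi h]; noncomm_ring
  rw [this, mul_apply]
  refine Finset.sum_congr rfl fun l _ => ?_
  simp only [Matrix.sub_apply, dmat_apply, mul_apply, transpose_apply, Finset.sum_add_distrib]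
  have e1 : ∑ m, T l m * Γ k m i = ∑ m, Γ k m i * T m l :=
    Finset.sum_congr rfl fun m _ => by rw [hs l m, mul_comm]
  have e2 : ∑ m, Γ k m l * T i m = ∑ m, Γ k m l * T m i :=
    Finset.sum_congr rfl fun m _ => by rw [hs i m]
  rw [hs i l, e1, e2]
  ring

lemma IsSlice.divergence_eq (hs : IsSlice s σ)
    (h : ∀ y (hy : s y ∈ Ω), G y = g.map (ev ⟨s y, hy⟩)) (hg : gᵀ = g) (hgi : g * gi = 1)
    (hgi' : gi * g = 1) {T : (ι → ℝ) → Matrix ι ι ℝ} {T' : Matrix ι ι (SmoothFn Ω)}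
    (hT : ∀ y (hy : s y ∈ Ω), T y = T'.map (ev ⟨s y, hy⟩)) (hT' : T'ᵀ = T')
    {y : ι → ℝ} (hy : s y ∈ Ω) (i : ι) :
    divergence G T i y = ev ⟨s y, hy⟩ (divg (sliceD Ω σ)
      (chr (sliceD Ω σ) g gi) (gi * T') i) := by
  rw [← sum_cov_lower hgi hgi' (isLeviCivita_chr _ hg hgi) hT']
  have hp : ∀ i j l, pderiv l (fun z => T z i j) y = ev ⟨s y, hy⟩ (sliceD Ω σ l (T' i j)) :=
    fun i j l => hs.pderiv_eq (F := fun z => T z i j) (f := T' i j)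
      (fun w hw => by rw [hT w hw]; rfl) hy l
  have hsym := (isLeviCivita_chr (sliceD Ω σ) hg hgi).symm
  simp only [divergence, covDerivTensor, hp, hs.christoffel_eq h hgi hy, hT y hy, h y hy,
    inv_eq_map_ev hgi, Matrix.map_apply, map_sum, map_mul, map_sub, map_add]

end SmoothFunctions

/-! ### Functions vanishing to a given order -/

section Vanishing

variable {R : Type*} [CommRing R] [Algebra ℝ R]

/-- The ideal of elements `f` such that `f, δ f, …, δ^(k-1) f` lie in the ideal `Z`. -/
def vanIdeal (δ : Derivation ℝ R R) (Z : Ideal R) : ℕ → Ideal R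
  | 0 => ⊤
  | k + 1 =>
    { carrier := {f | f ∈ vanIdeal δ Z k ∧ f ∈ Z ∧ δ f ∈ vanIdeal δ Z k}
      zero_mem' := by simp
      add_mem' := fun ha hb => ⟨add_mem ha.1 hb.1, add_mem ha.2.1 hb.2.1, by
        rw [map_add]; exact add_mem ha.2.2 hb.2.2⟩
      smul_mem' := fun c f hf => ⟨Ideal.mul_mem_left _ _ hf.1, Ideal.mul_mem_left _ _ hf.2.1, by
        rw [smul_eq_mul, Derivation.leibniz]
        exact add_mem (Ideal.mul_mem_left _ _ hf.2.2) (Ideal.mul_mem_right _ _ hf.1)⟩ }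

variable {δ : Derivation ℝ R R} {Z : Ideal R} {k : ℕ} {f r : R}

lemma mem_vanIdeal_zero : f ∈ vanIdeal δ Z 0 := Submodule.mem_top

lemma vanIdeal_succ_le (k : ℕ) : vanIdeal δ Z (k + 1) ≤ vanIdeal δ Z k := fun _ h => h.1

lemma mem_vanIdeal_succ : f ∈ vanIdeal δ Z (k + 1) ↔ f ∈ Z ∧ δ f ∈ vanIdeal δ Z k := by
  refine ⟨fun h => h.2, fun h => ?_⟩
  induction k with
  | zero => exact ⟨mem_vanIdeal_zero, h⟩
  | succ k ih => exact ⟨ih ⟨h.1, vanIdeal_succ_le k h.2⟩, h⟩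

lemma vanIdeal_one : vanIdeal δ Z 1 = Z := by
  ext f
  rw [show 1 = 0 + 1 from rfl, mem_vanIdeal_succ]
  exact ⟨fun h => h.1, fun h => ⟨h, mem_vanIdeal_zero⟩⟩

lemma mem_vanIdeal_iff : f ∈ vanIdeal δ Z k ↔ ∀ j < k, δ^[j] f ∈ Z := by
  induction k generalizing f with
  | zero => simp [mem_vanIdeal_zero]
  | succ k ih =>
    rw [mem_vanIdeal_succ, ih]
    constructor
    · rintro ⟨h0, h⟩ (_ | j) hj
      · exact h0
      · exact h j (by omega)
    · intro h
      exact ⟨h 0 (by omega), fun j hj => h (j + 1) (by omega)⟩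

lemma derivation_mem_vanIdeal {D : Derivation ℝ R R} (hD : ∀ a, D (δ a) = δ (D a))
    (hZ : ∀ a ∈ Z, D a ∈ Z) (hf : f ∈ vanIdeal δ Z k) : D f ∈ vanIdeal δ Z k := by
  induction k generalizing f with
  | zero => exact mem_vanIdeal_zero
  | succ k ih =>
    rw [mem_vanIdeal_succ] at hf ⊢
    exact ⟨hZ _ hf.1, by rw [← hD]; exact ih hf.2⟩

lemma mul_mem_vanIdeal_succ (hr : r ∈ Z) (hδ : δ r = 1) (hf : f ∈ vanIdeal δ Z k) :
    r * f ∈ vanIdeal δ Z (k + 1) := by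
  induction k generalizing f with
  | zero => rw [zero_add, vanIdeal_one]; exact Ideal.mul_mem_right _ _ hr
  | succ k ih =>
    rw [mem_vanIdeal_succ]
    refine ⟨Ideal.mul_mem_right _ _ hr, ?_⟩
    rw [Derivation.leibniz, hδ, smul_eq_mul, smul_eq_mul, mul_one]
    exact add_mem (ih hf.2.2) hf

lemma smul_mem_ideal {I : Ideal R} (c : ℝ) (hf : f ∈ I) : c • f ∈ I := by
  rw [Algebra.smul_def]; exact Ideal.mul_mem_left _ _ hf

lemma smul_mem_ideal_iff {I : Ideal R} {c : ℝ} (hc : c ≠ 0) : c • f ∈ I ↔ f ∈ I := by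
  refine ⟨fun h => ?_, smul_mem_ideal c⟩
  have := smul_mem_ideal c⁻¹ h
  rwa [smul_smul, inv_mul_cancel₀ hc, one_smul] at this

lemma derivation_indicial (hδ : δ r = 1) (c : ℝ) :
    δ (r * δ f - c • f) = r * δ (δ f) - (c - 1) • δ f := by
  rw [map_sub, Derivation.leibniz, hδ, Derivation.map_smul, sub_smul, one_smul, smul_eq_mul,
    smul_eq_mul, mul_one]
  ring

/-- The operator `r δ - c` has trivial kernel on formal power series in `r` up to order `k`, if
`c` is not one of `0, …, k - 1`. -/
lemma mem_vanIdeal_of_indicial (hr : r ∈ Z) (hδ : δ r = 1) {c : ℝ} (hc : ∀ j < k, c ≠ (j : ℕ))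
    (h : r * δ f - c • f ∈ vanIdeal δ Z k) : f ∈ vanIdeal δ Z k := by
  induction k generalizing f c with
  | zero => exact mem_vanIdeal_zero
  | succ k ih =>
    rw [mem_vanIdeal_succ] at h ⊢
    constructor
    · have h1 : r * δ f - (r * δ f - c • f) ∈ Z := sub_mem (Ideal.mul_mem_right _ _ hr) h.1
      rw [sub_sub_cancel] at h1
      exact (smul_mem_ideal_iff (by exact_mod_cast hc 0 (by omega))).1 h1
    · refine ih (c := c - 1) (fun j hj hcj => hc (j + 1) (by omega) ?_) ?_
      · push_cast; linarith
      · rw [← derivation_indicial hδ]; exact h.2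

/-- The operator `r δ - k` kills the coefficient of `r^k`. -/
lemma indicial_mem_vanIdeal (hr : r ∈ Z) (hδ : δ r = 1) (hf : f ∈ vanIdeal δ Z k) :
    r * δ f - (k : ℝ) • f ∈ vanIdeal δ Z (k + 1) := by
  induction k generalizing f with
  | zero =>
    rw [zero_add, vanIdeal_one, Nat.cast_zero, zero_smul, sub_zero]
    exact Ideal.mul_mem_right _ _ hr
  | succ k ih =>
    rw [mem_vanIdeal_succ]
    rw [mem_vanIdeal_succ] at hf
    refine ⟨sub_mem (Ideal.mul_mem_right _ _ hr) (smul_mem_ideal _ hf.1), ?_⟩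
    rw [derivation_indicial hδ]
    have := ih hf.2
    convert this using 3
    push_cast; ring

end Vanishing

/-! ### Change of rings -/

section Maps

variable {ι R R' : Type*} [Fintype ι] [DecidableEq ι] [CommRing R] [Algebra ℝ R]
  [CommRing R'] [Algebra ℝ R']

/-- A derivation preserving an ideal induces a derivation of the quotient. -/
def quotD (I : Ideal R) (D : Derivation ℝ R R) (h : ∀ a ∈ I, D a ∈ I) :
    Derivation ℝ (R ⧸ I) (R ⧸ I) :=
  Derivation.mk' (Submodule.mapQ (I.restrictScalars ℝ) (I.restrictScalars ℝ) D.toLinearMap h)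
    (by
      intro a b
      obtain ⟨a, rfl⟩ := Ideal.Quotient.mk_surjective a
      obtain ⟨b, rfl⟩ := Ideal.Quotient.mk_surjective b
      change Ideal.Quotient.mk I (D (a * b)) = Ideal.Quotient.mk I a * Ideal.Quotient.mk I (D b)
        + Ideal.Quotient.mk I b * Ideal.Quotient.mk I (D a)
      rw [← map_mul, ← map_mul, ← map_add, Derivation.leibniz, smul_eq_mul, smul_eq_mul])

variable {D : ι → Derivation ℝ R R} {D' : ι → Derivation ℝ R' R'} {φ : R →ₐ[ℝ] R'}
  {g gi E S A : Matrix ι ι R} {Γ : ι → Matrix ι ι R}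

lemma dmat_map {δ : Derivation ℝ R R} {δ' : Derivation ℝ R' R'} (h : ∀ a, δ' (φ a) = φ (δ a))
    (A : Matrix ι ι R) : dmat δ' (A.map φ) = (dmat δ A).map φ := by
  ext i j; exact h _

lemma matrix_map_one (φ : R →ₐ[ℝ] R') : (1 : Matrix ι ι R).map φ = 1 :=
  Matrix.map_one _ (map_zero _) (map_one _)

lemma matrix_map_add (A B : Matrix ι ι R) : (A + B).map φ = A.map φ + B.map φ :=
  Matrix.map_add _ (map_add φ) _ _

lemma matrix_map_sub (A B : Matrix ι ι R) : (A - B).map φ = A.map φ - B.map φ :=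
  Matrix.map_sub _ (map_sub φ) _ _

lemma matrix_map_zero : (0 : Matrix ι ι R).map φ = 0 := Matrix.map_zero _ (map_zero φ)

lemma IsLeviCivita.map (hφ : ∀ i a, D' i (φ a) = φ (D i a)) (h : IsLeviCivita D g Γ) :
    IsLeviCivita D' (g.map φ) (fun i => (Γ i).map φ) := by
  refine ⟨fun k i j => congrArg φ (h.symm k i j), fun k => ?_⟩
  rw [dmat_map (hφ k), h.compat, matrix_map_add, Matrix.map_mul, Matrix.map_mul,
    transpose_map]

lemma cov_map (hφ : ∀ i a, D' i (φ a) = φ (D i a)) (k : ι) (A : Matrix ι ι R) :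
    cov D' (fun i => (Γ i).map φ) k (A.map φ) = (cov D Γ k A).map φ := by
  rw [cov, cov, dmat_map (hφ k), matrix_map_sub, matrix_map_add, Matrix.map_mul, Matrix.map_mul]

lemma divg_map (hφ : ∀ i a, D' i (φ a) = φ (D i a)) (i : ι) (A : Matrix ι ι R) :
    divg D' (fun i => (Γ i).map φ) (A.map φ) i = φ (divg D Γ A i) := by
  simp only [divg, cov_map hφ, map_sum, Matrix.map_apply]

lemma ric_map (hφ : ∀ i a, D' i (φ a) = φ (D i a)) :
    ric D' (fun i => (Γ i).map φ) = (ric D Γ).map φ := by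
  ext i j
  simp only [ric_apply, Matrix.map_apply, map_sum, map_add, map_sub, map_mul, hφ]

lemma IsWalker.map (hφ : ∀ i a, D' i (φ a) = φ (D i a)) (hs : Function.Surjective φ)
    (w : IsWalker D g gi Γ E) :
    IsWalker D' (g.map φ) (gi.map φ) (fun i => (Γ i).map φ) (E.map φ) where
  comm i j a := by
    obtain ⟨a, rfl⟩ := hs a
    rw [hφ, hφ, hφ, hφ, w.comm]
  symm := by rw [← transpose_map, w.symm]
  mul_inv := by rw [← Matrix.map_mul, w.mul_inv, matrix_map_one]
  inv_mul := by rw [← Matrix.map_mul, w.inv_mul, matrix_map_one]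
  lc := w.lc.map hφ
  idem := by rw [← Matrix.map_mul, w.idem]
  null := by rw [← transpose_map, ← Matrix.map_mul, ← Matrix.map_mul, w.null, matrix_map_zero]
  parallel k := by
    rw [dmat_map (hφ k), ← Matrix.map_mul, ← matrix_map_add, ← Matrix.map_mul, w.parallel]

end Maps

/-! ### The perturbed metric modulo an ideal -/

section Modulo

variable {ι R : Type*} [Fintype ι] [DecidableEq ι] [CommRing R] [Algebra ℝ R]

/-- Two matrices are congruent modulo an ideal. -/
def MatCong (I : Ideal R) (A B : Matrix ι ι R) : Prop := ∀ i j, A i j - B i j ∈ I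

lemma matCong_iff {I : Ideal R} {A B : Matrix ι ι R} :
    MatCong I A B ↔ A.map (Ideal.Quotient.mkₐ ℝ I) = B.map (Ideal.Quotient.mkₐ ℝ I) := by
  constructor
  · intro h
    ext i j
    exact Ideal.Quotient.eq.2 (h i j)
  · intro h i j
    exact Ideal.Quotient.eq.1 (congrFun (congrFun h i) j)

variable {D : ι → Derivation ℝ R R} {g gi E S : Matrix ι ι R} {Γ Γ' : ι → Matrix ι ι R}
  {g₁ gi₁ U : Matrix ι ι R} {I : Ideal R}

/-- Modulo the ideal `I`, the metric `g₁ = g + g S` is a perturbation of `g` by a null tensor. -/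
structure IsNullPerturb (D : ι → Derivation ℝ R R) (g gi : Matrix ι ι R) (Γ : ι → Matrix ι ι R)
    (E S g₁ gi₁ : Matrix ι ι R) (Γ' : ι → Matrix ι ι R) (I : Ideal R) : Prop where
  walker : IsWalker D g gi Γ E
  stable : ∀ i, ∀ a ∈ I, D i a ∈ I
  eq : g₁ = g + g * S
  symm : (g * S)ᵀ = g * S
  inv_mul : gi₁ * g₁ = 1
  lc : IsLeviCivita D g₁ Γ'
  image : MatCong I (E * S) S

namespace IsNullPerturb

variable (P : IsNullPerturb D g gi Γ E S g₁ gi₁ Γ' I)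
include P

lemma nullEnd_map (hU : MatCong I (E * U) U) (hs : (g * U)ᵀ = g * U) :
    NullEnd (g.map (Ideal.Quotient.mkₐ ℝ I)) (E.map (Ideal.Quotient.mkₐ ℝ I))
      (U.map (Ideal.Quotient.mkₐ ℝ I)) := by
  constructor
  · rw [← Matrix.map_mul, matCong_iff.1 hU]
  · rw [← Matrix.map_mul, ← transpose_map, hs]

lemma walker_map : IsWalker (fun i => quotD I (D i) (P.stable i))
    (g.map (Ideal.Quotient.mkₐ ℝ I)) (gi.map (Ideal.Quotient.mkₐ ℝ I))
    (fun i => (Γ i).map (Ideal.Quotient.mkₐ ℝ I)) (E.map (Ideal.Quotient.mkₐ ℝ I)) :=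
  P.walker.map (fun _ _ => rfl) (Ideal.Quotient.mkₐ_surjective ℝ I)

lemma map_eq : g₁.map (Ideal.Quotient.mkₐ ℝ I) = g.map (Ideal.Quotient.mkₐ ℝ I)
    + g.map (Ideal.Quotient.mkₐ ℝ I) * S.map (Ideal.Quotient.mkₐ ℝ I) := by
  rw [P.eq, matrix_map_add, Matrix.map_mul]

lemma map_conn : (fun i => (Γ' i).map (Ideal.Quotient.mkₐ ℝ I)) = fun i =>
    (Γ i).map (Ideal.Quotient.mkₐ ℝ I) + diffConn (fun i => quotD I (D i) (P.stable i))
      (g.map (Ideal.Quotient.mkₐ ℝ I)) (gi.map (Ideal.Quotient.mkₐ ℝ I))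
      (fun i => (Γ i).map (Ideal.Quotient.mkₐ ℝ I)) (S.map (Ideal.Quotient.mkₐ ℝ I)) i := by
  have h1 := P.lc.map (D' := fun i => quotD I (D i) (P.stable i))
    (φ := Ideal.Quotient.mkₐ ℝ I) (fun _ _ => rfl)
  have hS := P.nullEnd_map P.image P.symm
  refine IsLeviCivita.unique (gi := gi₁.map (Ideal.Quotient.mkₐ ℝ I)) ?_ ?_ h1 ?_
  · rw [← transpose_map, P.eq, transpose_add, P.walker.symm, P.symm]
  · rw [← Matrix.map_mul, P.inv_mul, matrix_map_one]
  · rw [P.map_eq]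
    exact isLeviCivita_add_diffConn P.walker_map hS

lemma map_inv : gi₁.map (Ideal.Quotient.mkₐ ℝ I) = gi.map (Ideal.Quotient.mkₐ ℝ I)
    - S.map (Ideal.Quotient.mkₐ ℝ I) * gi.map (Ideal.Quotient.mkₐ ℝ I) := by
  have h1 : gi₁.map (Ideal.Quotient.mkₐ ℝ I) * g₁.map (Ideal.Quotient.mkₐ ℝ I) = 1 := by
    rw [← Matrix.map_mul, P.inv_mul, matrix_map_one]
  have h2 := (P.nullEnd_map P.image P.symm).perturb_mul_inv P.walker_map
  rw [← P.map_eq] at h2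
  exact left_inv_eq_right_inv h1 h2

/-- Raising an index with `g₁` or with `g` is the same on null tensors. -/
lemma inv_mul_cong (hU : MatCong I (E * U) U) : MatCong I (gi₁ * (g * U)) U := by
  rw [matCong_iff, Matrix.map_mul, P.map_inv, Matrix.map_mul]
  have hS := P.nullEnd_map P.image P.symm
  have hU' : E.map (Ideal.Quotient.mkₐ ℝ I) * U.map (Ideal.Quotient.mkₐ ℝ I)
      = U.map (Ideal.Quotient.mkₐ ℝ I) := by
    rw [← Matrix.map_mul, matCong_iff.1 hU]
  rw [← mul_assoc, sub_mul, mul_assoc (S.map _), P.walker_map.inv_mul, mul_one, sub_mul, one_mul,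
    hS.mul_eq_zero P.walker_map hU', sub_zero]

/-- The divergences for `g₁` and `g` agree on null tensors. -/
lemma divg_cong (hU : MatCong I (E * U) U) (hs : (g * U)ᵀ = g * U) (i : ι) :
    divg D Γ' U i - divg D Γ U i ∈ I := by
  rw [← Ideal.Quotient.eq]
  change Ideal.Quotient.mkₐ ℝ I _ = Ideal.Quotient.mkₐ ℝ I _
  rw [← divg_map (D' := fun i => quotD I (D i) (P.stable i)) (fun _ _ => rfl),
    ← divg_map (D' := fun i => quotD I (D i) (P.stable i)) (fun _ _ => rfl), P.map_conn]
  exact divg_add_diffConn P.walker_map (P.nullEnd_map P.image P.symm) (P.nullEnd_map hU hs) i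

/-- The Ricci tensor of `g₁` is null if `S` is divergence-free. -/
lemma ric_cong (hdiv : ∀ i, divg D Γ S i ∈ I) (hRic : E * (gi * ric D Γ) = gi * ric D Γ) :
    MatCong I (E * (gi * ric D Γ')) (gi * ric D Γ') := by
  have hS := P.nullEnd_map P.image P.symm
  have hφ : ∀ i a, quotD I (D i) (P.stable i) (Ideal.Quotient.mkₐ ℝ I a)
      = Ideal.Quotient.mkₐ ℝ I (D i a) := fun _ _ => rfl
  have := (nullEnd_ric_add_diffConn P.walker_map hS (fun i => ?_) ?_).image
  · rw [← P.map_conn, ric_map hφ, ← Matrix.map_mul, ← Matrix.map_mul, ← matCong_iff] at this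
    exact this
  · rw [divg_map hφ]
    exact Ideal.Quotient.eq_zero_iff_mem.2 (hdiv i)
  · rw [ric_map hφ, ← Matrix.map_mul, ← Matrix.map_mul, hRic]

end IsNullPerturb

end Modulo

/-! ### The Fefferman-Graham expansion of a null Ricci Walker metric -/

section Expansion

variable {ι R : Type*} [Fintype ι] [DecidableEq ι] [CommRing R] [Algebra ℝ R]

/-- All entries of the matrix lie in the ideal. -/
def MatIn (I : Ideal R) (A : Matrix ι ι R) : Prop := ∀ i j, A i j ∈ I

namespace MatIn

variable {I : Ideal R} {A B : Matrix ι ι R}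

lemma mul_left (h : MatIn I A) (B : Matrix ι ι R) : MatIn I (B * A) := fun i j => by
  rw [mul_apply]; exact sum_mem fun k _ => Ideal.mul_mem_left _ _ (h k j)

lemma mul_right (h : MatIn I A) (B : Matrix ι ι R) : MatIn I (A * B) := fun i j => by
  rw [mul_apply]; exact sum_mem fun k _ => Ideal.mul_mem_right _ _ (h i k)

lemma trace (h : MatIn I A) : A.trace ∈ I := sum_mem fun k _ => h k k

end MatIn

lemma matIn_sub_iff {I : Ideal R} {A B : Matrix ι ι R} : MatIn I (A - B) ↔ MatCong I A B := Iff.rfl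

lemma eq_of_matCong_bot {A B : Matrix ι ι R} (h : MatCong ⊥ A B) : A = B := by
  ext i j; exact sub_eq_zero.1 ((Submodule.mem_bot R).1 (h i j))

/-- The family of metrics `g₁`, depending on the coordinate `r`, restricts along the ideal `Z` of
functions vanishing at `r = 0` to the null Ricci Walker metric `g`, and `S` is the endomorphism
associated with the difference of `g₁` and `g`. -/
structure IsFGFamily (D : Unit ⊕ ι ⊕ Unit → Derivation ℝ R R) (t ti r : R) (g gi : Matrix ι ι R)
    (Γ : ι → Matrix ι ι R) (E S g₁ gi₁ : Matrix ι ι R) (Γ' : ι → Matrix ι ι R) (Z : Ideal R) :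
    Prop where
  amb : IsAmbient D t ti r g₁ gi₁ Γ'
  walker : IsWalker (fun i => D (Sum.inr (Sum.inl i))) g gi Γ E
  ric_null : E * (gi * ric (fun i => D (Sum.inr (Sum.inl i))) Γ)
    = gi * ric (fun i => D (Sum.inr (Sum.inl i))) Γ
  D_r_g : dmat (D (Sum.inr (Sum.inr ()))) g = 0
  D_r_E : dmat (D (Sum.inr (Sum.inr ()))) E = 0
  stable : ∀ i, ∀ a ∈ Z, D (Sum.inr (Sum.inl i)) a ∈ Z
  r_mem : r ∈ Z
  eq : g₁ = g + g * S
  initial : MatIn Z S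

/-- The ambient Ricci tensor of the family `g₁`. -/
def ambRic (D : Unit ⊕ ι ⊕ Unit → Derivation ℝ R R) (t ti r : R) (g₁ gi₁ : Matrix ι ι R)
    (Γ' : ι → Matrix ι ι R) : Matrix (Unit ⊕ ι ⊕ Unit) (Unit ⊕ ι ⊕ Unit) R :=
  ric D (ambConn t ti r g₁ (dmat (D (Sum.inr (Sum.inr ()))) g₁)
    (gi₁ * dmat (D (Sum.inr (Sum.inr ()))) g₁) Γ')

/-- The `TM ⊗ TM` block of the ambient Ricci tensor. -/
def ambBlock (D : Unit ⊕ ι ⊕ Unit → Derivation ℝ R R) (t ti r : R) (g₁ gi₁ : Matrix ι ι R)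
    (Γ' : ι → Matrix ι ι R) : Matrix ι ι R :=
  Matrix.of fun i j => ambRic D t ti r g₁ gi₁ Γ' (Sum.inr (Sum.inl i)) (Sum.inr (Sum.inl j))

namespace IsFGFamily

variable {D : Unit ⊕ ι ⊕ Unit → Derivation ℝ R R} {t ti r : R} {g gi : Matrix ι ι R}
  {Γ : ι → Matrix ι ι R} {E S g₁ gi₁ : Matrix ι ι R} {Γ' : ι → Matrix ι ι R} {Z : Ideal R}

local notation "δ" => D (Sum.inr (Sum.inr ()))
local notation "∂" => fun i => D (Sum.inr (Sum.inl i))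
local notation "V" => vanIdeal (D (Sum.inr (Sum.inr ()))) Z

variable (F : IsFGFamily D t ti r g gi Γ E S g₁ gi₁ Γ' Z)
include F

lemma symm : (g * S)ᵀ = g * S := by
  have h := F.amb.symm
  rw [F.eq, transpose_add, F.walker.symm] at h
  exact add_left_cancel h

lemma D_r_gi : dmat δ gi = 0 := by
  rw [dmat_of_inv _ F.walker.inv_mul F.walker.mul_inv, F.D_r_g, mul_zero, zero_mul, neg_zero]

lemma D_r_conn (k : ι) : dmat δ (Γ k) = 0 := by
  have hz : ∀ i j, δ (g i j) = 0 := fun i j => congrFun (congrFun F.D_r_g i) j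
  have h1 : dmat δ (g * Γ k) = 0 := by
    ext i j
    have h2 := congrArg δ (F.walker.lc.koszul F.walker.symm k i j)
    rw [Derivation.leibniz, derivation_two, map_sub, map_add] at h2
    simp only [F.amb.comm (Sum.inr (Sum.inr ())), hz, map_zero] at h2
    refine eq_of_two_mul_eq ?_
    simpa using h2
  rw [dmat_mul, F.D_r_g, zero_mul, zero_add] at h1
  rw [← one_mul (dmat δ (Γ k)), ← F.walker.inv_mul, mul_assoc, h1, mul_zero]

lemma deriv_metric : dmat δ g₁ = g * dmat δ S := by
  rw [F.eq, dmat_add, dmat_mul, F.D_r_g, zero_mul, zero_add, zero_add]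

lemma deriv_symm : (g * dmat δ S)ᵀ = g * dmat δ S := by
  rw [← F.deriv_metric, ← dmat_transpose, F.amb.symm]

lemma deriv_defect : dmat δ (E * S - S) = E * dmat δ S - dmat δ S := by
  rw [dmat_sub, dmat_mul, F.D_r_E, zero_mul, zero_add]

lemma divg_deriv (A : Matrix ι ι R) (i : ι) : divg ∂ Γ (dmat δ A) i = δ (divg ∂ Γ A i) := by
  have h1 : ∀ k, cov ∂ Γ k (dmat δ A) = dmat δ (cov ∂ Γ k A) := by
    intro k
    have hc : dmat (D (Sum.inr (Sum.inl k))) (dmat δ A) = dmat δ (dmat (D (Sum.inr (Sum.inl k))) A)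
        := by ext a b; exact F.amb.comm _ _ _
    rw [cov, cov, dmat_sub, dmat_add, dmat_mul, dmat_mul, F.D_r_conn, hc]
    noncomm_ring
  simp only [divg, h1, map_sum, dmat_apply]

lemma stable_van (k : ℕ) (i : ι) : ∀ a ∈ V k, D (Sum.inr (Sum.inl i)) a ∈ V k := fun _ ha =>
  derivation_mem_vanIdeal (fun _ => F.amb.comm _ _ _) (F.stable i) ha

lemma perturb {k : ℕ} (h : MatCong (V k) (E * S) S) :
    IsNullPerturb ∂ g gi Γ E S g₁ gi₁ Γ' (V k) :=
  ⟨F.walker, F.stable_van k, F.eq, F.symm, F.amb.inv_mul, F.amb.lc, h⟩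

lemma deriv_null {k : ℕ} (h : MatCong (V (k + 1)) (E * S) S) :
    MatCong (V k) (E * dmat δ S) (dmat δ S) := by
  rw [← matIn_sub_iff, ← F.deriv_defect]
  exact fun i j => (mem_vanIdeal_succ.1 (h i j)).2

lemma defect_initial (i j : ι) : (E * S) i j - S i j ∈ Z :=
  sub_mem (F.initial.mul_left E i j) (F.initial i j)

lemma divg_initial (i : ι) : divg ∂ Γ S i ∈ Z :=
  sum_mem fun k _ => sub_mem (add_mem (F.stable k _ (F.initial k i))
    (F.initial.mul_left (Γ k) k i)) (F.initial.mul_right (Γ k) k i)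

/-- Modulo functions vanishing to order `k`, raising an index of the derivative of the metric with
`g₁` gives `δ S`. -/
lemma K_cong {k : ℕ} (h : MatCong (V k) (E * S) S)
    (h' : MatCong (V k) (E * dmat δ S) (dmat δ S)) :
    MatCong (V k) (gi₁ * dmat δ g₁) (dmat δ S) := by
  rw [F.deriv_metric]
  exact (F.perturb h).inv_mul_cong h'

lemma trace_mul_self_mem {k : ℕ} (h : MatCong (V (k + 1)) (E * S) S) :
    (gi₁ * dmat δ g₁ * (gi₁ * dmat δ g₁)).trace ∈ V k := by
  have h0 : MatCong (V k) (E * S) S := fun i j => vanIdeal_succ_le k (h i j)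
  have h1 := F.deriv_null h
  have h2 := matCong_iff.1 (F.K_cong h0 h1)
  have P := F.perturb h0
  have h3 := P.nullEnd_map h1 F.deriv_symm
  refine MatIn.trace (fun i j => ?_)
  have h4 : MatCong (V k) (gi₁ * dmat δ g₁ * (gi₁ * dmat δ g₁)) 0 := by
    rw [matCong_iff, Matrix.map_mul, h2, h3.mul_eq_zero P.walker_map h3.image, matrix_map_zero]
  simpa using h4 i j

/-- The part of the derivative of the metric transverse to the distribution. -/
lemma transverse_eq : (1 - E) * gi * dmat δ g₁ = dmat δ (S - E * S) := by
  have : dmat δ (S - E * S) = dmat δ S - E * dmat δ S := by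
    rw [← neg_sub (E * dmat δ S), ← F.deriv_defect, ← neg_sub (E * S)]
    ext i j; simp
  rw [F.deriv_metric, mul_assoc, ← mul_assoc gi, F.walker.inv_mul, this]
  noncomm_ring

lemma card_smul (x : R) :
    (half R * (Fintype.card ι : R) - 1) * x = ((Fintype.card ι : ℝ) / 2 - 1) • x := by
  rw [Algebra.smul_def, map_sub, map_one, div_eq_mul_inv, map_mul, map_natCast, half, one_div,
    mul_comm (algebraMap ℝ R 2⁻¹)]

lemma ambBlock_eq : ambBlock D t ti r g₁ gi₁ Γ' = r • dmat δ (dmat δ g₁)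
    - r • (dmat δ g₁ * (gi₁ * dmat δ g₁))
    + (half R * r * (gi₁ * dmat δ g₁).trace) • dmat δ g₁
    - ((Fintype.card ι : ℝ) / 2 - 1) • dmat δ g₁
    - (half R * (gi₁ * dmat δ g₁).trace) • g₁ + ric ∂ Γ' := by
  ext i j
  simp only [Matrix.add_apply, Matrix.sub_apply, Matrix.smul_apply, smul_eq_mul,
    ← F.card_smul (_ : R)]
  exact F.amb.ric_ij i j rfl rfl

/-- The transverse part of the Fefferman-Graham equation is an indicial equation for the
transverse part of the derivative of the metric. -/
lemma ambBlock_cong {k : ℕ} (h : MatCong (V (k + 1)) (E * S) S)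
    (hdiv : ∀ i, divg ∂ Γ S i ∈ V (k + 1)) (htr : (gi₁ * dmat δ g₁).trace ∈ V (k + 1)) (i j : ι) :
    ((1 - E) * gi * ambBlock D t ti r g₁ gi₁ Γ') i j
      - (r * δ (dmat δ (S - E * S) i j)
        - ((Fintype.card ι : ℝ) / 2 - 1) • dmat δ (S - E * S) i j) ∈ V (k + 1) := by
  set K := gi₁ * dmat δ g₁ with hK
  set X := dmat δ (S - E * S) with hX
  have hXm : MatIn (V k) X := by
    intro i j
    have := (mem_vanIdeal_succ.1 (h i j)).2
    rw [hX, dmat_apply, Matrix.sub_apply, ← neg_sub, map_neg]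
    exact neg_mem this
  have hq : dmat δ ((1 - E) * gi) = 0 := by
    rw [dmat_mul, F.D_r_gi, dmat_sub, F.D_r_E, dmat_one]; simp
  have hX' : (1 - E) * gi * dmat δ (dmat δ g₁) = dmat δ X := by
    rw [hX, ← F.transverse_eq, dmat_mul _ ((1 - E) * gi), hq, zero_mul, zero_add]
  have key : (1 - E) * gi * ambBlock D t ti r g₁ gi₁ Γ'
      = (r • dmat δ X - ((Fintype.card ι : ℝ) / 2 - 1) • X) - r • (X * K)
        + (half R * r * K.trace) • X - (half R * K.trace) • ((1 - E) * gi * g₁)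
        + (gi * ric ∂ Γ' - E * (gi * ric ∂ Γ')) := by
    rw [F.ambBlock_eq, mul_add, mul_sub, mul_sub, mul_add, mul_sub]
    simp only [Matrix.mul_smul]
    rw [hX', ← mul_assoc _ (dmat δ g₁), F.transverse_eq, ← hX]
    have : (1 - E) * gi * ric ∂ Γ' = gi * ric ∂ Γ' - E * (gi * ric ∂ Γ') := by noncomm_ring
    rw [this]
    abel
  have e : ((1 - E) * gi * ambBlock D t ti r g₁ gi₁ Γ') i j
      - (r * δ (X i j) - ((Fintype.card ι : ℝ) / 2 - 1) • X i j)
      = -(r * (X * K) i j) + half R * r * K.trace * X i j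
        - half R * K.trace * ((1 - E) * gi * g₁) i j
        + -((E * (gi * ric ∂ Γ')) i j - (gi * ric ∂ Γ') i j) := by
    rw [key]
    simp only [Matrix.add_apply, Matrix.sub_apply, Matrix.smul_apply, smul_eq_mul, dmat_apply]
    ring
  rw [e]
  refine add_mem (sub_mem (add_mem (neg_mem ?_) ?_) ?_) (neg_mem ?_)
  · exact mul_mem_vanIdeal_succ F.r_mem F.amb.D_r_r (hXm.mul_right K i j)
  · exact Ideal.mul_mem_right _ _ (Ideal.mul_mem_left _ _ htr)
  · exact Ideal.mul_mem_right _ _ (Ideal.mul_mem_left _ _ htr)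
  · exact (F.perturb h).ric_cong hdiv F.ric_null i j

/-- Along `r = 0` the derivative of the metric is trace-free: the trace of the `TM ⊗ TM` equation
is `(n - 1) tr (g⁻¹ g') = 0`, as `g` has vanishing scalar curvature. -/
lemma trace_initial (hn : 2 ≤ Fintype.card ι) (hB : MatIn Z (ambBlock D t ti r g₁ gi₁ Γ')) :
    (gi₁ * dmat δ g₁).trace ∈ Z := by
  have hP : MatCong (V 1) (E * S) S := fun i j => by
    rw [vanIdeal_one]; exact F.defect_initial i j
  have P := F.perturb hP
  set q := Ideal.Quotient.mkₐ ℝ (V 1) with hq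
  set K := gi₁ * dmat δ g₁ with hK
  have hS0 : S.map q = 0 := by
    ext i j
    have : S i j ∈ V 1 := by rw [vanIdeal_one]; exact F.initial i j
    exact Ideal.Quotient.eq_zero_iff_mem.2 this
  have hr0 : q r = 0 := by
    have : r ∈ V 1 := by rw [vanIdeal_one]; exact F.r_mem
    exact Ideal.Quotient.eq_zero_iff_mem.2 this
  have hB0 : (ambBlock D t ti r g₁ gi₁ Γ').map q = 0 := by
    ext i j
    have : ambBlock D t ti r g₁ gi₁ Γ' i j ∈ V 1 := by rw [vanIdeal_one]; exact hB i j
    exact Ideal.Quotient.eq_zero_iff_mem.2 this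
  have hgi : gi₁.map q = gi.map q := by rw [P.map_inv, hS0, zero_mul, sub_zero]
  have hg : g₁.map q = g.map q := by rw [P.map_eq, hS0, mul_zero, add_zero]
  have hlc := P.lc.map (D' := fun i => quotD (V 1) (D (Sum.inr (Sum.inl i))) (P.stable i))
    (φ := q) (fun _ _ => rfl)
  rw [hg] at hlc
  have hconn := hlc.unique (P.walker_map.symm) P.walker_map.inv_mul P.walker_map.lc
  have hric : (ric ∂ Γ').map q = (ric ∂ Γ).map q := by
    rw [← ric_map (D' := fun i => quotD (V 1) (D (Sum.inr (Sum.inl i))) (P.stable i))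
      (fun _ _ => rfl), ← ric_map (D' := fun i => quotD (V 1) (D (Sum.inr (Sum.inl i)))
      (P.stable i)) (fun _ _ => rfl), hconn]
  have hRn : NullEnd g E (gi * ric ∂ Γ) := ⟨F.ric_null, by
    rw [← mul_assoc, F.walker.mul_inv, one_mul, ric_symm F.walker.symm F.walker.inv_mul
      F.walker.mul_inv F.walker.comm F.walker.lc]⟩
  have htr := hRn.trace_eq_zero F.walker
  have hblock : ∀ i j, q (half R * K.trace) * q (g i j)
      = q (ric ∂ Γ i j) - ((Fintype.card ι : ℝ) / 2 - 1) • q (dmat δ g₁ i j) := by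
    intro i j
    have h1 := congrFun (congrFun hB0 i) j
    rw [F.ambBlock_eq] at h1
    simp only [Matrix.map_apply, Matrix.add_apply, Matrix.sub_apply, Matrix.smul_apply,
      smul_eq_mul, map_add, map_sub, map_mul, hr0, map_smul, Matrix.zero_apply] at h1
    have h2 := congrFun (congrFun hric i) j
    have h3 := congrFun (congrFun hg i) j
    simp only [Matrix.map_apply] at h2 h3
    rw [h2, h3] at h1
    rw [map_mul]
    linear_combination -h1
  -- trace with the inverse metric
  have htrace : q (half R * K.trace) * (Fintype.card ι : _)
      = - (((Fintype.card ι : ℝ) / 2 - 1) • q K.trace) := by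
    have h1 : ((gi * g).map q).trace = (Fintype.card ι : _) := by
      rw [F.walker.inv_mul, matrix_map_one, trace_one]
    have h2 : ((gi * ric ∂ Γ).map q).trace = 0 := by
      have := congrArg q htr
      rw [map_zero] at this
      rw [← this, trace, trace, map_sum]
      rfl
    have h3 : ((gi * dmat δ g₁).map q).trace = q K.trace := by
      have h4 : (gi * dmat δ g₁).map q = K.map q := by
        rw [hK, Matrix.map_mul, Matrix.map_mul, hgi]
      rw [h4, trace, trace, map_sum]
      rfl
    have hb' : q (half R * K.trace) • g.map q = (ric ∂ Γ).map q
        - ((Fintype.card ι : ℝ) / 2 - 1) • (dmat δ g₁).map q := by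
      ext i j
      exact hblock i j
    have h5 := congrArg (fun M => (gi.map q * M).trace) hb'
    simp only [Matrix.mul_smul, mul_sub, ← Matrix.map_mul, trace_smul, trace_sub, h1, h2, h3,
      smul_eq_mul] at h5
    rw [h5, zero_sub]
  have hcomb : ((Fintype.card ι : ℝ) - 1) • q K.trace = 0 := by
    have h6 : q (half R * K.trace) * (Fintype.card ι : _)
        = ((Fintype.card ι : ℝ) / 2) • q K.trace := by
      have e : q (half R * K.trace) = (1 / 2 : ℝ) • q K.trace := by
        rw [half, ← Algebra.smul_def, map_smul]
      rw [e, smul_mul_assoc, mul_comm, ← nsmul_eq_mul, ← Nat.cast_smul_eq_nsmul ℝ, smul_smul]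
      congr 1
      ring
    rw [h6] at htrace
    rw [← sub_eq_zero, sub_neg_eq_add, ← add_smul] at htrace
    rw [← htrace]
    congr 1
    ring
  rw [← map_smul] at hcomb
  have hmem : ((Fintype.card ι : ℝ) - 1) • K.trace ∈ V 1 := Ideal.Quotient.eq_zero_iff_mem.1 hcomb
  rw [vanIdeal_one, smul_mem_ideal_iff] at hmem
  · exact hmem
  · have : (2 : ℝ) ≤ Fintype.card ι := by exact_mod_cast hn
    linarith

/-- The `δδ` component `δ tr K + ½ tr K² = 0` of the Fefferman-Graham equations, where
`K = gi₁ * dmat δ g₁`, controls the trace of the derivative of the metric. -/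
lemma trace_mem (hn : 2 ≤ Fintype.card ι) {k : ℕ} (h : MatCong (V (k + 1)) (E * S) S)
    (hB : MatIn Z (ambBlock D t ti r g₁ gi₁ Γ'))
    (hr : ambRic D t ti r g₁ gi₁ Γ' (Sum.inr (Sum.inr ())) (Sum.inr (Sum.inr ())) ∈ V k) :
    (gi₁ * dmat δ g₁).trace ∈ V (k + 1) := by
  rw [mem_vanIdeal_succ]
  refine ⟨F.trace_initial hn hB, ?_⟩
  rw [ambRic, F.amb.ric_rr] at hr
  have h1 := F.trace_mul_self_mem h
  have h2 : δ (gi₁ * dmat δ g₁).trace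
      = -2 * (- half R * δ (gi₁ * dmat δ g₁).trace
          - half R ^ 2 * (gi₁ * dmat δ g₁ * (gi₁ * dmat δ g₁)).trace)
        - half R * (gi₁ * dmat δ g₁ * (gi₁ * dmat δ g₁)).trace := by
    linear_combination (-δ (gi₁ * dmat δ g₁).trace
      - half R * (gi₁ * dmat δ g₁ * (gi₁ * dmat δ g₁)).trace) * two_mul_half (R := R)
  rw [h2]
  exact sub_mem (Ideal.mul_mem_left _ _ hr) (Ideal.mul_mem_left _ _ h1)

/-- One step of the induction over the order of vanishing. The transverse part of the derivative of
`S` is determined by the indicial equation, and its divergence by the mixed equation. -/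
lemma step (hn : 2 ≤ Fintype.card ι) {k : ℕ}
    (hc : ∀ j < k + 1, (Fintype.card ι : ℝ) / 2 - 1 ≠ (j : ℕ))
    (h : MatCong (V (k + 1)) (E * S) S) (hdiv : ∀ i, divg ∂ Γ S i ∈ V (k + 1))
    (hRic : ∀ a b, ambRic D t ti r g₁ gi₁ Γ' a b ∈ V (k + 1)) :
    MatCong (V (k + 2)) (E * S) S ∧ ∀ i, divg ∂ Γ S i ∈ V (k + 2) := by
  have hB : MatIn (V (k + 1)) (ambBlock D t ti r g₁ gi₁ Γ') := fun i j => hRic _ _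
  have htr := F.trace_mem hn h (fun i j => (mem_vanIdeal_succ.1 (hB i j)).1)
    (vanIdeal_succ_le k (hRic _ _))
  have hX : ∀ i j, dmat δ (S - E * S) i j ∈ V (k + 1) := by
    intro i j
    refine mem_vanIdeal_of_indicial F.r_mem F.amb.D_r_r hc ?_
    have h1 := F.ambBlock_cong h hdiv htr i j
    have h2 := sub_mem (hB.mul_left ((1 - E) * gi) i j) h1
    rwa [sub_sub_cancel] at h2
  have hnull : MatCong (V (k + 2)) (E * S) S := by
    intro i j
    rw [mem_vanIdeal_succ]
    refine ⟨F.defect_initial i j, ?_⟩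
    have := hX i j
    rw [dmat_apply, Matrix.sub_apply] at this
    rw [← neg_sub, map_neg]
    exact neg_mem this
  refine ⟨hnull, fun i => ?_⟩
  rw [mem_vanIdeal_succ]
  refine ⟨F.divg_initial i, ?_⟩
  rw [← F.divg_deriv]
  have h1 := hRic (Sum.inr (Sum.inl i)) (Sum.inr (Sum.inr ()))
  rw [ambRic, F.amb.ric_ir i rfl rfl] at h1
  have h2 : divg ∂ Γ' (gi₁ * dmat δ g₁) i ∈ V (k + 1) := by
    have h3 := add_mem (Ideal.mul_mem_left _ 2 h1) (F.stable_van (k + 1) i _ htr)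
    have e : divg ∂ Γ' (gi₁ * dmat δ g₁) i = 2 * (half R * (divg ∂ Γ' (gi₁ * dmat δ g₁) i
        - D (Sum.inr (Sum.inl i)) (gi₁ * dmat δ g₁).trace))
        + D (Sum.inr (Sum.inl i)) (gi₁ * dmat δ g₁).trace := by
      linear_combination (-(divg ∂ Γ' (gi₁ * dmat δ g₁) i
        - D (Sum.inr (Sum.inl i)) (gi₁ * dmat δ g₁).trace)) * two_mul_half (R := R)
    rw [e]
    exact h3
  have hd := F.deriv_null hnull
  have P := F.perturb h
  have h4 : divg ∂ Γ' (gi₁ * dmat δ g₁) i - divg ∂ Γ' (dmat δ S) i ∈ V (k + 1) := by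
    have hφ : ∀ i a, quotD (V (k + 1)) (D (Sum.inr (Sum.inl i))) (P.stable i)
      (Ideal.Quotient.mkₐ ℝ (V (k + 1)) a)
      = Ideal.Quotient.mkₐ ℝ (V (k + 1)) (D (Sum.inr (Sum.inl i)) a) := fun _ _ => rfl
    rw [← Ideal.Quotient.eq]
    change Ideal.Quotient.mkₐ ℝ _ _ = Ideal.Quotient.mkₐ ℝ _ _
    rw [← divg_map hφ, ← divg_map hφ, matCong_iff.1 (F.K_cong h hd)]
  have h5 := P.divg_cong hd F.deriv_symm i
  have h6 := sub_mem h2 (add_mem h4 h5)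
  convert h6 using 1
  ring

/-- If the Fefferman-Graham equations hold to order `m`, below the critical order, then the
Taylor coefficients of the metric up to order `m` are null and divergence-free. -/
theorem null_of_ric (hn : 2 ≤ Fintype.card ι) {m : ℕ}
    (hc : ∀ j < m, (Fintype.card ι : ℝ) / 2 - 1 ≠ (j : ℕ))
    (hRic : ∀ a b, ambRic D t ti r g₁ gi₁ Γ' a b ∈ V m) :
    MatCong (V (m + 1)) (E * S) S ∧ ∀ i, divg ∂ Γ S i ∈ V (m + 1) := by
  induction m with
  | zero =>
    rw [zero_add, vanIdeal_one]
    exact ⟨F.defect_initial, F.divg_initial⟩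
  | succ m ih =>
    obtain ⟨h1, h2⟩ := ih (fun j hj => hc j (by omega)) fun a b => vanIdeal_succ_le m (hRic a b)
    exact F.step hn hc h1 h2 hRic

/-- At the critical order the transverse part of the obstruction vanishes. -/
theorem obstruction_mem {m : ℕ} (hn : 2 ≤ Fintype.card ι) (hm : Fintype.card ι = 2 * (m + 2))
    (hRic : ∀ a b, ambRic D t ti r g₁ gi₁ Γ' a b ∈ V (m + 1)) :
    MatIn (V (m + 2)) ((1 - E) * gi * ambBlock D t ti r g₁ gi₁ Γ') := by
  have hc : (Fintype.card ι : ℝ) / 2 - 1 = ((m + 1 : ℕ) : ℝ) := by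
    rw [hm]; push_cast; ring
  obtain ⟨h1, h2⟩ := F.null_of_ric hn (m := m + 1) (fun j hj => by
    rw [hc]; exact_mod_cast hj.ne') hRic
  have htr := F.trace_mem hn h1
    (fun i j => (mem_vanIdeal_succ.1 (hRic (Sum.inr (Sum.inl i)) (Sum.inr (Sum.inl j)))).1)
    (hRic _ _)
  intro i j
  have h3 := F.ambBlock_cong h1 h2 htr i j
  have hX : dmat δ (S - E * S) i j ∈ V (m + 1) := by
    have := (mem_vanIdeal_succ.1 (h1 i j)).2
    rw [dmat_apply, Matrix.sub_apply, ← neg_sub, map_neg]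
    exact neg_mem this
  have h4 := indicial_mem_vanIdeal F.r_mem F.amb.D_r_r hX
  rw [← hc] at h4
  have := add_mem h3 h4
  rwa [sub_add_cancel] at this

lemma ambRic_symm : (ambRic D t ti r g₁ gi₁ Γ')ᵀ = ambRic D t ti r g₁ gi₁ Γ' :=
  ric_symm (ambMat_transpose F.amb.symm) (ambInv_mul_ambMat F.amb.t_mul F.amb.inv_mul)
    (ambMat_mul_ambInv F.amb.t_mul F.amb.mul_inv) F.amb.comm F.amb.isLeviCivita_ambConn

section Exact

lemma perturb_bot (hS : E * S = S) : IsNullPerturb ∂ g gi Γ E S g₁ gi₁ Γ' ⊥ :=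
  ⟨F.walker, fun i a ha => by rw [(Submodule.mem_bot R).1 ha, map_zero]; exact zero_mem _, F.eq,
    F.symm, F.amb.inv_mul, F.amb.lc, fun i j => by rw [hS, sub_self]; exact zero_mem _⟩

lemma nullEnd_deriv (hS : E * S = S) : NullEnd g E (dmat δ S) :=
  ⟨by
    have := F.deriv_defect
    rw [hS, sub_self] at this
    rw [← sub_eq_zero, ← this]
    ext i j; simp, F.deriv_symm⟩

lemma K_eq (hS : E * S = S) : gi₁ * dmat δ g₁ = dmat δ S := by
  rw [F.deriv_metric]
  refine eq_of_matCong_bot ((F.perturb_bot hS).inv_mul_cong ?_)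
  intro i j
  rw [(F.nullEnd_deriv hS).image, sub_self]
  exact zero_mem _

lemma K_trace (hS : E * S = S) : (gi₁ * dmat δ g₁).trace = 0 := by
  rw [F.K_eq hS, (F.nullEnd_deriv hS).trace_eq_zero F.walker]

/-- For an exactly null perturbation the `TM ⊗ TM` equation loses all its nonlinear terms except
the Ricci tensor. -/
lemma ambBlock_eq_of_null (hS : E * S = S) :
    ambBlock D t ti r g₁ gi₁ Γ' = r • dmat δ (dmat δ g₁)
    - ((Fintype.card ι : ℝ) / 2 - 1) • dmat δ g₁ + ric ∂ Γ' := by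
  have h1 : dmat δ g₁ * (gi₁ * dmat δ g₁) = 0 := by
    rw [F.K_eq hS, F.deriv_metric, mul_assoc,
      (F.nullEnd_deriv hS).mul_eq_zero F.walker (F.nullEnd_deriv hS).image, mul_zero]
  rw [F.ambBlock_eq, h1, F.K_trace hS]
  simp

lemma ric_nullEnd (hS : E * S = S) (hdiv : ∀ i, divg ∂ Γ S i = 0) :
    NullEnd g E (gi * ric ∂ Γ') := by
  refine ⟨eq_of_matCong_bot ((F.perturb_bot hS).ric_cong (fun i => ?_) F.ric_null), ?_⟩
  · rw [hdiv]; exact zero_mem _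
  · rw [← mul_assoc, F.walker.mul_inv, one_mul, ric_symm F.amb.symm F.amb.inv_mul F.amb.mul_inv
      F.walker.comm F.amb.lc]

/-- The Ricci tensor of the perturbed metric is divergence-free, by the contracted Bianchi
identity. -/
lemma divg_ric (hS : E * S = S) (hdiv : ∀ i, divg ∂ Γ S i = 0) (i : ι) :
    divg ∂ Γ (gi * ric ∂ Γ') i = 0 := by
  have hn := F.ric_nullEnd hS hdiv
  have P := F.perturb_bot hS
  have hn' : MatCong ⊥ (E * (gi * ric ∂ Γ')) (gi * ric ∂ Γ') := by
    intro a b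
    rw [hn.image, sub_self]
    exact zero_mem _
  have h1 : gi₁ * ric ∂ Γ' = gi * ric ∂ Γ' := by
    rw [← eq_of_matCong_bot (P.inv_mul_cong hn'), ← mul_assoc g, F.walker.mul_inv, one_mul]
  have h2 := two_mul_divg_ric F.amb.symm F.amb.inv_mul F.amb.mul_inv F.walker.comm F.amb.lc i
  rw [h1, hn.trace_eq_zero F.walker, map_zero] at h2
  have h3 := P.divg_cong hn' hn.symm i
  rw [Submodule.mem_bot, sub_eq_zero] at h3
  -- the scalar curvature being zero, the divergence vanishes
  rw [← h3]
  apply eq_of_two_mul_eq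
  rw [h2, mul_zero]

lemma ambBlock_nullEnd (hS : E * S = S) (hdiv : ∀ i, divg ∂ Γ S i = 0) :
    NullEnd g E (gi * ambBlock D t ti r g₁ gi₁ Γ') := by
  have hc : gi * dmat δ g₁ = dmat δ S := by
    rw [F.deriv_metric, ← mul_assoc, F.walker.inv_mul, one_mul]
  have hd := F.nullEnd_deriv hS
  have hdd : NullEnd g E (dmat δ (dmat δ S)) := by
    constructor
    · conv_rhs => rw [← hd.image]
      rw [dmat_mul, F.D_r_E, zero_mul, zero_add]
    · have : g * dmat δ (dmat δ S) = dmat δ (g * dmat δ S) := by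
        rw [dmat_mul, F.D_r_g, zero_mul, zero_add]
      rw [this, ← dmat_transpose, hd.symm]
  have key : gi * ambBlock D t ti r g₁ gi₁ Γ' = r • dmat δ (dmat δ S)
      - (algebraMap ℝ R ((Fintype.card ι : ℝ) / 2 - 1)) • dmat δ S + gi * ric ∂ Γ' := by
    have hcc : gi * dmat δ (dmat δ g₁) = dmat δ (dmat δ S) := by
      rw [← hc, dmat_mul, F.D_r_gi, zero_mul, zero_add]
    rw [F.ambBlock_eq_of_null hS, mul_add, mul_sub, Matrix.mul_smul, Matrix.mul_smul, hc, hcc,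
      algebraMap_smul]
  rw [key]
  exact ((hdd.smul r).sub (hd.smul _)).add (F.ric_nullEnd hS hdiv)

/-- All components of the ambient Ricci tensor other than those in `TM ⊗ TM` vanish. -/
lemma ambRic_eq_zero (hS : E * S = S) (hdiv : ∀ i, divg ∂ Γ S i = 0)
    (a b : Unit ⊕ ι ⊕ Unit)
    (h : ∀ i j, ¬ (a = Sum.inr (Sum.inl i) ∧ b = Sum.inr (Sum.inl j))) :
    ambRic D t ti r g₁ gi₁ Γ' a b = 0 := by
  have hsym : ∀ a b, ambRic D t ti r g₁ gi₁ Γ' a b = ambRic D t ti r g₁ gi₁ Γ' b a := by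
    intro a b
    conv_lhs => rw [← F.ambRic_symm, transpose_apply]
  have ht : ∀ b, ambRic D t ti r g₁ gi₁ Γ' (Sum.inl ()) b = 0 := fun b => F.amb.ric_t b
  have hir : ∀ i, ambRic D t ti r g₁ gi₁ Γ' (Sum.inr (Sum.inl i)) (Sum.inr (Sum.inr ())) = 0 := by
    intro i
    have h3 := (F.perturb_bot hS).divg_cong (U := dmat δ S)
      (fun a b => by rw [(F.nullEnd_deriv hS).image, sub_self]; exact zero_mem _) F.deriv_symm i
    rw [Submodule.mem_bot, sub_eq_zero, F.divg_deriv, hdiv, map_zero] at h3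
    rw [ambRic, F.amb.ric_ir i rfl rfl, F.K_trace hS, F.K_eq hS, h3]
    simp
  have hrr : ambRic D t ti r g₁ gi₁ Γ' (Sum.inr (Sum.inr ())) (Sum.inr (Sum.inr ())) = 0 := by
    rw [ambRic, F.amb.ric_rr, F.K_trace hS, F.K_eq hS,
      (F.nullEnd_deriv hS).mul_eq_zero F.walker (F.nullEnd_deriv hS).image]
    simp
  rcases a with _ | a | _
  · exact ht b
  · rcases b with _ | b | _
    · rw [hsym]; exact ht _
    · exact absurd ⟨rfl, rfl⟩ (h a b)
    · exact hir a
  · rcases b with _ | b | _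
    · rw [hsym]; exact ht _
    · rw [hsym]; exact hir b
    · exact hrr

end Exact

end IsFGFamily

end Expansion

/-! ### The coordinates `(t, x, ρ)` -/

section AmbientDomain

open TopologicalSpace

section

variable {ι κ : Type*} [Fintype ι] [DecidableEq ι] [Fintype κ] [DecidableEq κ]

lemma isSlice_of_eq {s : (ι → ℝ) → (κ → ℝ)} {σ : ι → κ} (z₀ : κ → ℝ)
    (h : ∀ y, s y = (∑ i, y i • Pi.single (σ i) (1 : ℝ)) + z₀) : IsSlice s σ := by
  intro y
  set L := LinearMap.toContinuousLinearMap
    (Fintype.linearCombination ℝ (fun i => (Pi.single (σ i) (1 : ℝ) : κ → ℝ))) with hL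
  refine ⟨L, ?_, fun k => ?_⟩
  · have h2 : s = fun y => L y + z₀ := by
      funext y
      rw [h y]
      rfl
    rw [h2]
    exact L.hasFDerivAt.add_const z₀
  · change Fintype.linearCombination ℝ _ (Pi.single k 1) = _
    rw [Fintype.linearCombination_apply_single, one_smul]

lemma IsSlice.contDiff {s : (ι → ℝ) → (κ → ℝ)} {σ : ι → κ} (z₀ : κ → ℝ)
    (h : ∀ y, s y = (∑ i, y i • Pi.single (σ i) (1 : ℝ)) + z₀) : ContDiff ℝ ∞ s := by
  have h2 : s = fun y => (∑ i, y i • Pi.single (σ i) (1 : ℝ)) + z₀ := funext h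
  rw [h2]
  fun_prop

lemma isSlice_id : IsSlice (id : (ι → ℝ) → (ι → ℝ)) id := fun y =>
  ⟨ContinuousLinearMap.id ℝ _, hasFDerivAt_id y, fun _ => rfl⟩

end

variable {n : ℕ}

lemma ambientPoint_eq (t : ℝ) (y : Fin n → ℝ) (ρ : ℝ) : ambientPoint t y ρ
    = (∑ i, y i • Pi.single (Sum.inr (Sum.inl i)) (1 : ℝ)) + ambientPoint t 0 ρ := by
  funext c
  rw [Pi.add_apply, Finset.sum_apply]
  rcases c with _ | i | _
  · simp [ambientPoint]
  · simp [ambientPoint, Pi.single_apply]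
  · simp [ambientPoint]

lemma isSlice_ambientPoint (t ρ : ℝ) : IsSlice (fun y : Fin n → ℝ => ambientPoint t y ρ)
    (fun i => Sum.inr (Sum.inl i)) :=
  isSlice_of_eq _ fun y => ambientPoint_eq t y ρ

lemma contDiff_ambientPoint (t ρ : ℝ) : ContDiff ℝ ∞ (fun y : Fin n → ℝ => ambientPoint t y ρ) :=
  IsSlice.contDiff _ fun y => ambientPoint_eq t y ρ

lemma hasDerivAt_ambientPoint (t : ℝ) (y : Fin n → ℝ) (ρ : ℝ) :
    HasDerivAt (fun ρ => ambientPoint t y ρ) (Pi.single (Sum.inr (Sum.inr ())) 1) ρ := by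
  rw [hasDerivAt_pi]
  rintro (_ | i | _)
  · simpa [ambientPoint] using hasDerivAt_const ρ t
  · simpa [ambientPoint] using hasDerivAt_const ρ (y i)
  · simpa [ambientPoint] using hasDerivAt_id' ρ

/-- The space `(0, ∞) × W × (-ε, ε)`. -/
def ambientDomain (W : Opens (Fin n → ℝ)) (ε : ℝ) : Opens (Unit ⊕ Fin n ⊕ Unit → ℝ) where
  carrier := {z | 0 < z (Sum.inl ()) ∧ (fun i => z (Sum.inr (Sum.inl i))) ∈ W ∧
    z (Sum.inr (Sum.inr ())) ∈ Set.Ioo (-ε) ε}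
  is_open' := by
    refine (isOpen_lt continuous_const (continuous_apply _)).inter (IsOpen.inter ?_ ?_)
    · exact W.2.preimage (continuous_pi fun i => continuous_apply _)
    · exact isOpen_Ioo.preimage (continuous_apply _)

variable {W : Opens (Fin n → ℝ)} {ε : ℝ}

lemma ambientPoint_mem {t : ℝ} {y : Fin n → ℝ} {ρ : ℝ} :
    ambientPoint t y ρ ∈ ambientDomain W ε ↔ 0 < t ∧ y ∈ W ∧ ρ ∈ Set.Ioo (-ε) ε := Iff.rfl

lemma eq_ambientPoint (z : Unit ⊕ Fin n ⊕ Unit → ℝ) : z = ambientPoint (z (Sum.inl ()))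
    (fun i => z (Sum.inr (Sum.inl i))) (z (Sum.inr (Sum.inr ()))) := by
  funext c
  rcases c with _ | i | _ <;> rfl

lemma ambientDomain_ext {f f' : SmoothFn (ambientDomain W ε)}
    (h : ∀ t y ρ (hz : ambientPoint t y ρ ∈ ambientDomain W ε),
      ev ⟨_, hz⟩ f = ev ⟨_, hz⟩ f') : f = f' := by
  refine SmoothFn.ext_ev fun z => ?_
  obtain ⟨z, hz⟩ := z
  have hz' : ambientPoint _ _ _ ∈ ambientDomain W ε := (eq_ambientPoint z) ▸ hz
  have h1 := h _ _ _ hz'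
  have h2 : (⟨z, hz⟩ : ambientDomain W ε) = ⟨_, hz'⟩ := Subtype.ext (eq_ambientPoint z)
  rw [h2]
  exact h1

/-- The ideal of functions vanishing at `ρ = 0`. -/
def zeroIdeal (W : Opens (Fin n → ℝ)) (ε : ℝ) : Ideal (SmoothFn (ambientDomain W ε)) where
  carrier := {f | ∀ t y (hz : ambientPoint t y 0 ∈ ambientDomain W ε), ev ⟨_, hz⟩ f = 0}
  zero_mem' := fun _ _ _ => map_zero _
  add_mem' := fun ha hb t y hz => by rw [map_add, ha t y hz, hb t y hz, add_zero]
  smul_mem' := fun c f hf t y hz => by rw [smul_eq_mul, map_mul, hf t y hz, mul_zero]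

lemma mem_zeroIdeal {f : SmoothFn (ambientDomain W ε)} : f ∈ zeroIdeal W ε ↔
    ∀ t y (hz : ambientPoint t y 0 ∈ ambientDomain W ε), ev ⟨_, hz⟩ f = 0 := Iff.rfl

lemma pderiv_const {κ : Type*} [Fintype κ] [DecidableEq κ] (k : κ) (c : ℝ) (y : κ → ℝ) :
    pderiv k (fun _ => c) y = 0 := by
  simp [pderiv]

lemma partialD_mem_zeroIdeal (i : Fin n) {f : SmoothFn (ambientDomain W ε)}
    (hf : f ∈ zeroIdeal W ε) : partialD (Sum.inr (Sum.inl i)) f ∈ zeroIdeal W ε := by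
  intro t y hz
  rw [← (isSlice_ambientPoint t 0).pderiv_eq (F := fun _ => 0) (f := f)
    (fun w hw => (hf t w hw).symm) hz i, pderiv_const]

/-- The derivation `∂_ρ` computes derivatives along the `ρ`-lines. -/
lemma deriv_eq_ev {F : ℝ → ℝ} {f : SmoothFn (ambientDomain W ε)} {t : ℝ} {y : Fin n → ℝ}
    (h : ∀ ρ (hz : ambientPoint t y ρ ∈ ambientDomain W ε), F ρ = ev ⟨_, hz⟩ f) {ρ : ℝ}
    (hz : ambientPoint t y ρ ∈ ambientDomain W ε) :
    deriv F ρ = ev ⟨_, hz⟩ (partialD (Sum.inr (Sum.inr ())) f) := by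
  have h1 : F =ᶠ[nhds ρ] extendZero f ∘ fun ρ => ambientPoint t y ρ := by
    filter_upwards [isOpen_Ioo.mem_nhds (ambientPoint_mem.1 hz).2.2] with σ hσ
    have hz' : ambientPoint t y σ ∈ ambientDomain W ε :=
      ⟨(ambientPoint_mem.1 hz).1, (ambientPoint_mem.1 hz).2.1, hσ⟩
    rw [h σ hz', Function.comp, extendZero_apply f hz', ev_apply]
  rw [h1.deriv_eq, ((differentiableAt_extendZero f hz).hasFDerivAt.comp_hasDerivAt ρ
    (hasDerivAt_ambientPoint t y ρ)).deriv]
  rfl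

lemma iteratedDeriv_eq_ev {F : ℝ → ℝ} {f : SmoothFn (ambientDomain W ε)} {t : ℝ} {y : Fin n → ℝ}
    (h : ∀ ρ (hz : ambientPoint t y ρ ∈ ambientDomain W ε), F ρ = ev ⟨_, hz⟩ f) (k : ℕ) :
    ∀ ρ (hz : ambientPoint t y ρ ∈ ambientDomain W ε),
      iteratedDeriv k F ρ = ev ⟨_, hz⟩ ((partialD (Sum.inr (Sum.inr ())))^[k] f) := by
  induction k with
  | zero => simpa using h
  | succ k ih =>
    intro ρ hz
    rw [iteratedDeriv_succ, deriv_eq_ev ih hz, Function.iterate_succ_apply']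

lemma mem_vanIdeal_iff_iteratedDeriv {F : ℝ → (Fin n → ℝ) → ℝ → ℝ}
    {f : SmoothFn (ambientDomain W ε)}
    (h : ∀ t y ρ (hz : ambientPoint t y ρ ∈ ambientDomain W ε), F t y ρ = ev ⟨_, hz⟩ f)
    (hε : 0 < ε) (k : ℕ) :
    f ∈ vanIdeal (partialD (Sum.inr (Sum.inr ()))) (zeroIdeal W ε) k ↔
      ∀ j < k, ∀ t, 0 < t → ∀ y ∈ W, iteratedDeriv j (F t y) 0 = 0 := by
  rw [mem_vanIdeal_iff]
  refine forall₂_congr fun j _ => ?_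
  rw [mem_zeroIdeal]
  constructor
  · intro h1 t ht y hy
    have hz : ambientPoint t y 0 ∈ ambientDomain W ε := ⟨ht, hy, by simp [ambientPoint, hε]⟩
    rw [iteratedDeriv_eq_ev (h t y) j 0 hz, h1 t y hz]
  · intro h1 t y hz
    rw [← iteratedDeriv_eq_ev (h t y) j 0 hz, h1 t hz.1 y hz.2.1]

/-- A function of `(ρ, x)` as a function of `(t, x, ρ)`. -/
def liftFn (A : ℝ → (Fin n → ℝ) → ℝ)
    (hA : ContDiffOn ℝ ∞ (fun q : ℝ × (Fin n → ℝ) => A q.1 q.2) (Set.Ioo (-ε) ε ×ˢ W)) :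
    SmoothFn (ambientDomain W ε) :=
  SmoothFn.of (fun z => A (z (Sum.inr (Sum.inr ()))) (fun i => z (Sum.inr (Sum.inl i)))) (by
    have h1 : ContDiff ℝ ∞ (fun z : Unit ⊕ Fin n ⊕ Unit → ℝ =>
        (z (Sum.inr (Sum.inr ())), fun i => z (Sum.inr (Sum.inl i)))) := by fun_prop
    exact hA.comp h1.contDiffOn fun z hz => ⟨hz.2.2, hz.2.1⟩)

/-- A function not depending on `ρ` is killed by `∂_ρ`. -/
lemma partialD_r_eq_zero {f : SmoothFn (ambientDomain W ε)} (F : ℝ → (Fin n → ℝ) → ℝ)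
    (h : ∀ t y ρ (hz : ambientPoint t y ρ ∈ ambientDomain W ε), ev ⟨_, hz⟩ f = F t y) :
    partialD (Sum.inr (Sum.inr ())) f = 0 := by
  refine ambientDomain_ext fun t y ρ hz => ?_
  rw [← deriv_eq_ev (F := fun _ => F t y) (f := f) (fun σ hσ => (h t y σ hσ).symm) hz]
  simp

/-- A function not depending on `t` is killed by `∂_t`. -/
lemma partialD_t_eq_zero {f : SmoothFn (ambientDomain W ε)} (F : (Fin n → ℝ) → ℝ → ℝ)
    (h : ∀ t y ρ (hz : ambientPoint t y ρ ∈ ambientDomain W ε), ev ⟨_, hz⟩ f = F y ρ) :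
    partialD (Sum.inl ()) f = 0 := by
  refine ambientDomain_ext fun t y ρ hz => ?_
  have hs : IsSlice (fun τ : Unit → ℝ => ambientPoint (τ ()) y ρ) (fun _ => Sum.inl ()) := by
    refine isSlice_of_eq (ambientPoint 0 y ρ) fun τ => ?_
    funext c
    rcases c with _ | i | _ <;> simp [ambientPoint]
  have := hs.pderiv_eq (F := fun _ => F y ρ) (f := f) (fun τ hτ => (h _ y ρ hτ).symm)
    (y := fun _ => t) hz ()
  rw [pderiv_const] at this
  rw [← this, map_zero]

/-- The coordinate `c`. -/
def coordFn (W : Opens (Fin n → ℝ)) (ε : ℝ) (c : Unit ⊕ Fin n ⊕ Unit) :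
    SmoothFn (ambientDomain W ε) :=
  SmoothFn.of (fun z => z c) (by fun_prop)

lemma partialD_coordFn (a c : Unit ⊕ Fin n ⊕ Unit) :
    partialD a (coordFn W ε c) = if a = c then 1 else 0 := by
  refine SmoothFn.ext_ev fun z => ?_
  have h1 := isSlice_id.pderiv_eq (F := fun z => z c) (f := coordFn W ε c) (fun _ _ => rfl) z.2 a
  have h2 : pderiv a (fun z : Unit ⊕ Fin n ⊕ Unit → ℝ => z c) z.1 = if a = c then 1 else 0 := by
    have h3 : HasFDerivAt (fun z : Unit ⊕ Fin n ⊕ Unit → ℝ => z c)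
        (ContinuousLinearMap.proj (R := ℝ) (φ := fun _ => ℝ) c) z.1 := hasFDerivAt_apply c z.1
    rw [pderiv, h3.fderiv, ContinuousLinearMap.proj_apply, Pi.single_apply]
    simp only [eq_comm]
  change ev z (partialD a (coordFn W ε c)) = _
  refine h1.symm.trans (h2.trans ?_)
  split_ifs
  · exact (map_one _).symm
  · exact (map_zero _).symm

/-- A nowhere vanishing smooth function is invertible. -/
lemma isUnit_of_ne_zero {κ : Type*} [Fintype κ] [DecidableEq κ] {Ω : Opens (κ → ℝ)}
    {f : SmoothFn Ω} (h : ∀ z, ev z f ≠ 0) : IsUnit f := by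
  refine IsUnit.of_mul_eq_one (SmoothFn.of (fun z => (extendZero f z)⁻¹)
    ((contDiffOn_extendZero f).inv fun z hz => ?_)) ?_
  · rw [extendZero_apply f hz]; exact h ⟨z, hz⟩
  · refine SmoothFn.ext_ev fun z => ?_
    rw [map_mul, map_one]
    change ev z f * (extendZero f z)⁻¹ = 1
    rw [extendZero_apply f z.2]
    exact mul_inv_cancel₀ (h z)

lemma isUnit_det_of_ev {κ ι : Type*} [Fintype κ] [DecidableEq κ] [Fintype ι] [DecidableEq ι]
    {Ω : Opens (κ → ℝ)} {A : Matrix ι ι (SmoothFn Ω)} (h : ∀ z, (A.map (ev z)).det ≠ 0) :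
    IsUnit A.det := by
  refine isUnit_of_ne_zero fun z => ?_
  have := RingHom.map_det (ev z).toRingHom A
  change ev z A.det = (A.map (ev z)).det at this
  rw [this]
  exact h z

lemma contDiffOn_slice (f : SmoothFn (ambientDomain W ε)) {t ρ : ℝ} (ht : 0 < t)
    (hρ : ρ ∈ Set.Ioo (-ε) ε) :
    ContDiffOn ℝ ∞ (fun y : Fin n → ℝ => extendZero f (ambientPoint t y ρ)) W :=
  (contDiffOn_extendZero f).comp (contDiff_ambientPoint t ρ).contDiffOn
    fun _ hy => ⟨ht, hy, hρ⟩

end AmbientDomain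

/-! ### Coordinate changes -/

section Charts

open TopologicalSpace

variable {n : ℕ} {M : Type*} [TopologicalSpace M] [ChartedSpace (EuclideanSpace ℝ (Fin n)) M]

lemma isOpen_domain (e : Chart n M) : IsOpen (domain e) :=
  e.open_target.preimage (PiLp.continuous_toLp 2 _)

lemma point_mem_source {e : Chart n M} {y : Fin n → ℝ} (hy : y ∈ domain e) :
    point e y ∈ e.source := e.map_target hy

/-- The coordinate frame as a linear map. -/
def coordMap (e : Chart n M) (y : Fin n → ℝ) :
    (Fin n → ℝ) →ₗ[ℝ] TangentSpace (𝓡 n) (point e y) :=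
  (mfderiv (𝓡 n) (𝓡 n) e.symm (WithLp.toLp 2 y)).toLinearMap ∘ₗ
    (WithLp.linearEquiv 2 ℝ (Fin n → ℝ)).symm.toLinearMap

lemma coordMap_apply (e : Chart n M) (y v : Fin n → ℝ) : coordMap e y v = coordVec e y v := rfl

lemma sum_coordVec (e : Chart n M) (y v : Fin n → ℝ) :
    coordVec e y v = ∑ i, v i • coordVec e y (Pi.single i 1) := by
  have h : v = ∑ i, v i • Pi.single i (1 : ℝ) := by
    ext j
    simp [Finset.sum_apply, Pi.single_apply]
  simp only [← coordMap_apply]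
  conv_lhs => rw [h]
  simp only [map_sum, map_smul]

/-- A bilinear form in terms of its components. -/
lemma apply_coordVec (e : Chart n M) (T : TensorField n M) (y v w : Fin n → ℝ) :
    T (point e y) (coordVec e y v) (coordVec e y w) = v ⬝ᵥ comp e T y *ᵥ w := by
  rw [sum_coordVec e y v, sum_coordVec e y w]
  simp only [map_sum, LinearMap.sum_apply, map_smul, LinearMap.smul_apply, smul_eq_mul,
    dotProduct, mulVec, comp, of_apply, Finset.mul_sum]
  rw [Finset.sum_comm]
  exact Finset.sum_congr rfl fun i _ => Finset.sum_congr rfl fun j _ => by ring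

lemma comp_transpose (e : Chart n M) {T : TensorField n M} {y : Fin n → ℝ}
    (h : ∀ v w, T (point e y) v w = T (point e y) w v) : (comp e T y)ᵀ = comp e T y := by
  ext i j
  exact h _ _

/-- The coordinate change from the chart `e` to the chart `e'`. -/
def transition (e e' : Chart n M) (y : Fin n → ℝ) : Fin n → ℝ := WithLp.ofLp (e' (point e y))

/-- The coordinates in the chart `e` of the points in the domain of the chart `e'`. -/
def overlap (e e' : Chart n M) : Opens (Fin n → ℝ) where
  carrier := {y | y ∈ domain e ∧ point e y ∈ e'.source}
  is_open' := (e.symm.isOpen_inter_preimage e'.open_source).preimage (PiLp.continuous_toLp 2 _)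

/-- The Jacobian matrix of the coordinate change. -/
def jacobian (e e' : Chart n M) (y : Fin n → ℝ) : Matrix (Fin n) (Fin n) ℝ :=
  Matrix.of fun a b => pderiv b (fun z => transition e e' z a) y

variable {e e' : Chart n M} {y : Fin n → ℝ}

lemma transition_mem_domain (hy : y ∈ overlap e e') : transition e e' y ∈ domain e' :=
  e'.map_source hy.2

lemma point_transition (hy : y ∈ overlap e e') : point e' (transition e e' y) = point e y :=
  e'.left_inv hy.2

lemma transition_mem_overlap (hy : y ∈ overlap e e') : transition e e' y ∈ overlap e' e :=
  ⟨transition_mem_domain hy, by rw [point_transition hy]; exact point_mem_source hy.1⟩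

variable [IsManifold (𝓡 n) ∞ M]

variable (n M) in
lemma isManifold_one : IsManifold (𝓡 n) 1 M := IsManifold.of_le (m := 1) (n := ∞) (by simp)

lemma contDiffOn_transition (he : e ∈ atlas (EuclideanSpace ℝ (Fin n)) M)
    (he' : e' ∈ atlas (EuclideanSpace ℝ (Fin n)) M) :
    ContDiffOn ℝ ∞ (transition e e') (overlap e e') := by
  have h1 := (contDiffGroupoid ∞ (𝓡 n)).compatible he he'
  have h2 := (contMDiffOn_of_mem_contDiffGroupoid h1).contDiffOn
  have h3 : ContDiff ℝ ∞ (fun y : Fin n → ℝ => (WithLp.toLp 2 y : EuclideanSpace ℝ (Fin n))) :=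
    PiLp.contDiff_toLp
  have h4 : ContDiff ℝ ∞ (fun y : EuclideanSpace ℝ (Fin n) => WithLp.ofLp y) :=
    PiLp.contDiff_ofLp
  refine h4.comp_contDiffOn (h2.comp h3.contDiffOn fun y hy => ?_)
  rw [OpenPartialHomeomorph.trans_source]
  exact ⟨hy.1, hy.2⟩

lemma mulVec_jacobian (he : e ∈ atlas (EuclideanSpace ℝ (Fin n)) M)
    (he' : e' ∈ atlas (EuclideanSpace ℝ (Fin n)) M) (hy : y ∈ overlap e e') (v : Fin n → ℝ) :
    jacobian e e' y *ᵥ v = fderiv ℝ (transition e e') y v := by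
  have hd : DifferentiableAt ℝ (transition e e') y :=
    ((contDiffOn_transition he he').contDiffAt ((overlap e e').2.mem_nhds hy)).differentiableAt
      (by simp)
  have h : jacobian e e' y = LinearMap.toMatrix' (fderiv ℝ (transition e e') y).toLinearMap := by
    ext i j
    rw [LinearMap.toMatrix'_apply]
    change fderiv ℝ (fun z => transition e e' z i) y (Pi.single j 1) = _
    rw [fderiv_apply hd]
    rfl
  rw [h, LinearMap.toMatrix'_mulVec]
  rfl

/-- The differential of the chart `e'` in the coordinate frame of the chart `e`. -/
lemma mfderiv_coordVec (he : e ∈ atlas (EuclideanSpace ℝ (Fin n)) M)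
    (he' : e' ∈ atlas (EuclideanSpace ℝ (Fin n)) M) (hy : y ∈ overlap e e') (v : Fin n → ℝ) :
    mfderiv (𝓡 n) (𝓡 n) e' (point e y) (coordVec e y v)
      = WithLp.toLp 2 (jacobian e e' y *ᵥ v) := by
  have := isManifold_one n M
  have h1 := mdifferentiableAt_atlas_symm (I := 𝓡 n) he hy.1
  have h2 := mdifferentiableAt_atlas (I := 𝓡 n) he' hy.2
  have h3 := mfderiv_comp (WithLp.toLp 2 y) h2 h1
  have h4 := congrArg (fun L : EuclideanSpace ℝ (Fin n) →L[ℝ] EuclideanSpace ℝ (Fin n) =>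
    L (WithLp.toLp 2 v)) h3
  refine h4.symm.trans ?_
  rw [mfderiv_eq_fderiv, mulVec_jacobian he he' hy]
  have h5 : transition e e' = (PiLp.continuousLinearEquiv 2 ℝ (fun _ : Fin n => ℝ))
    ∘ (e' ∘ e.symm) ∘ (PiLp.continuousLinearEquiv 2 ℝ (fun _ : Fin n => ℝ)).symm := rfl
  rw [h5, ContinuousLinearEquiv.comp_fderiv, ContinuousLinearEquiv.comp_right_fderiv]
  rfl

lemma coordVec_bijective (he : e ∈ atlas (EuclideanSpace ℝ (Fin n)) M) (hy : y ∈ domain e) :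
    Function.Bijective (coordVec e y) := by
  have := isManifold_one n M
  have h1 := (mdifferentiable_of_mem_atlas (I := 𝓡 n) he).symm.mfderiv_bijective
    (x := WithLp.toLp 2 y) hy
  exact h1.comp (WithLp.linearEquiv 2 ℝ (Fin n → ℝ)).symm.bijective

/-- The components of a bilinear form in two charts. -/
lemma comp_transition (he : e ∈ atlas (EuclideanSpace ℝ (Fin n)) M)
    (he' : e' ∈ atlas (EuclideanSpace ℝ (Fin n)) M) (hy : y ∈ overlap e e') (T : TensorField n M) :
    comp e T y = (jacobian e e' y)ᵀ * comp e' T (transition e e' y) * jacobian e e' y := by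
  have := isManifold_one n M
  have key : ∀ v : Fin n → ℝ, (coordVec e y v : EuclideanSpace ℝ (Fin n))
      = coordVec e' (transition e e' y) (jacobian e e' y *ᵥ v) := by
    intro v
    have h1 := (mdifferentiable_of_mem_atlas (I := 𝓡 n) he').symm_comp_deriv hy.2
    have h2 := congrArg (fun L : EuclideanSpace ℝ (Fin n) →L[ℝ] EuclideanSpace ℝ (Fin n) =>
      L (coordVec e y v)) h1
    refine h2.symm.trans ?_
    have h3 := mfderiv_coordVec he he' hy v
    exact congrArg (mfderiv (𝓡 n) (𝓡 n) e'.symm (e' (point e y))) h3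
  have hT : ∀ (x x' : M), x = x' → ∀ v w : EuclideanSpace ℝ (Fin n),
      (T x v w : ℝ) = T x' v w := by
    rintro x _ rfl v w; rfl
  ext i j
  have h1 := hT _ _ (point_transition hy).symm (coordVec e y (Pi.single i 1))
    (coordVec e y (Pi.single j 1))
  refine h1.trans ?_
  rw [key, key]
  refine (apply_coordVec e' T _ _ _).trans ?_
  rw [mulVec_mulVec, dotProduct_mulVec, vecMul_mulVec]
  simp [← mul_assoc]

variable (n M) in
/-- A family of matrices, one for each chart, that transforms like the components of a bilinear
form. -/
def IsTensorial (c : Chart n M → (Fin n → ℝ) → Matrix (Fin n) (Fin n) ℝ) : Prop :=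
  ∀ e ∈ atlas (EuclideanSpace ℝ (Fin n)) M, ∀ e' ∈ atlas (EuclideanSpace ℝ (Fin n)) M,
    ∀ y ∈ overlap e e',
      c e y = (jacobian e e' y)ᵀ * c e' (transition e e' y) * jacobian e e' y

/-- A tensorial family of matrices comes from a field of bilinear forms. -/
lemma IsTensorial.exists_comp {c : Chart n M → (Fin n → ℝ) → Matrix (Fin n) (Fin n) ℝ}
    (hc : IsTensorial n M c) : ∃ T : TensorField n M,
      ∀ e ∈ atlas (EuclideanSpace ℝ (Fin n)) M, ∀ y ∈ domain e, comp e T y = c e y := by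
  let L : ∀ x : M, TangentSpace (𝓡 n) x →ₗ[ℝ] (Fin n → ℝ) := fun x =>
    (WithLp.linearEquiv 2 ℝ (Fin n → ℝ)).toLinearMap ∘ₗ
      (mfderiv (𝓡 n) (𝓡 n) (chartAt (EuclideanSpace ℝ (Fin n)) x) x).toLinearMap
  refine ⟨fun x => (Matrix.toBilin' (c (chartAt _ x)
    (WithLp.ofLp (chartAt (EuclideanSpace ℝ (Fin n)) x x)))).comp (L x) (L x),
    fun e he y hy => ?_⟩
  have he' := chart_mem_atlas (EuclideanSpace ℝ (Fin n)) (point e y)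
  have hy' : y ∈ overlap e (chartAt _ (point e y)) := ⟨hy, mem_chart_source _ _⟩
  have hL : ∀ v, L (point e y) (coordVec e y v)
      = jacobian e (chartAt (EuclideanSpace ℝ (Fin n)) (point e y)) y *ᵥ v := fun v =>
    congrArg WithLp.ofLp (mfderiv_coordVec he he' hy' v)
  ext i j
  rw [hc e he _ he' y hy']
  change Matrix.toBilin' _ (L (point e y) _) (L (point e y) _) = _
  rw [hL, hL, Matrix.toBilin'_apply']
  rw [mulVec_mulVec, dotProduct_mulVec, vecMul_mulVec]
  simp [← mul_assoc]
  rfl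

end Charts

/-! ### Null Ricci Walker metrics in local coordinates -/

section LocalModel

open TopologicalSpace

/-- If the Schouten tensor has image in a totally null subspace, then so has the Ricci tensor:
the scalar curvature vanishes. -/
lemma ricci_image_of_schouten_image {ι : Type*} [Fintype ι] [DecidableEq ι]
    (hn : 2 < Fintype.card ι) {g E Rc : Matrix ι ι ℝ} (hg : gᵀ = g) (hdet : IsUnit g.det)
    (hRc : Rcᵀ = Rc) (hE : Eᵀ * g * E = 0)
    (h : E * (g⁻¹ * ((1 / ((Fintype.card ι : ℝ) - 2)) •
        (Rc - (metricTrace g Rc / (2 * ((Fintype.card ι : ℝ) - 1))) • g)))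
      = g⁻¹ * ((1 / ((Fintype.card ι : ℝ) - 2)) •
        (Rc - (metricTrace g Rc / (2 * ((Fintype.card ι : ℝ) - 1))) • g))) :
    E * (g⁻¹ * Rc) = g⁻¹ * Rc := by
  have hn' : (2 : ℝ) < Fintype.card ι := by exact_mod_cast hn
  set s := metricTrace g Rc with hs
  set P := (1 / ((Fintype.card ι : ℝ) - 2)) • (Rc - (s / (2 * ((Fintype.card ι : ℝ) - 1))) • g)
    with hP
  have hPt : Pᵀ = P := by
    rw [hP, transpose_smul, transpose_sub, transpose_smul, hRc, hg]
  have hgi : g * g⁻¹ = 1 := Matrix.mul_nonsing_inv g hdet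
  have hgi' : g⁻¹ * g = 1 := Matrix.nonsing_inv_mul g hdet
  have hPE : P * E = 0 := by
    have h1 : P = (g⁻¹ * P)ᵀ * g := by
      rw [transpose_mul, hPt, mul_assoc, inv_symm_of_symm hg hgi, hgi', mul_one]
    rw [h1, ← h, transpose_mul]
    calc (g⁻¹ * P)ᵀ * Eᵀ * g * E = (g⁻¹ * P)ᵀ * (Eᵀ * g * E) := by noncomm_ring
      _ = 0 := by rw [hE, mul_zero]
  have htr : (g⁻¹ * P).trace = 0 := by
    rw [← h, trace_mul_comm, mul_assoc, hPE, mul_zero, trace_zero]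
  have hs' : (g⁻¹ * Rc).trace = s := by
    rw [hs, metricTrace, trace]
    refine Finset.sum_congr rfl fun i _ => ?_
    rw [diag_apply, mul_apply]
    exact Finset.sum_congr rfl fun j _ => by rw [← hRc, transpose_apply, hRc]
  have hs0 : s = 0 := by
    rw [hP, Matrix.mul_smul, mul_sub, Matrix.mul_smul, hgi', trace_smul, trace_sub, trace_smul,
      trace_one, hs', smul_eq_mul, smul_eq_mul] at htr
    have h2 : (Fintype.card ι : ℝ) - 2 ≠ 0 := by linarith
    have h3 : (Fintype.card ι : ℝ) - 1 ≠ 0 := by linarith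
    field_simp at htr
    have h4 : s * ((Fintype.card ι : ℝ) - 2) = 0 := by linarith
    exact (mul_eq_zero.1 h4).resolve_right h2
  have h5 : Rc = ((Fintype.card ι : ℝ) - 2) • P := by
    rw [hP, hs0, zero_div, zero_smul, sub_zero, smul_smul, mul_one_div_cancel, one_smul]
    linarith
  rw [h5, Matrix.mul_smul, Matrix.mul_smul, h]

lemma exists_inverse {κ ι : Type*} [Fintype κ] [DecidableEq κ] [Fintype ι] [DecidableEq ι]
    {Ω : Opens (κ → ℝ)} {A : Matrix ι ι (SmoothFn Ω)} (h : ∀ z, (A.map (ev z)).det ≠ 0) :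
    ∃ B, A * B = 1 ∧ B * A = 1 :=
  ⟨A⁻¹, Matrix.mul_nonsing_inv A (isUnit_det_of_ev h), Matrix.nonsing_inv_mul A
    (isUnit_det_of_ev h)⟩

variable {n : ℕ}

lemma ambientDomain_matrix_ext {W : Opens (Fin n → ℝ)} {ε : ℝ} {α β : Type*}
    {A B : Matrix α β (SmoothFn (ambientDomain W ε))}
    (h : ∀ t y ρ (hz : ambientPoint t y ρ ∈ ambientDomain W ε),
      A.map (ev ⟨_, hz⟩) = B.map (ev ⟨_, hz⟩)) : A = B := by
  ext1 i j
  exact ambientDomain_ext fun t y ρ hz => congrFun (congrFun (h t y ρ hz) i) j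

/-- A matrix-valued function of `(ρ, x)` as a matrix of functions of `(t, x, ρ)`. -/
def liftMat {W : Opens (Fin n → ℝ)} {ε : ℝ} {α β : Type*} (A : ℝ → (Fin n → ℝ) → Matrix α β ℝ)
    (hA : ∀ i j, ContDiffOn ℝ ∞ (fun q : ℝ × (Fin n → ℝ) => A q.1 q.2 i j)
      (Set.Ioo (-ε) ε ×ˢ W)) : Matrix α β (SmoothFn (ambientDomain W ε)) :=
  Matrix.of fun i j => liftFn (fun ρ y => A ρ y i j) (hA i j)

lemma map_ev_liftMat {W : Opens (Fin n → ℝ)} {ε : ℝ} {α β : Type*}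
    {A : ℝ → (Fin n → ℝ) → Matrix α β ℝ}
    (hA : ∀ i j, ContDiffOn ℝ ∞ (fun q : ℝ × (Fin n → ℝ) => A q.1 q.2 i j)
      (Set.Ioo (-ε) ε ×ˢ W)) {t : ℝ} {y : Fin n → ℝ} {ρ : ℝ}
    (hz : ambientPoint t y ρ ∈ ambientDomain W ε) :
    (liftMat A hA).map (ev ⟨_, hz⟩) = A ρ y := rfl

/-- The derivations `∂_i` in the directions of the base. -/
abbrev baseD (W : Opens (Fin n → ℝ)) (ε : ℝ) (i : Fin n) :
    Derivation ℝ (SmoothFn (ambientDomain W ε)) (SmoothFn (ambientDomain W ε)) :=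
  sliceD (ambientDomain W ε) (fun i => Sum.inr (Sum.inl i)) i

/-- The derivation `∂_ρ`. -/
abbrev radialD (W : Opens (Fin n → ℝ)) (ε : ℝ) :
    Derivation ℝ (SmoothFn (ambientDomain W ε)) (SmoothFn (ambientDomain W ε)) :=
  partialD (Sum.inr (Sum.inr ()))

/-- The projector onto the span of a smooth frame, orthogonal for the Euclidean inner product of the
coordinate space. -/
lemma exists_projector {W : Opens (Fin n → ℝ)} (ε : ℝ) {p : ℕ}
    {V : Fin p → (Fin n → ℝ) → (Fin n → ℝ)} (hV : ∀ a, ContDiffOn ℝ ∞ (V a) W)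
    (hli : ∀ y ∈ W, LinearIndependent ℝ (fun a => V a y)) :
    ∃ E : Matrix (Fin n) (Fin n) (SmoothFn (ambientDomain W ε)), E * E = E ∧
      dmat (radialD W ε) E = 0 ∧
      ∀ t y ρ (hz : ambientPoint t y ρ ∈ ambientDomain W ε) v,
        E.map (ev ⟨_, hz⟩) *ᵥ v = v ↔ v ∈ Submodule.span ℝ (Set.range fun a => V a y) := by
  have hB : ∀ (i : Fin n) (a : Fin p), ContDiffOn ℝ ∞ (fun q : ℝ × (Fin n → ℝ) =>
      (Matrix.of fun i a => V a q.2 i : Matrix (Fin n) (Fin p) ℝ) i a)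
      (Set.Ioo (-ε) ε ×ˢ W) := fun i a =>
    (contDiffOn_pi.1 (hV a) i).comp contDiffOn_snd fun _ hq => hq.2
  set B : Matrix (Fin n) (Fin p) (SmoothFn (ambientDomain W ε)) :=
    liftMat (fun _ y => Matrix.of fun i a => V a y i) hB with hBdef
  have hmulVec : ∀ t y ρ (hz : ambientPoint t y ρ ∈ ambientDomain W ε) w,
      B.map (ev ⟨_, hz⟩) *ᵥ w = ∑ a, w a • V a y := by
    intro t y ρ hz w
    rw [hBdef, map_ev_liftMat]
    ext i
    simp [mulVec, dotProduct, mul_comm]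
  have hmap : ∀ z, (Bᵀ * B).map (ev z) = (B.map (ev z))ᵀ * B.map (ev z) := fun z => by
    rw [Matrix.map_mul, transpose_map]
  have hdet : ∀ z, ((Bᵀ * B).map (ev z)).det ≠ 0 := by
    rintro ⟨z, hz⟩ hd
    rw [hmap] at hd
    obtain ⟨w, hw0, hw⟩ := Matrix.exists_mulVec_eq_zero_iff.2 hd
    have h1 : B.map (ev ⟨z, hz⟩) *ᵥ w = 0 := by
      rw [← dotProduct_self_eq_zero, dotProduct_mulVec, vecMul_mulVec, ← dotProduct_mulVec,
        hw, dotProduct_zero]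
    have hz' : ambientPoint _ _ _ ∈ ambientDomain W ε := (eq_ambientPoint z) ▸ hz
    have h2 : (⟨z, hz⟩ : ambientDomain W ε) = ⟨_, hz'⟩ := Subtype.ext (eq_ambientPoint z)
    rw [h2, hmulVec] at h1
    exact hw0 (funext (Fintype.linearIndependent_iff.1 (hli _ hz.2.1) w h1))
  obtain ⟨C, hC, hC'⟩ := exists_inverse hdet
  have hEB : B * C * Bᵀ * B = B := by
    rw [Matrix.mul_assoc, Matrix.mul_assoc, hC', Matrix.mul_one]
  refine ⟨B * C * Bᵀ, ?_, ?_, fun t y ρ hz v => ?_⟩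
  · rw [← Matrix.mul_assoc, ← Matrix.mul_assoc, hEB]
  · ext1 i j
    refine partialD_r_eq_zero (fun _ y => ((Matrix.of fun i a => V a y i) *
      ((Matrix.of fun i a => V a y i)ᵀ * (Matrix.of fun i a => V a y i))⁻¹ *
      (Matrix.of fun i a => V a y i : Matrix (Fin n) (Fin p) ℝ)ᵀ) i j) fun t y ρ hz => ?_
    have h : (B * C * Bᵀ).map (ev ⟨_, hz⟩) = (Matrix.of fun i a => V a y i) *
      ((Matrix.of fun i a => V a y i)ᵀ * (Matrix.of fun i a => V a y i))⁻¹ *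
      (Matrix.of fun i a => V a y i : Matrix (Fin n) (Fin p) ℝ)ᵀ := by
      rw [Matrix.map_mul, Matrix.map_mul, transpose_map, ← inv_eq_map_ev hC, hmap, hBdef,
        map_ev_liftMat]
    exact congrFun (congrFun h i) j
  · rw [Submodule.mem_span_range_iff_exists_fun]
    constructor
    · intro h
      refine ⟨(C.map (ev ⟨_, hz⟩) * (B.map (ev ⟨_, hz⟩))ᵀ) *ᵥ v, ?_⟩
      rw [← hmulVec t y ρ hz, mulVec_mulVec, ← Matrix.mul_assoc]
      rw [Matrix.map_mul, Matrix.map_mul, transpose_map] at h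
      exact h
    · rintro ⟨w, rfl⟩
      rw [← hmulVec t y ρ hz, mulVec_mulVec, ← Matrix.map_mul, hEB]

variable {M : Type*} [TopologicalSpace M] [ChartedSpace (EuclideanSpace ℝ (Fin n)) M]
  [IsManifold (𝓡 n) ∞ M] {g : TensorField n M} {N : SubspaceField n M} {p : ℕ}

lemma det_comp_ne_zero {e : Chart n M} (he : e ∈ atlas (EuclideanSpace ℝ (Fin n)) M)
    {y : Fin n → ℝ} (hy : y ∈ domain e) {T : TensorField n M}
    (hT : ∀ v, (∀ w, T (point e y) v w = 0) → v = 0) : (comp e T y).det ≠ 0 := by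
  intro hd
  rw [← det_transpose] at hd
  obtain ⟨v, hv0, hv⟩ := Matrix.exists_mulVec_eq_zero_iff.2 hd
  refine hv0 ((coordVec_bijective he hy).1 ?_)
  rw [← coordMap_apply, ← coordMap_apply, map_zero]
  refine hT _ fun w => ?_
  obtain ⟨w, rfl⟩ := (coordVec_bijective he hy).2 w
  rw [coordMap_apply, apply_coordVec, dotProduct_mulVec, ← mulVec_transpose, hv, zero_dotProduct]

/-- The matrices `gm`, inverse to `gmi`, and `E` represent the null Ricci Walker metric `g` and a
projector onto the distribution `N` in the chart `e`. -/
structure IsBaseModel (g : TensorField n M) (N : SubspaceField n M) (e : Chart n M)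
    {W : Opens (Fin n → ℝ)} {ε : ℝ}
    (gm gmi E : Matrix (Fin n) (Fin n) (SmoothFn (ambientDomain W ε))) : Prop where
  walker : IsWalker (baseD W ε) gm gmi
    (chr (baseD W ε) gm gmi) E
  ric_null : E * (gmi * ric (baseD W ε)
      (chr (baseD W ε) gm gmi))
    = gmi * ric (baseD W ε)
      (chr (baseD W ε) gm gmi)
  D_r_g : dmat (radialD W ε) gm = 0
  D_r_E : dmat (radialD W ε) E = 0
  map_ev : ∀ t y ρ (hz : ambientPoint t y ρ ∈ ambientDomain W ε),
    gm.map (ev ⟨_, hz⟩) = comp e g y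
  mem_iff : ∀ t y ρ (hz : ambientPoint t y ρ ∈ ambientDomain W ε) v,
    E.map (ev ⟨_, hz⟩) *ᵥ v = v ↔ coordVec e y v ∈ N (point e y)

/-- Every point of a chart has a neighbourhood in which a null Ricci Walker metric is represented
by matrices of smooth functions. -/
lemma exists_isBaseModel (hn : 2 < n) (hg : IsNullRicciWalker g N p) {e : Chart n M}
    (he : e ∈ atlas (EuclideanSpace ℝ (Fin n)) M) {y₀ : Fin n → ℝ} (hy₀ : y₀ ∈ domain e) :
    ∃ W : Opens (Fin n → ℝ), y₀ ∈ W ∧ (W : Set (Fin n → ℝ)) ⊆ domain e ∧ ∀ ε : ℝ,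
      ∃ gm gmi E : Matrix (Fin n) (Fin n) (SmoothFn (ambientDomain W ε)),
        IsBaseModel g N e gm gmi E := by
  obtain ⟨W₀, hW₀, hyW, hsub, V, hV, hVN⟩ := hg.distribution e he y₀ hy₀
  let W : Opens (Fin n → ℝ) := ⟨W₀, hW₀⟩
  refine ⟨W, hyW, hsub, fun ε => ?_⟩
  obtain ⟨E, hEE, hδE, hE⟩ := exists_projector (W := W) ε hV fun y hy => (hVN y hy).1
  have hmem : ∀ t y ρ (hz : ambientPoint t y ρ ∈ ambientDomain W ε) v,
      E.map (ev ⟨_, hz⟩) *ᵥ v = v ↔ coordVec e y v ∈ N (point e y) := fun t y ρ hz v =>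
    (hE t y ρ hz v).trans ((hVN y hz.2.1).2 v).symm
  have hcomp : ∀ i j, ContDiffOn ℝ ∞ (fun q : ℝ × (Fin n → ℝ) => comp e g q.2 i j)
      (Set.Ioo (-ε) ε ×ˢ W) := fun i j =>
    ((hg.metric.smooth e he i j).mono hsub).comp contDiffOn_snd fun _ hq => hq.2
  set gm : Matrix (Fin n) (Fin n) (SmoothFn (ambientDomain W ε)) :=
    liftMat (fun _ y => comp e g y) hcomp with hgm
  have hev : ∀ t y ρ (hz : ambientPoint t y ρ ∈ ambientDomain W ε),
      gm.map (ev ⟨_, hz⟩) = comp e g y := fun t y ρ hz => map_ev_liftMat hcomp hz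
  have hgt : gmᵀ = gm := ambientDomain_matrix_ext fun t y ρ hz => by
    rw [transpose_map, hev, comp_transpose e fun v w => hg.metric.symm _ v w]
  have hdet : ∀ z, (gm.map (ev z)).det ≠ 0 := by
    rintro ⟨z, hz⟩
    exact det_comp_ne_zero he (hsub hz.2.1) (hg.metric.nondegenerate _)
  obtain ⟨gmi, hgi, hgi'⟩ := exists_inverse hdet
  have hslice : ∀ t ρ, 0 < t → ρ ∈ Set.Ioo (-ε) ε → ∀ y
      (hy : ambientPoint t y ρ ∈ ambientDomain W ε), comp e g y = gm.map (ev ⟨_, hy⟩) :=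
    fun t ρ _ _ y hy => (hev t y ρ hy).symm
  have hinv : ∀ t y ρ (hz : ambientPoint t y ρ ∈ ambientDomain W ε),
      gmi.map (ev ⟨_, hz⟩) = (comp e g y)⁻¹ := fun t y ρ hz => by
    rw [← hev t y ρ hz, inv_eq_map_ev hgi]
  have hcol : ∀ t y ρ (hz : ambientPoint t y ρ ∈ ambientDomain W ε) j,
      coordVec e y (fun i => ev ⟨_, hz⟩ (E i j)) ∈ N (point e y) := by
    intro t y ρ hz j
    rw [← hmem t y ρ hz]
    have h1 : (fun i => ev ⟨_, hz⟩ (E i j)) = E.map (ev ⟨_, hz⟩) *ᵥ Pi.single j 1 := by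
      ext i; simp
    rw [h1, mulVec_mulVec, ← Matrix.map_mul, hEE]
  have hnull : Eᵀ * gm * E = 0 := by
    refine ambientDomain_matrix_ext fun t y ρ hz => ?_
    rw [Matrix.map_mul, Matrix.map_mul, transpose_map, hev]
    ext i j
    have h1 := hg.null _ _ (hcol t y ρ hz i) _ (hcol t y ρ hz j)
    rw [apply_coordVec] at h1
    rw [mul_assoc]
    simp only [dotProduct, mulVec] at h1
    simpa [mul_apply] using h1
  have hLC := isLeviCivita_chr (baseD W ε) hgt hgi
  have hpar : ∀ k, E * (dmat (baseD W ε k) E + chr (baseD W ε) gm gmi k * E)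
      = dmat (baseD W ε k) E + chr (baseD W ε) gm gmi k * E := by
    intro k
    refine ambientDomain_matrix_ext fun t y ρ hz => ?_
    have hs := isSlice_ambientPoint (n := n) t ρ
    ext i j
    have h1 := hg.parallel e he W₀ hW₀ hsub
      (fun y i => extendZero (E i j) (ambientPoint t y ρ))
      (contDiffOn_pi.2 fun i => contDiffOn_slice (E i j) hz.1 hz.2.2)
      (fun y hy => by
        have hz' : ambientPoint t y ρ ∈ ambientDomain W ε := ⟨hz.1, hy, hz.2.2⟩
        simp only [extendZero_apply _ hz']
        exact hcol t y ρ hz' j) y hz.2.1 k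
    have h2 : (fun i => covDerivVec (comp e g)
        (fun y i => extendZero (E i j) (ambientPoint t y ρ)) k i y)
        = (dmat (baseD W ε k) E + chr (baseD W ε) gm gmi k * E).map (ev ⟨_, hz⟩) *ᵥ Pi.single j 1 := by
      ext i
      rw [covDerivVec, hs.pderiv_eq (f := E i j) (fun w hw => extendZero_apply _ hw) hz]
      simp only [hs.christoffel_eq (hslice t ρ hz.1 hz.2.2) hgi hz, extendZero_apply _ hz]
      simp [mul_apply, ev_apply, sliceD]
    rw [h2, ← hmem t y ρ hz, mulVec_mulVec, ← Matrix.map_mul, mulVec_single_one,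
      mulVec_single_one] at h1
    exact congrFun h1 i
  have hcomm : ∀ i j (a : SmoothFn (ambientDomain W ε)), baseD W ε i (baseD W ε j a) = baseD W ε j (baseD W ε i a) := fun i j a =>
    partialD_comm _ _ a
  refine ⟨gm, gmi, E, ⟨⟨hcomm, hgt, hgi, hgi', hLC, hEE, hnull, hpar⟩, ?_, ?_, hδE, hev, hmem⟩⟩
  · refine ambientDomain_matrix_ext fun t y ρ hz => ?_
    have hric := (isSlice_ambientPoint (n := n) t ρ).ricci_eq (hslice t ρ hz.1 hz.2.2) hgt hgi hz
    rw [Matrix.map_mul, Matrix.map_mul, hinv, ← hric]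
    refine ricci_image_of_schouten_image (by simpa using hn)
      (comp_transpose e fun v w => hg.metric.symm _ v w)
      (det_comp_ne_zero he (hsub hz.2.1) (hg.metric.nondegenerate _)).isUnit ?_ ?_ ?_
    · rw [hric, ← transpose_map, ric_symm hgt hgi' hgi hcomm hLC]
    · rw [← hev t y ρ hz, ← transpose_map, ← Matrix.map_mul, ← Matrix.map_mul, hnull]
      exact Matrix.map_zero _ (map_zero _)
    · ext i j
      have h1 := hg.schouten_image e he y (hsub hz.2.1) (Pi.single j 1)
      rw [← hmem t y ρ hz, mulVec_mulVec, mulVec_single_one, mulVec_single_one] at h1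
      exact congrFun h1 i
  · ext1 i j
    exact partialD_r_eq_zero (fun _ y => comp e g y i j) fun t y ρ hz =>
      congrFun (congrFun (hev t y ρ hz) i) j

end LocalModel

/-! ### Families of metrics in local coordinates -/

section FamilyModel

open TopologicalSpace

section Iterate

variable {ι R : Type*} [Fintype ι] [DecidableEq ι] [CommRing R] [Algebra ℝ R]
  {δ : Derivation ℝ R R} {A B : Matrix ι ι R}

lemma iterate_dmat_apply (m : ℕ) (i j : ι) : (dmat δ)^[m] A i j = δ^[m] (A i j) := by
  induction m generalizing A with
  | zero => rfl
  | succ m ih => rw [Function.iterate_succ_apply, Function.iterate_succ_apply, ih, dmat_apply]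

lemma iterate_dmat_mul (hA : dmat δ A = 0) (m : ℕ) :
    (dmat δ)^[m] (A * B) = A * (dmat δ)^[m] B := by
  induction m generalizing B with
  | zero => rfl
  | succ m ih =>
    rw [Function.iterate_succ_apply, Function.iterate_succ_apply, dmat_mul, hA, zero_mul, zero_add,
      ih]

lemma iterate_dmat_transpose (m : ℕ) : (dmat δ)^[m] Aᵀ = ((dmat δ)^[m] A)ᵀ := by
  induction m generalizing A with
  | zero => rfl
  | succ m ih => simp only [Function.iterate_succ_apply, dmat_transpose, ih]

end Iterate

variable {n : ℕ} {M : Type*} [TopologicalSpace M] [ChartedSpace (EuclideanSpace ℝ (Fin n)) M]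

/-- `G ρ`, for `ρ ∈ (-ε, ε)`, is a smooth family of metrics with `G 0 = g`. -/
structure IsMetricFamily (g : TensorField n M) (ε : ℝ) (G : ℝ → TensorField n M) : Prop where
  initial : G 0 = g
  symm : ∀ ρ ∈ Set.Ioo (-ε) ε, ∀ x v w, G ρ x v w = G ρ x w v
  nondegenerate : ∀ ρ ∈ Set.Ioo (-ε) ε, ∀ x v, (∀ w, G ρ x v w = 0) → v = 0
  smooth : ∀ e ∈ atlas (EuclideanSpace ℝ (Fin n)) M, ∀ i j,
    ContDiffOn ℝ ∞ (fun q : ℝ × (Fin n → ℝ) => comp e (G q.1) q.2 i j)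
      (Set.Ioo (-ε) ε ×ˢ domain e)

lemma SolvesFeffermanGraham.isMetricFamily {g : TensorField n M} {ε : ℝ} {G : ℝ → TensorField n M}
    (h : SolvesFeffermanGraham g ε G) : IsMetricFamily g ε G :=
  ⟨h.initial, h.symm, h.nondegenerate, h.smooth⟩

/-- The matrices `gm₁`, inverse to `gmi₁`, represent the family of metrics `G` in the chart `e`,
and `S` represents the endomorphism associated with the difference of `G` and `g`. -/
structure IsFamilyModel (g : TensorField n M) (N : SubspaceField n M) (G : ℝ → TensorField n M)
    (e : Chart n M) {W : Opens (Fin n → ℝ)} {ε : ℝ} (ti : SmoothFn (ambientDomain W ε))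
    (gm gmi E S gm₁ gmi₁ : Matrix (Fin n) (Fin n) (SmoothFn (ambientDomain W ε))) : Prop
    extends IsBaseModel g N e gm gmi E where
  family : IsFGFamily (partialD (Ω := ambientDomain W ε)) (coordFn W ε (Sum.inl ())) ti
    (coordFn W ε (Sum.inr (Sum.inr ()))) gm gmi (chr (baseD W ε) gm gmi) E S gm₁ gmi₁
    (chr (baseD W ε) gm₁ gmi₁) (zeroIdeal W ε)
  map_ev_family : ∀ t y ρ (hz : ambientPoint t y ρ ∈ ambientDomain W ε),
    gm₁.map (ev ⟨_, hz⟩) = comp e (G ρ) y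

variable {g : TensorField n M} {N : SubspaceField n M} {G h : ℝ → TensorField n M} {e : Chart n M}
  {W : Opens (Fin n → ℝ)} {ε : ℝ} {ti : SmoothFn (ambientDomain W ε)}
  {gm gmi E S gm₁ gmi₁ : Matrix (Fin n) (Fin n) (SmoothFn (ambientDomain W ε))}

lemma IsBaseModel.exists_isFamilyModel [IsManifold (𝓡 n) ∞ M] (hB : IsBaseModel g N e gm gmi E)
    (he : e ∈ atlas (EuclideanSpace ℝ (Fin n)) M) (hsub : (W : Set (Fin n → ℝ)) ⊆ domain e)
    (hG : IsMetricFamily g ε G) :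
    ∃ ti S gm₁ gmi₁, IsFamilyModel g N G e ti gm gmi E S gm₁ gmi₁ := by
  have hcomp : ∀ i j, ContDiffOn ℝ ∞ (fun q : ℝ × (Fin n → ℝ) => comp e (G q.1) q.2 i j)
      (Set.Ioo (-ε) ε ×ˢ W) := fun i j =>
    (hG.smooth e he i j).mono (Set.prod_mono le_rfl hsub)
  set gm₁ : Matrix (Fin n) (Fin n) (SmoothFn (ambientDomain W ε)) :=
    liftMat (fun ρ y => comp e (G ρ) y) hcomp with hgm
  have hev : ∀ t y ρ (hz : ambientPoint t y ρ ∈ ambientDomain W ε),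
      gm₁.map (ev ⟨_, hz⟩) = comp e (G ρ) y := fun t y ρ hz => map_ev_liftMat hcomp hz
  have hgt : gm₁ᵀ = gm₁ := ambientDomain_matrix_ext fun t y ρ hz => by
    rw [transpose_map, hev, comp_transpose e fun v w => hG.symm ρ hz.2.2 _ v w]
  have hdet : ∀ z, (gm₁.map (ev z)).det ≠ 0 := by
    rintro ⟨z, hz⟩
    exact det_comp_ne_zero he (hsub hz.2.1) (hG.nondegenerate _ hz.2.2 _)
  obtain ⟨gmi₁, hgi, hgi'⟩ := exists_inverse hdet
  have ht : IsUnit (coordFn W ε (Sum.inl ())) := isUnit_of_ne_zero fun z => z.2.1.ne'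
  obtain ⟨ti, hti⟩ := ht.exists_right_inv
  refine ⟨ti, gmi * (gm₁ - gm), gm₁, gmi₁, hB, ⟨⟨partialD_comm, hti, ?_, ?_, ?_, ?_, ?_, ?_, ?_,
    hgt, hgi, hgi', isLeviCivita_chr _ hgt hgi⟩, hB.walker, hB.ric_null, hB.D_r_g, hB.D_r_E,
    fun i a ha => partialD_mem_zeroIdeal i ha, ?_, ?_, ?_⟩, hev⟩
  · rw [partialD_coordFn, if_pos rfl]
  · intro i; rw [partialD_coordFn, if_neg (by simp)]
  · rw [partialD_coordFn, if_neg (by simp)]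
  · rw [partialD_coordFn, if_neg (by simp)]
  · intro i; rw [partialD_coordFn, if_neg (by simp)]
  · rw [partialD_coordFn, if_pos rfl]
  · exact fun i j => partialD_t_eq_zero (fun y ρ => comp e (G ρ) y i j) fun t y ρ hz =>
      congrFun (congrFun (hev t y ρ hz) i) j
  · exact fun t y hz => rfl
  · rw [← mul_assoc, hB.walker.mul_inv, one_mul, add_sub_cancel]
  · refine MatIn.mul_left (fun i j t y hz => ?_) _
    have h1 : (gm₁ - gm).map (ev ⟨_, hz⟩) = 0 := by
      rw [matrix_map_sub, hev, hB.map_ev, hG.initial, sub_self]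
    exact congrFun (congrFun h1 i) j

namespace IsFamilyModel

variable (F : IsFamilyModel g N G e ti gm gmi E S gm₁ gmi₁)
include F

/-- The components of the ambient Ricci tensor as smooth functions. -/
lemma ambientRicci_eq {t : ℝ} {y : Fin n → ℝ} {ρ : ℝ}
    (hz : ambientPoint t y ρ ∈ ambientDomain W ε) :
    ambientRicci e G t y ρ = (ambRic (partialD (Ω := ambientDomain W ε))
      (coordFn W ε (Sum.inl ())) ti (coordFn W ε (Sum.inr (Sum.inr ()))) gm₁ gmi₁
      (chr (baseD W ε) gm₁ gmi₁)).map (ev ⟨_, hz⟩) := by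
  have A := F.family.amb
  have hcomp : ∀ z (hz : id z ∈ ambientDomain W ε), ambientComp e G z
      = (ambMat (coordFn W ε (Sum.inl ())) (coordFn W ε (Sum.inr (Sum.inr ()))) gm₁).map
        (ev ⟨id z, hz⟩) := by
    intro z hz
    have hz' : ambientPoint _ _ _ ∈ ambientDomain W ε := (eq_ambientPoint z) ▸ hz
    have h2 : (⟨z, hz⟩ : ambientDomain W ε) = ⟨_, hz'⟩ := Subtype.ext (eq_ambientPoint z)
    have h1 := F.map_ev_family _ _ _ hz'
    rw [← h2] at h1
    ext a b
    rw [Matrix.map_apply]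
    rcases a with _ | i | _ <;> rcases b with _ | j | _ <;>
      simp only [ambientComp, ambMat, of_apply, id, map_mul, map_pow, map_zero, map_ofNat]
    · rfl
    · rfl
    · rw [← h1]; rfl
    · rfl
  have h1 := isSlice_id.ricci_eq hcomp (ambMat_transpose A.symm)
    (ambMat_mul_ambInv A.t_mul A.mul_inv) (y := ambientPoint t y ρ) hz
  have h2 := isLeviCivita_chr (sliceD (ambientDomain W ε) id)
    (ambMat_transpose (t := coordFn W ε (Sum.inl ())) (r := coordFn W ε (Sum.inr (Sum.inr ())))
      A.symm) (ambMat_mul_ambInv A.t_mul A.mul_inv)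
  have h3 := h2.unique (ambMat_transpose A.symm) (ambInv_mul_ambMat A.t_mul A.inv_mul)
    A.isLeviCivita_ambConn
  rw [h3] at h1
  exact h1

/-- The Fefferman-Graham equations to order `m` as a congruence. -/
lemma ambRic_mem_iff (hε : 0 < ε) (m : ℕ) :
    (∀ a b, ambRic (partialD (Ω := ambientDomain W ε))
      (coordFn W ε (Sum.inl ())) ti (coordFn W ε (Sum.inr (Sum.inr ()))) gm₁ gmi₁
      (chr (baseD W ε) gm₁ gmi₁) a b ∈ vanIdeal (radialD W ε) (zeroIdeal W ε) m) ↔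
    ∀ k < m, ∀ t, 0 < t → ∀ y ∈ W, ∀ a b,
      iteratedDeriv k (fun ρ => ambientRicci e G t y ρ a b) 0 = 0 := by
  have h1 := fun a b => mem_vanIdeal_iff_iteratedDeriv
    (F := fun t y ρ => ambientRicci e G t y ρ a b)
    (f := ambRic (partialD (Ω := ambientDomain W ε))
      (coordFn W ε (Sum.inl ())) ti (coordFn W ε (Sum.inr (Sum.inr ()))) gm₁ gmi₁
      (chr (baseD W ε) gm₁ gmi₁) a b)
    (fun t y ρ hz => by rw [F.ambientRicci_eq hz]; rfl) hε m
  exact ⟨fun h k hk t ht y hy a b => (h1 a b).1 (h a b) k hk t ht y hy,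
    fun h a b => (h1 a b).2 fun k hk t ht y hy => h k hk t ht y hy a b⟩

lemma base_mem (hε : 0 < ε) {t : ℝ} (ht : 0 < t) {y : Fin n → ℝ} (hy : y ∈ W) :
    ambientPoint t y 0 ∈ ambientDomain W ε := ⟨ht, hy, by simp [ambientPoint, hε]⟩

lemma map_ev_inv {t : ℝ} {y : Fin n → ℝ} {ρ : ℝ} (hz : ambientPoint t y ρ ∈ ambientDomain W ε) :
    gmi.map (ev ⟨_, hz⟩) = (comp e g y)⁻¹ := by
  rw [← F.map_ev t y ρ hz, inv_eq_map_ev F.family.walker.mul_inv]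

/-- The Taylor coefficients of `G - g` as iterated derivatives. -/
lemma taylorCoeff_eq (hh : ∀ ρ x, h ρ x = G ρ x - g x) (m : ℕ) {t : ℝ} {y : Fin n → ℝ}
    (hz : ambientPoint t y 0 ∈ ambientDomain W ε) :
    taylorCoeff h m e y = (gm * (dmat (radialD W ε))^[m] S).map (ev ⟨_, hz⟩) := by
  rw [← iterate_dmat_mul F.D_r_g]
  ext i j
  rw [Matrix.map_apply, iterate_dmat_apply]
  refine iteratedDeriv_eq_ev (fun ρ hz' => ?_) m 0 hz
  have h1 : comp e (h ρ) y = comp e (G ρ) y - comp e g y := by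
    ext i j
    simp only [comp, of_apply, hh, Matrix.sub_apply]
    rfl
  have h2 : gm * S = gm₁ - gm := by rw [F.family.eq, add_sub_cancel_left]
  rw [h1, h2, ← F.map_ev_family t y ρ hz', ← F.map_ev t y ρ hz', ← matrix_map_sub]
  rfl

lemma taylorCoeff_image (hε : 0 < ε) (hh : ∀ ρ x, h ρ x = G ρ x - g x) {m : ℕ}
    (hS : MatCong (vanIdeal (radialD W ε) (zeroIdeal W ε) (m + 1)) (E * S) S) {y : Fin n → ℝ}
    (hy : y ∈ W) (v : Fin n → ℝ) :
    coordVec e y (((comp e g y)⁻¹ * taylorCoeff h m e y) *ᵥ v) ∈ N (point e y) := by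
  have hz := F.base_mem hε one_pos hy
  rw [F.taylorCoeff_eq hh m hz, ← F.map_ev_inv hz, ← Matrix.map_mul, ← mul_assoc,
    F.family.walker.inv_mul, one_mul, ← F.mem_iff 1 y 0 hz, mulVec_mulVec, ← Matrix.map_mul,
    ← iterate_dmat_mul F.D_r_E]
  congr 1
  ext i j
  have h1 := mem_vanIdeal_iff.1 (hS i j) m (Nat.lt_succ_self m) 1 y hz
  have h2 : (radialD W ε)^[m] ((E * S) i j - S i j)
      = (radialD W ε)^[m] ((E * S) i j) - (radialD W ε)^[m] (S i j) :=
    iterate_map_sub _ m _ _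
  rw [h2, map_sub, sub_eq_zero] at h1
  rw [Matrix.map_apply, Matrix.map_apply, iterate_dmat_apply, iterate_dmat_apply, h1]

lemma divg_iterate (A : Matrix (Fin n) (Fin n) (SmoothFn (ambientDomain W ε))) (k : ℕ) (i : Fin n) :
    divg (baseD W ε) (chr (baseD W ε) gm gmi) ((dmat (radialD W ε))^[k] A) i
      = (radialD W ε)^[k] (divg (baseD W ε) (chr (baseD W ε) gm gmi) A i) := by
  induction k with
  | zero => rfl
  | succ k ih =>
    rw [Function.iterate_succ_apply', Function.iterate_succ_apply', ← ih]
    exact F.family.divg_deriv _ i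

lemma divergence_taylorCoeff (hε : 0 < ε) (hh : ∀ ρ x, h ρ x = G ρ x - g x) {m : ℕ} {i : Fin n}
    (hS : divg (baseD W ε) (chr (baseD W ε) gm gmi) S i
      ∈ vanIdeal (radialD W ε) (zeroIdeal W ε) (m + 1)) {y : Fin n → ℝ} (hy : y ∈ W) :
    divergence (comp e g) (taylorCoeff h m e) i y = 0 := by
  have hz := F.base_mem hε one_pos hy
  have hw := F.family.walker
  have hsymm : (gm * (dmat (radialD W ε))^[m] S)ᵀ = gm * (dmat (radialD W ε))^[m] S := by
    rw [← iterate_dmat_mul F.D_r_g, ← iterate_dmat_transpose, F.family.symm]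
  have h1 := (isSlice_ambientPoint (n := n) 1 0).divergence_eq
    (fun w hw => (F.map_ev 1 w 0 hw).symm) hw.symm hw.mul_inv hw.inv_mul
    (fun w hw => F.taylorCoeff_eq hh m hw) hsymm hz i
  rw [h1, ← mul_assoc, hw.inv_mul, one_mul]
  exact (congrArg _ (F.divg_iterate S m i)).trans (mem_vanIdeal_iff.1 hS m (Nat.lt_succ_self m) 1 y hz)

/-- The leading coefficient of the ambient Ricci tensor as an iterated derivative. -/
lemma leadingRicci_eq {t : ℝ} {y : Fin n → ℝ}
    (hz : ambientPoint t y 0 ∈ ambientDomain W ε) :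
    leadingRicci e G t y = (((n / 2 - 1).factorial : ℝ)⁻¹ •
      (dmat (radialD W ε))^[n / 2 - 1] (ambBlock (partialD (Ω := ambientDomain W ε))
      (coordFn W ε (Sum.inl ())) ti (coordFn W ε (Sum.inr (Sum.inr ()))) gm₁ gmi₁
      (chr (baseD W ε) gm₁ gmi₁))).map (ev ⟨_, hz⟩) := by
  ext i j
  rw [Matrix.map_apply, Matrix.smul_apply, map_smul, smul_eq_mul, iterate_dmat_apply]
  refine congrArg (_ * ·) (iteratedDeriv_eq_ev (fun ρ hz' => ?_) _ 0 hz)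
  rw [F.ambientRicci_eq hz']
  rfl

lemma obstruction_image (hε : 0 < ε) (c : ℝ) {m : ℕ} (hn : n = 2 * (m + 2))
    (hRic : ∀ a b, ambRic (partialD (Ω := ambientDomain W ε))
      (coordFn W ε (Sum.inl ())) ti (coordFn W ε (Sum.inr (Sum.inr ()))) gm₁ gmi₁
      (chr (baseD W ε) gm₁ gmi₁) a b ∈ vanIdeal (radialD W ε) (zeroIdeal W ε) (m + 1))
    {y : Fin n → ℝ} (hy : y ∈ W) (v : Fin n → ℝ) :
    coordVec e y (((comp e g y)⁻¹ * obstruction c G e y) *ᵥ v) ∈ N (point e y) := by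
  have hz := F.base_mem hε one_pos hy
  have hn' : n / 2 - 1 = m + 1 := by omega
  have h1 := F.family.obstruction_mem (by simp; omega) (by simpa using hn) hRic
  set B := ambBlock (partialD (Ω := ambientDomain W ε))
      (coordFn W ε (Sum.inl ())) ti (coordFn W ε (Sum.inr (Sum.inr ()))) gm₁ gmi₁
      (chr (baseD W ε) gm₁ gmi₁) with hB
  have hd : dmat (radialD W ε) ((1 - E) * gmi) = 0 := by
    rw [dmat_mul, F.family.D_r_gi, dmat_sub, F.D_r_E, dmat_one]; simp
  have h2 : ((1 - E) * gmi * (dmat (radialD W ε))^[m + 1] B).map (ev ⟨_, hz⟩) = 0 := by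
    rw [← iterate_dmat_mul hd]
    ext i j
    rw [Matrix.map_apply, iterate_dmat_apply]
    exact mem_vanIdeal_iff.1 (h1 i j) (m + 1) (Nat.lt_succ_self _) 1 y hz
  have h3 : (E * (gmi * (dmat (radialD W ε))^[m + 1] B)).map (ev ⟨_, hz⟩)
      = (gmi * (dmat (radialD W ε))^[m + 1] B).map (ev ⟨_, hz⟩) := by
    have h4 : (1 - E) * gmi * (dmat (radialD W ε))^[m + 1] B
      = gmi * (dmat (radialD W ε))^[m + 1] B - E * (gmi * (dmat (radialD W ε))^[m + 1] B) := by
      rw [sub_mul, sub_mul, one_mul, mul_assoc E]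
    rw [h4, matrix_map_sub, sub_eq_zero] at h2
    exact h2.symm
  have h5 : (comp e g y)⁻¹ * obstruction c G e y = (c * ((n / 2 - 1).factorial : ℝ)⁻¹) •
      (gmi * (dmat (radialD W ε))^[m + 1] B).map (ev ⟨_, hz⟩) := by
    rw [obstruction, F.leadingRicci_eq hz, hn', ← F.map_ev_inv hz, Matrix.map_mul,
      Matrix.mul_smul, mul_smul]
    congr 1
    rw [← Matrix.mul_smul]
    congr 1
  rw [h5, ← F.mem_iff 1 y 0 hz, mulVec_mulVec, Matrix.mul_smul, ← Matrix.map_mul, h3]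

end IsFamilyModel

end FamilyModel

/-! ### Solutions of the Fefferman-Graham equations -/

section Solutions

open TopologicalSpace

variable {n : ℕ} {M : Type*} [TopologicalSpace M] [ChartedSpace (EuclideanSpace ℝ (Fin n)) M]
  [IsManifold (𝓡 n) ∞ M] {g : TensorField n M} {N : SubspaceField n M} {p : ℕ} {ε : ℝ}
  {G h : ℝ → TensorField n M}

/-- If the Fefferman-Graham equations hold to order `k`, below the critical order, then the Taylor
coefficients of order at most `k` have image in `N` and are divergence-free. -/
theorem taylorCoeff_of_ricciDerivVanishes (hn : 2 < n) (hg : IsNullRicciWalker g N p)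
    (hε : 0 < ε) (hG : IsMetricFamily g ε G) (hh : ∀ ρ x, h ρ x = G ρ x - g x) {k : ℕ}
    (hk : ∀ j < k, n ≠ 2 * (j + 1)) (hRic : ∀ j < k, RicciDerivVanishes G j) :
    ImageIn g N (taylorCoeff h k) ∧ DivergenceFree g (taylorCoeff h k) := by
  have key : ∀ e ∈ atlas (EuclideanSpace ℝ (Fin n)) M, ∀ y ∈ domain e,
      (∀ v, coordVec e y (((comp e g y)⁻¹ * taylorCoeff h k e y) *ᵥ v) ∈ N (point e y)) ∧
        ∀ i, divergence (comp e g) (taylorCoeff h k e) i y = 0 := by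
    intro e he y hy
    obtain ⟨W, hyW, hsub, hW⟩ := exists_isBaseModel hn hg he hy
    obtain ⟨gm, gmi, E, hB⟩ := hW ε
    obtain ⟨ti, S, gm₁, gmi₁, F⟩ := hB.exists_isFamilyModel he hsub hG
    have h1 := (F.ambRic_mem_iff hε k).2 fun j hj t ht y hy a b =>
      hRic j hj e he t ht y (hsub hy) a b
    obtain ⟨h2, h3⟩ := F.family.null_of_ric (by simpa using hn.le) (fun j hj hj' => by
      rw [Fintype.card_fin] at hj'
      refine hk j hj ?_
      have : (n : ℝ) = ((2 * (j + 1) : ℕ) : ℝ) := by push_cast; linarith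
      exact_mod_cast this) h1
    exact ⟨F.taylorCoeff_image hε hh h2 hyW, fun i => F.divergence_taylorCoeff hε hh (h3 i) hyW⟩
  exact ⟨fun e he y hy => (key e he y hy).1, fun e he y hy => (key e he y hy).2⟩

/-- The obstruction tensor has image in `N`. -/
theorem imageIn_obstruction (hn : 2 < n) (hg : IsNullRicciWalker g N p) (hε : 0 < ε)
    (hG : IsMetricFamily g ε G) (heven : Even n)
    (hRic : ∀ k < n / 2 - 1, RicciDerivVanishes G k) (c : ℝ) :
    ImageIn g N (obstruction c G) := by
  intro e he y hy
  obtain ⟨W, hyW, hsub, hW⟩ := exists_isBaseModel hn hg he hy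
  obtain ⟨gm, gmi, E, hB⟩ := hW ε
  obtain ⟨ti, S, gm₁, gmi₁, F⟩ := hB.exists_isFamilyModel he hsub hG
  obtain ⟨m, hm⟩ : ∃ m, n = 2 * (m + 2) := by
    obtain ⟨q, hq⟩ := heven
    exact ⟨q - 2, by omega⟩
  refine F.obstruction_image hε c hm ?_ hyW
  exact (F.ambRic_mem_iff hε (m + 1)).2 fun j hj t ht y hy a b =>
    hRic j (by omega) e he t ht y (hsub hy) a b

end Solutions

/-! ### Covariance of the Ricci tensor -/

section Covariance

variable {ι R R' : Type*} [Fintype ι] [DecidableEq ι] [CommRing R] [Algebra ℝ R]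
  [CommRing R'] [Algebra ℝ R']

/-- The ring homomorphism `φ` is the pull-back along a coordinate change `ψ`, with Jacobian matrix
`J` inverse to `Ji`, under which the metric `g'` is pulled back to `g`. -/
structure IsCoordChange (D : ι → Derivation ℝ R R) (D' : ι → Derivation ℝ R' R') (φ : R' →ₐ[ℝ] R)
    (ψ : ι → R) (J Ji : Matrix ι ι R) (g : Matrix ι ι R) (g' : Matrix ι ι R') : Prop where
  comm : ∀ i j a, D i (D j a) = D j (D i a)
  chain : ∀ k f, D k (φ f) = ∑ l, J l k * φ (D' l f)
  jac : ∀ a k, J a k = D k (ψ a)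
  mul_inv : J * Ji = 1
  inv_mul : Ji * J = 1
  metric : g = Jᵀ * g'.map φ * J

namespace IsCoordChange

variable {D : ι → Derivation ℝ R R} {D' : ι → Derivation ℝ R' R'} {φ : R' →ₐ[ℝ] R}
  {ψ : ι → R} {J Ji : Matrix ι ι R} {g : Matrix ι ι R} {g' : Matrix ι ι R'}
  {Γ' : ι → Matrix ι ι R'}

/-- The pull-back of the connection form. -/
def pullConn (φ : R' →ₐ[ℝ] R) (J : Matrix ι ι R) (Γ' : ι → Matrix ι ι R') (k : ι) :
    Matrix ι ι R := ∑ l, J l k • (Γ' l).map φ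

/-- The connection in the new coordinate frame: the gauge transform of the pull-back. -/
def gaugeConn (D : ι → Derivation ℝ R R) (φ : R' →ₐ[ℝ] R) (J Ji : Matrix ι ι R)
    (Γ' : ι → Matrix ι ι R') (k : ι) : Matrix ι ι R :=
  Ji * (pullConn φ J Γ' k * J + dmat (D k) J)

variable (C : IsCoordChange D D' φ ψ J Ji g g')
include C

lemma mul_gaugeConn (k : ι) : J * gaugeConn D φ J Ji Γ' k = pullConn φ J Γ' k * J + dmat (D k) J := by
  rw [gaugeConn, ← mul_assoc, C.mul_inv, one_mul]

lemma dmat_map_eq (k : ι) (A : Matrix ι ι R') :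
    dmat (D k) (A.map φ) = ∑ l, J l k • (dmat (D' l) A).map φ := by
  ext i j
  rw [Matrix.sum_apply]
  exact C.chain k _

/-- The Jacobian matrix is a matrix of mixed derivatives. -/
lemma closed (k l a : ι) : D k (J a l) = D l (J a k) := by
  rw [C.jac, C.jac, C.comm]

lemma isLeviCivita_gaugeConn (h : IsLeviCivita D' g' Γ') :
    IsLeviCivita D g (gaugeConn D φ J Ji Γ') := by
  constructor
  · intro k i j
    have h1 : ∀ a, (pullConn φ J Γ' k * J + dmat (D k) J) a j
        = (pullConn φ J Γ' j * J + dmat (D j) J) a k := by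
      intro a
      simp only [Matrix.add_apply, dmat_apply, C.closed k j a, mul_apply, pullConn,
        Matrix.sum_apply, Matrix.smul_apply, Matrix.map_apply, smul_eq_mul, Finset.sum_mul]
      rw [Finset.sum_comm]
      congr 1
      refine Finset.sum_congr rfl fun b _ => Finset.sum_congr rfl fun l _ => ?_
      rw [h.symm b a l]
      ring
    rw [gaugeConn, gaugeConn, mul_apply, mul_apply]
    exact Finset.sum_congr rfl fun a _ => by rw [h1]
  · intro k
    set A := pullConn φ J Γ' k with hA
    have h1 : dmat (D k) (g'.map φ) = Aᵀ * g'.map φ + g'.map φ * A := by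
      rw [C.dmat_map_eq, hA, pullConn, transpose_sum, Finset.sum_mul, Finset.mul_sum,
        ← Finset.sum_add_distrib]
      refine Finset.sum_congr rfl fun l _ => ?_
      rw [h.compat l, matrix_map_add, Matrix.map_mul, Matrix.map_mul, smul_add, transpose_smul,
        Matrix.smul_mul, Matrix.mul_smul, transpose_map]
    have h2 : g * gaugeConn D φ J Ji Γ' k = Jᵀ * g'.map φ * (A * J + dmat (D k) J) := by
      rw [C.metric, mul_assoc, C.mul_gaugeConn]
    have h3 : (gaugeConn D φ J Ji Γ' k)ᵀ * g = (A * J + dmat (D k) J)ᵀ * (g'.map φ * J) := by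
      rw [C.metric, mul_assoc Jᵀ, ← mul_assoc _ Jᵀ, ← transpose_mul, C.mul_gaugeConn]
    rw [h2, h3, C.metric, dmat_mul, dmat_mul, h1, transpose_add, transpose_mul, dmat_transpose]
    noncomm_ring

/-- The curvature is a two-form with values in endomorphisms. -/
lemma mul_curv_gaugeConn (k l : ι) : J * curv D (gaugeConn D φ J Ji Γ') k l
    = (∑ a, ∑ b, (J a k * J b l) • (curv D' Γ' a b).map φ) * J := by
  set A := pullConn φ J Γ' with hA
  -- the derivative of the pulled back connection form
  have hd : ∀ k l, dmat (D k) (A l) = (∑ b, D k (J b l) • (Γ' b).map φ)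
      + ∑ a, ∑ b, (J a k * J b l) • (dmat (D' a) (Γ' b)).map φ := by
    intro k l
    have h1 : dmat (D k) (A l) = ∑ b, (D k (J b l) • (Γ' b).map φ
        + J b l • dmat (D k) ((Γ' b).map φ)) := by
      ext i j
      simp only [hA, pullConn, dmat_apply, Matrix.sum_apply, map_sum, Matrix.smul_apply,
        Matrix.add_apply, smul_eq_mul, Derivation.leibniz]
      exact Finset.sum_congr rfl fun b _ => by ring
    rw [h1, Finset.sum_add_distrib, Finset.sum_comm (γ := ι)]
    congr 1
    refine Finset.sum_congr rfl fun b _ => ?_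
    rw [C.dmat_map_eq, Finset.smul_sum]
    exact Finset.sum_congr rfl fun a _ => by rw [smul_smul, mul_comm]
  have hp : ∀ k l, A k * A l
      = ∑ a, ∑ b, (J a k * J b l) • ((Γ' a).map φ * (Γ' b).map φ) := by
    intro k l
    rw [hA, pullConn, pullConn, Finset.sum_mul_sum]
    refine Finset.sum_congr rfl fun a _ => Finset.sum_congr rfl fun b _ => ?_
    rw [smul_mul_smul_comm]
  have hF : dmat (D k) (A l) - dmat (D l) (A k) + A k * A l - A l * A k
      = ∑ a, ∑ b, (J a k * J b l) • (curv D' Γ' a b).map φ := by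
    have hc : ∑ b, D k (J b l) • (Γ' b).map φ = ∑ b, D l (J b k) • (Γ' b).map φ :=
      Finset.sum_congr rfl fun b _ => by rw [C.closed]
    have hs : ∀ X : ι → ι → Matrix ι ι R, ∑ a, ∑ b, (J a l * J b k) • X a b
        = ∑ a, ∑ b, (J a k * J b l) • X b a := by
      intro X
      rw [Finset.sum_comm]
      exact Finset.sum_congr rfl fun a _ => Finset.sum_congr rfl fun b _ => by rw [mul_comm]
    rw [hd, hd, hp, hp, hc, hs, hs]
    simp only [curv, matrix_map_add, matrix_map_sub, Matrix.map_mul, smul_add, smul_sub,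
      Finset.sum_add_distrib, Finset.sum_sub_distrib]
    abel
  -- the gauge transformation of the curvature
  have hJ : ∀ k l, dmat (D k) J * gaugeConn D φ J Ji Γ' l + J * dmat (D k) (gaugeConn D φ J Ji Γ' l)
      = dmat (D k) (A l) * J + A l * dmat (D k) J + dmat (D k) (dmat (D l) J) := by
    intro k l
    rw [← dmat_mul, C.mul_gaugeConn, dmat_add, dmat_mul]
  have hcomm : dmat (D k) (dmat (D l) J) = dmat (D l) (dmat (D k) J) := by
    ext i j; exact C.comm k l _
  have hdJ : ∀ k, dmat (D k) J = J * gaugeConn D φ J Ji Γ' k - A k * J := fun k => by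
    rw [C.mul_gaugeConn, add_sub_cancel_left]
  rw [← hF]
  have e1 := hJ k l
  have e2 := hJ l k
  rw [← hcomm] at e2
  have e3 : J * dmat (D k) (gaugeConn D φ J Ji Γ' l) - J * dmat (D l) (gaugeConn D φ J Ji Γ' k)
      = dmat (D k) (A l) * J + A l * dmat (D k) J - dmat (D k) J * gaugeConn D φ J Ji Γ' l
        - (dmat (D l) (A k) * J + A k * dmat (D l) J - dmat (D l) J * gaugeConn D φ J Ji Γ' k) := by
    rw [← eq_sub_iff_add_eq'] at e1 e2
    rw [e1, e2]
    abel
  rw [hdJ k, hdJ l] at e3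
  have e4 : J * curv D (gaugeConn D φ J Ji Γ') k l
      = (J * dmat (D k) (gaugeConn D φ J Ji Γ' l) - J * dmat (D l) (gaugeConn D φ J Ji Γ' k))
        + J * gaugeConn D φ J Ji Γ' k * gaugeConn D φ J Ji Γ' l
        - J * gaugeConn D φ J Ji Γ' l * gaugeConn D φ J Ji Γ' k := by
    rw [curv]; noncomm_ring
  rw [e4, e3]
  noncomm_ring

lemma ric_gaugeConn : ric D (gaugeConn D φ J Ji Γ') = Jᵀ * (ric D' Γ').map φ * J := by
  have hF : ∀ k j, curv D (gaugeConn D φ J Ji Γ') k j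
      = Ji * ((∑ a, ∑ b, (J a k * J b j) • (curv D' Γ' a b).map φ) * J) := by
    intro k j
    rw [← C.mul_curv_gaugeConn, ← mul_assoc, C.inv_mul, one_mul]
  have hdelta : ∀ a c, ∑ k, J a k * Ji k c = if a = c then 1 else 0 := by
    intro a c
    rw [← mul_apply, C.mul_inv, one_apply]
  ext i j
  have h1 : ric D (gaugeConn D φ J Ji Γ') i j
      = ∑ a, ∑ b, ∑ c, (∑ k, J a k * Ji k c) * (J b j * ((curv D' Γ' a b).map φ * J) c i) := by
    simp only [ric, of_apply, hF, Finset.sum_mul]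
    simp only [Matrix.mul_sum, Matrix.smul_mul, Matrix.mul_smul, Matrix.sum_apply,
      Matrix.smul_apply, smul_eq_mul]
    rw [Finset.sum_comm]
    refine Finset.sum_congr rfl fun a _ => ?_
    rw [Finset.sum_comm]
    refine Finset.sum_congr rfl fun b _ => ?_
    rw [Finset.sum_comm]
    refine Finset.sum_congr rfl fun k _ => ?_
    rw [mul_apply, Finset.mul_sum]
    exact Finset.sum_congr rfl fun c _ => by ring
  rw [h1]
  simp only [hdelta, ite_mul, one_mul, zero_mul, Finset.sum_ite_eq, Finset.mem_univ, if_true]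
  have h2 : ∀ a b, ((curv D' Γ' a b).map φ * J) a i = ∑ d, φ (curv D' Γ' a b a d) * J d i :=
    fun a b => rfl
  simp only [h2]
  simp only [mul_apply, transpose_apply, Matrix.map_apply, ric, of_apply, map_sum, Finset.mul_sum,
    Finset.sum_mul]
  rw [Finset.sum_comm]
  refine Finset.sum_congr rfl fun b _ => ?_
  rw [Finset.sum_comm]
  refine Finset.sum_congr rfl fun d _ => Finset.sum_congr rfl fun a _ => by ring

end IsCoordChange

end Covariance

/-! ### The Ricci tensor in different charts -/

section CovarianceCharts

open TopologicalSpace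

variable {κ : Type*} [Fintype κ] [DecidableEq κ] {Ω Ω' : Opens (κ → ℝ)}

/-- The pull-back of smooth functions along a smooth map. -/
def pullback (ψ : (κ → ℝ) → (κ → ℝ)) (hψ : ContDiffOn ℝ ∞ ψ Ω) (hm : ∀ z ∈ Ω, ψ z ∈ Ω') :
    SmoothFn Ω' →ₐ[ℝ] SmoothFn Ω where
  toFun f := SmoothFn.of (fun z => extendZero f (ψ z))
    ((contDiffOn_extendZero f).comp hψ fun z hz => hm z hz)
  map_one' := Subtype.ext (funext fun z => extendZero_apply _ (hm z z.2))
  map_zero' := Subtype.ext (funext fun z => extendZero_apply _ (hm z z.2))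
  map_mul' f f' := Subtype.ext (funext fun z => by
    change extendZero _ _ = extendZero _ _ * extendZero _ _
    rw [extendZero_apply _ (hm z z.2), extendZero_apply _ (hm z z.2),
      extendZero_apply _ (hm z z.2)]
    rfl)
  map_add' f f' := Subtype.ext (funext fun z => by
    change extendZero _ _ = extendZero _ _ + extendZero _ _
    rw [extendZero_apply _ (hm z z.2), extendZero_apply _ (hm z z.2),
      extendZero_apply _ (hm z z.2)]
    rfl)
  commutes' c := Subtype.ext (funext fun z => extendZero_apply _ (hm z z.2))

variable {ψ : (κ → ℝ) → (κ → ℝ)} (hψ : ContDiffOn ℝ ∞ ψ Ω) (hm : ∀ z ∈ Ω, ψ z ∈ Ω')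

lemma ev_pullback (z : Ω) (f : SmoothFn Ω') :
    ev z (pullback ψ hψ hm f) = ev ⟨ψ z, hm z z.2⟩ f := extendZero_apply _ (hm z z.2)

/-- The components of a smooth map as smooth functions. -/
def mapCoord (l : κ) : SmoothFn Ω := SmoothFn.of (fun z => ψ z l) (contDiffOn_pi.1 hψ l)

lemma ev_partialD_mapCoord (z : Ω) (k l : κ) :
    ev z (partialD k (mapCoord hψ l)) = pderiv k (fun z => ψ z l) z :=
  (isSlice_id.pderiv_eq (F := fun z => ψ z l) (f := mapCoord hψ l) (fun _ _ => rfl) z.2 k).symm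

/-- The chain rule. -/
lemma partialD_pullback (k : κ) (f : SmoothFn Ω') : partialD k (pullback ψ hψ hm f)
    = ∑ l, partialD k (mapCoord hψ l) * pullback ψ hψ hm (partialD l f) := by
  refine SmoothFn.ext_ev fun z => ?_
  have hd : DifferentiableAt ℝ ψ z :=
    (hψ.contDiffAt (Ω.2.mem_nhds z.2)).differentiableAt (by simp)
  have h1 := isSlice_id.pderiv_eq (F := fun z => extendZero f (ψ z)) (f := pullback ψ hψ hm f)
    (fun _ _ => rfl) z.2 k
  refine h1.symm.trans ?_
  have hdf := differentiableAt_extendZero f (hm z z.2)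
  have h2 : fderiv ℝ (fun z => extendZero f (ψ z)) z
      = (fderiv ℝ (extendZero f) (ψ z)).comp (fderiv ℝ ψ z) := fderiv_comp _ hdf hd
  change fderiv ℝ (fun z => extendZero f (ψ z)) z (Pi.single k 1) = _
  rw [h2, ContinuousLinearMap.comp_apply]
  have h3 : fderiv ℝ ψ z (Pi.single k 1)
      = ∑ l, pderiv k (fun z => ψ z l) z • Pi.single l (1 : ℝ) := by
    ext j
    have : fderiv ℝ (fun z => ψ z j) z (Pi.single k 1) = fderiv ℝ ψ z (Pi.single k 1) j := by
      rw [fderiv_apply hd]; rfl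
    rw [← this]
    simp [Finset.sum_apply, Pi.single_apply, pderiv]
  rw [h3, map_sum, map_sum]
  refine Finset.sum_congr rfl fun l _ => ?_
  rw [map_smul, map_mul, ev_partialD_mapCoord, ev_pullback]
  rfl

variable {n : ℕ} {M : Type*} [TopologicalSpace M] [ChartedSpace (EuclideanSpace ℝ (Fin n)) M]
  [IsManifold (𝓡 n) ∞ M]

lemma det_jacobian_ne_zero {e e' : Chart n M} (he : e ∈ atlas (EuclideanSpace ℝ (Fin n)) M)
    (he' : e' ∈ atlas (EuclideanSpace ℝ (Fin n)) M) {y : Fin n → ℝ} (hy : y ∈ overlap e e') :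
    (jacobian e e' y).det ≠ 0 := by
  have := isManifold_one n M
  intro hd
  obtain ⟨v, hv0, hv⟩ := Matrix.exists_mulVec_eq_zero_iff.2 hd
  have h1 := mfderiv_coordVec he he' hy v
  rw [hv] at h1
  refine hv0 ((coordVec_bijective he hy.1).1 ?_)
  refine ((mdifferentiable_of_mem_atlas (I := 𝓡 n) he').mfderiv_bijective hy.2).1 ?_
  refine h1.trans ?_
  rw [← coordMap_apply, map_zero, map_zero]
  rfl

/-- The Ricci tensor of a metric is a tensor. -/
theorem isTensorial_ricci {T : TensorField n M} (hT : IsPseudoRiemannian T) :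
    IsTensorial n M (fun e => ricci (comp e T)) := by
  intro e he e' he' y hy
  have hψ := contDiffOn_transition he he'
  have hm : ∀ z ∈ overlap e e', transition e e' z ∈ overlap e' e := fun z hz =>
    transition_mem_overlap hz
  set φ := pullback (transition e e') hψ hm with hφ
  have hsmooth : ∀ (e e' : Chart n M), e ∈ atlas (EuclideanSpace ℝ (Fin n)) M → ∀ i j,
      ContDiffOn ℝ ∞ (fun y => comp e T y i j) (overlap e e') := fun e e' he i j =>
    (hT.smooth e he i j).mono fun y hy => hy.1
  -- the components of the metric in both charts
  have hrep : ∀ (e e' : Chart n M), e ∈ atlas (EuclideanSpace ℝ (Fin n)) M →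
      ∃ g gi : Matrix (Fin n) (Fin n) (SmoothFn (overlap e e')),
      (∀ z (hz : z ∈ overlap e e'), comp e T z = g.map (ev ⟨z, hz⟩)) ∧ gᵀ = g ∧ g * gi = 1 ∧
        gi * g = 1 := by
    intro e e' he
    set g : Matrix (Fin n) (Fin n) (SmoothFn (overlap e e')) :=
      Matrix.of fun i j => SmoothFn.of (fun y => comp e T y i j) (hsmooth e e' he i j) with hg
    have hev : ∀ z (hz : z ∈ overlap e e'), comp e T z = g.map (ev ⟨z, hz⟩) := fun _ _ => rfl
    obtain ⟨gi, h1, h2⟩ := exists_inverse (A := g) (by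
      rintro ⟨z, hz⟩
      rw [← hev z hz]
      exact det_comp_ne_zero he hz.1 (hT.nondegenerate _))
    refine ⟨g, gi, hev, ?_, h1, h2⟩
    ext1 i j
    refine SmoothFn.ext_ev fun z => ?_
    exact hT.symm _ _ _
  obtain ⟨g, gi, hev, hgt, hgi, hgi'⟩ := hrep e e' he
  obtain ⟨g', gi', hev', hgt', hgi₁, hgi₁'⟩ := hrep e' e he'
  set J : Matrix (Fin n) (Fin n) (SmoothFn (overlap e e')) :=
    Matrix.of fun a k => partialD k (mapCoord hψ a) with hJ
  have hJev : ∀ z (hz : z ∈ overlap e e'), J.map (ev ⟨z, hz⟩) = jacobian e e' z := by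
    intro z hz
    ext a k
    exact ev_partialD_mapCoord hψ ⟨z, hz⟩ k a
  obtain ⟨Ji, hJi, hJi'⟩ := exists_inverse (A := J) (by
    rintro ⟨z, hz⟩
    rw [hJev z hz]
    exact det_jacobian_ne_zero he he' hz)
  have hmapφ : ∀ (A : Matrix (Fin n) (Fin n) (SmoothFn (overlap e' e))) z
      (hz : z ∈ overlap e e'),
      (A.map φ).map (ev ⟨z, hz⟩) = A.map (ev ⟨transition e e' z, hm z hz⟩) := by
    intro A z hz
    ext i j
    exact ev_pullback hψ hm ⟨z, hz⟩ (A i j)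
  have C : IsCoordChange (partialD (Ω := overlap e e')) (partialD (Ω := overlap e' e)) φ
      (mapCoord hψ) J Ji g g' := by
    refine ⟨partialD_comm, fun k f => partialD_pullback hψ hm k f, fun a k => rfl, hJi, hJi', ?_⟩
    ext1 i j
    refine SmoothFn.ext_ev fun z => ?_
    have h1 : g.map (ev z) = (Jᵀ * g'.map φ * J).map (ev z) := by
      rw [Matrix.map_mul, Matrix.map_mul, transpose_map, hJev z z.2, hmapφ _ z z.2, ← hev z z.2,
        ← hev' _ (hm z z.2)]
      exact comp_transition he he' z.2 T
    exact congrFun (congrFun h1 i) j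
  have h1 := isSlice_id.ricci_eq (fun z hz => hev z hz) hgt hgi hy
  have h2 := isSlice_id.ricci_eq (fun z hz => hev' z hz) hgt' hgi₁ (hm y hy)
  have h3 := C.isLeviCivita_gaugeConn (isLeviCivita_chr (partialD (Ω := overlap e' e)) hgt' hgi₁)
  have h4 := (isLeviCivita_chr (partialD (Ω := overlap e e')) hgt hgi).unique hgt hgi' h3
  change ricci (comp e T) y = _ at h1
  change ricci (comp e' T) (transition e e' y) = _ at h2
  change ricci (comp e T) y
    = (jacobian e e' y)ᵀ * ricci (comp e' T) (transition e e' y) * jacobian e e' y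
  rw [h1, h2]
  change Matrix.map (ric (partialD (Ω := overlap e e')) (chr (partialD (Ω := overlap e e')) g gi))
    _ = _
  rw [h4, C.ric_gaugeConn, Matrix.map_mul, Matrix.map_mul, transpose_map]
  have h5 := hJev y hy
  have h6 := hmapφ (ric (partialD (Ω := overlap e' e)) (chr (partialD (Ω := overlap e' e)) g' gi'))
    y hy
  rw [← h5]
  exact congrArg (fun X => (J.map (ev ⟨y, hy⟩))ᵀ * X * J.map (ev ⟨y, hy⟩)) h6

end CovarianceCharts

/-! ### Raising the order of an approximate solution -/

section RaiseOrder

variable {ι R : Type*} [Fintype ι] [DecidableEq ι] [CommRing R] [Algebra ℝ R]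

/-- The Ricci tensor depends on the metric modulo a differential ideal only. -/
lemma ric_matCong {D : ι → Derivation ℝ R R} {I : Ideal R} (hI : ∀ i, ∀ a ∈ I, D i a ∈ I)
    {g g' gi : Matrix ι ι R} {Γ Γ' : ι → Matrix ι ι R} (hg : gᵀ = g) (hgi : gi * g = 1)
    (h : IsLeviCivita D g Γ) (h' : IsLeviCivita D g' Γ') (hgg : MatCong I g' g) :
    MatCong I (ric D Γ') (ric D Γ) := by
  have hφ : ∀ i a, quotD I (D i) (hI i) (Ideal.Quotient.mkₐ ℝ I a)
    = Ideal.Quotient.mkₐ ℝ I (D i a) := fun _ _ => rfl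
  have hm := h.map hφ
  have hm' := h'.map hφ
  rw [matCong_iff.1 hgg] at hm'
  have hu := hm'.unique (gi := gi.map (Ideal.Quotient.mkₐ ℝ I))
    (by rw [← transpose_map, hg]) (by rw [← Matrix.map_mul, hgi, matrix_map_one]) hm
  rw [matCong_iff, ← ric_map hφ, ← ric_map hφ, hu]

variable {δ : Derivation ℝ R R} {r : R}

lemma derivation_pow_succ_mul (hδ : δ r = 1) {a : R} (ha : δ a = 0) (k : ℕ) :
    δ (r ^ (k + 1) * a) = ((k : ℝ) + 1) • (r ^ k * a) := by
  rw [Derivation.leibniz, ha, smul_zero, zero_add, Derivation.leibniz_pow, hδ, Nat.add_sub_cancel,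
    smul_eq_mul, smul_eq_mul, mul_one, nsmul_eq_mul, Algebra.smul_def, map_add, map_natCast, map_one]
  push_cast
  ring

lemma iterate_pow_mul (hδ : δ r = 1) {a : R} (ha : δ a = 0) (k : ℕ) :
    δ^[k] (r ^ k * a) = (k.factorial : ℝ) • a := by
  induction k with
  | zero => simp
  | succ k ih =>
    rw [Function.iterate_succ_apply, derivation_pow_succ_mul hδ ha]
    have h1 : δ^[k] (((k : ℝ) + 1) • (r ^ k * a)) = ((k : ℝ) + 1) • δ^[k] (r ^ k * a) :=
      Function.Commute.iterate_left (fun b => δ.map_smul _ b) k _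
    rw [h1, ih, smul_smul, Nat.factorial_succ]
    push_cast
    rfl

lemma pow_mul_mem_vanIdeal {Z : Ideal R} (hr : r ∈ Z) (hδ : δ r = 1) (k : ℕ) (a : R) :
    r ^ k * a ∈ vanIdeal δ Z k := by
  induction k with
  | zero => exact mem_vanIdeal_zero
  | succ k ih =>
    rw [pow_succ', mul_assoc]
    exact mul_mem_vanIdeal_succ hr hδ ih

/-- At `r = 0` the derivative of order `k` of `(r δ - c) f` is `k - c` times that of `f`. -/
lemma iterate_indicial (hδ : δ r = 1) (c : ℝ) (k : ℕ) (f : R) :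
    δ^[k] (r * δ f - c • f) = r * δ^[k + 1] f - (c - k) • δ^[k] f := by
  induction k generalizing f c with
  | zero => simp
  | succ k ih =>
    rw [Function.iterate_succ_apply, derivation_indicial hδ, ih, Function.iterate_succ_apply,
      Function.iterate_succ_apply, Function.iterate_succ_apply]
    push_cast
    congr 2
    ring

namespace IsFGFamily

variable {D : Unit ⊕ ι ⊕ Unit → Derivation ℝ R R} {t ti ti' r : R} {g gi : Matrix ι ι R}
  {Γ : ι → Matrix ι ι R} {E S S' g₁ gi₁ g₂ gi₂ : Matrix ι ι R} {Γ₁ Γ₂ : ι → Matrix ι ι R}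
  {Z : Ideal R}

/-- Adding to the family of metrics a term of order `k + 1`, determined by the derivative of order
`k` of the Ricci tensor, raises the order to which the Fefferman-Graham equations hold. -/
lemma ambBlock_mem_succ (F₁ : IsFGFamily D t ti r g gi Γ E S g₁ gi₁ Γ₁ Z)
    (F₂ : IsFGFamily D t ti' r g gi Γ E S' g₂ gi₂ Γ₂ Z) (hS : E * S = S) (hS' : E * S' = S')
    {k : ℕ} {C : Matrix ι ι R} (hC : dmat (D (Sum.inr (Sum.inr ()))) C = 0)
    (h₂ : g₂ = g₁ + r ^ (k + 1) • C)
    (hRic : ∀ i j, (k.factorial * (((k : ℝ) + 1) * (k - ((Fintype.card ι : ℝ) / 2 - 1)))) • C i j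
      + (D (Sum.inr (Sum.inr ())))^[k] (ric (fun i => D (Sum.inr (Sum.inl i))) Γ₁ i j) ∈ Z)
    (hg₁ : ∀ i j, (D (Sum.inr (Sum.inr ())))^[k + 1] (g₁ i j) ∈ Z)
    (hB : MatIn (vanIdeal (D (Sum.inr (Sum.inr ()))) Z k) (ambBlock D t ti r g₁ gi₁ Γ₁)) :
    MatIn (vanIdeal (D (Sum.inr (Sum.inr ()))) Z (k + 1)) (ambBlock D t ti' r g₂ gi₂ Γ₂) := by
  set δ := D (Sum.inr (Sum.inr ())) with hδdef
  have hδ : δ r = 1 := F₁.amb.D_r_r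
  have hr := F₁.r_mem
  have hCa : ∀ i j, δ (C i j) = 0 := fun i j => congrFun (congrFun hC i) j
  have hcong : MatCong (vanIdeal δ Z (k + 1)) g₂ g₁ := by
    intro i j
    rw [h₂, Matrix.add_apply, add_sub_cancel_left]
    exact pow_mul_mem_vanIdeal hr hδ _ _
  have hq := ric_matCong (F₁.stable_van (k + 1)) F₁.amb.symm F₁.amb.inv_mul F₁.amb.lc F₂.amb.lc
    hcong
  intro i j
  set c : ℝ := (Fintype.card ι : ℝ) / 2 - 1 with hc
  -- the transport part of the equation, applied to the new term
  have hnew : r * δ (δ (r ^ (k + 1) * C i j)) - c • δ (r ^ (k + 1) * C i j)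
      = (((k : ℝ) + 1) * (k - c)) • (r ^ k * C i j) := by
    rw [derivation_pow_succ_mul hδ (hCa i j), Derivation.map_smul]
    have h1 : r * δ (r ^ k * C i j) = (k : ℝ) • (r ^ k * C i j) := by
      cases k with
      | zero => simp [hCa i j]
      | succ k =>
        rw [derivation_pow_succ_mul hδ (hCa i j), mul_smul_comm]
        push_cast
        congr 1
        ring
    rw [mul_smul_comm, h1, smul_smul, smul_smul, ← sub_smul]
    congr 1
    ring
  have hB₂ : ambBlock D t ti' r g₂ gi₂ Γ₂ i j = ambBlock D t ti r g₁ gi₁ Γ₁ i j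
      + (((k : ℝ) + 1) * (k - c)) • (r ^ k * C i j)
      + (ric (fun i => D (Sum.inr (Sum.inl i))) Γ₂ i j
        - ric (fun i => D (Sum.inr (Sum.inl i))) Γ₁ i j) := by
    rw [F₂.ambBlock_eq_of_null hS', F₁.ambBlock_eq_of_null hS, ← hnew, h₂]
    simp only [Matrix.add_apply, Matrix.sub_apply, Matrix.smul_apply, dmat_apply, smul_eq_mul,
      map_add, smul_add]
    ring
  rw [hB₂]
  refine add_mem ?_ (hq i j)
  rw [mem_vanIdeal_iff]
  intro l hl
  rcases Nat.lt_succ_iff_lt_or_eq.1 hl with hl | rfl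
  · exact mem_vanIdeal_iff.1 (add_mem (hB i j) (smul_mem_ideal _
      (pow_mul_mem_vanIdeal hr hδ k _))) l hl
  · have h1 : ambBlock D t ti r g₁ gi₁ Γ₁ i j = (r * δ (δ (g₁ i j)) - c • δ (g₁ i j))
        + ric (fun i => D (Sum.inr (Sum.inl i))) Γ₁ i j := by
      rw [F₁.ambBlock_eq_of_null hS]
      rfl
    have hadd : ∀ a b, δ^[l] (a + b) = δ^[l] a + δ^[l] b := fun a b => iterate_map_add δ l a b
    have hsmul : ∀ (s : ℝ) a, δ^[l] (s • a) = s • δ^[l] a := fun s a =>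
      Function.Commute.iterate_left (fun b => δ.map_smul s b) l a
    rw [h1, hadd, hadd, hsmul, iterate_indicial hδ, iterate_pow_mul hδ (hCa i j), smul_smul]
    have h2 := hRic i j
    have h3 := hg₁ i j
    rw [Function.iterate_succ_apply] at h3
    have h4 := add_mem (sub_mem (Ideal.mul_mem_right (δ^[l + 1] (δ (g₁ i j))) _ hr)
      (smul_mem_ideal (c - l) h3)) h2
    convert h4 using 1
    rw [mul_comm (l.factorial : ℝ)]
    ring

end IsFGFamily

end RaiseOrder

/-! ### Families of null perturbations -/

section NullTensors

open TopologicalSpace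

variable {n : ℕ} {M : Type*} [TopologicalSpace M] [ChartedSpace (EuclideanSpace ℝ (Fin n)) M]
  {g : TensorField n M} {N : SubspaceField n M} {p : ℕ}

lemma comp_add (e : Chart n M) (T T' : TensorField n M) (y : Fin n → ℝ) :
    comp e (T + T') y = comp e T y + comp e T' y := rfl

lemma comp_smul (e : Chart n M) (a : ℝ) (T : TensorField n M) (y : Fin n → ℝ) :
    comp e (a • T) y = a • comp e T y := rfl

lemma comp_zero (e : Chart n M) (y : Fin n → ℝ) : comp e (0 : TensorField n M) y = 0 := rfl

/-- A smooth symmetric divergence-free tensor with image in `N`. -/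
structure IsNullTensor (g : TensorField n M) (N : SubspaceField n M) (T : TensorField n M) :
    Prop where
  symm : ∀ x v w, T x v w = T x w v
  smooth : ∀ e ∈ atlas (EuclideanSpace ℝ (Fin n)) M, ∀ i j,
    ContDiffOn ℝ ∞ (fun y => comp e T y i j) (domain e)
  image : ImageIn g N (fun e => comp e T)
  divFree : DivergenceFree g (fun e => comp e T)

lemma divergence_add_smul {ι : Type*} [Fintype ι] [DecidableEq ι]
    {G T T' : (ι → ℝ) → Matrix ι ι ℝ} {y : ι → ℝ} (a : ℝ)
    (hT : ∀ i j, DifferentiableAt ℝ (fun z => T z i j) y)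
    (hT' : ∀ i j, DifferentiableAt ℝ (fun z => T' z i j) y) (i : ι) :
    divergence G (fun z => T z + a • T' z) i y = divergence G T i y + a * divergence G T' i y := by
  have hp : ∀ k i j, pderiv k (fun z => (T z + a • T' z) i j) y
      = pderiv k (fun z => T z i j) y + a * pderiv k (fun z => T' z i j) y := by
    intro k i j
    have h1 : HasFDerivAt (fun z => (T z + a • T' z) i j) (fderiv ℝ (fun z => T z i j) y
        + a • fderiv ℝ (fun z => T' z i j) y) y :=
      (hT i j).hasFDerivAt.add ((hT' i j).hasFDerivAt.const_smul a)
    rw [pderiv, h1.fderiv]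
    rfl
  simp only [divergence, covDerivTensor, hp, Finset.mul_sum, ← Finset.sum_add_distrib]
  refine Finset.sum_congr rfl fun k _ => Finset.sum_congr rfl fun l _ => ?_
  have h2 : ∑ m, (christoffel G m k i y * (T y + a • T' y) m l
        + christoffel G m k l y * (T y + a • T' y) i m)
      = ∑ m, (christoffel G m k i y * T y m l + christoffel G m k l y * T y i m)
        + a * ∑ m, (christoffel G m k i y * T' y m l + christoffel G m k l y * T' y i m) := by
    rw [Finset.mul_sum, ← Finset.sum_add_distrib]
    refine Finset.sum_congr rfl fun m _ => ?_
    simp only [Matrix.add_apply, Matrix.smul_apply, smul_eq_mul]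
    ring
  rw [h2]
  ring

lemma isNullTensor_zero : IsNullTensor g N 0 where
  symm _ _ _ := rfl
  smooth e _ i j := contDiffOn_const (c := (0 : ℝ))
  image e _ y _ v := by
    change coordVec e y (((comp e g y)⁻¹ * comp e 0 y) *ᵥ v) ∈ N (point e y)
    rw [comp_zero, mul_zero, zero_mulVec, ← coordMap_apply, map_zero]
    exact zero_mem _
  divFree e _ y _ i := by
    simp only [divergence, covDerivTensor, comp_zero, Matrix.zero_apply, mul_zero, add_zero,
      Finset.sum_const_zero, sub_zero, pderiv_const]

lemma IsNullTensor.add_smul {T T' : TensorField n M} (h : IsNullTensor g N T)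
    (h' : IsNullTensor g N T') (a : ℝ) : IsNullTensor g N (T + a • T') where
  symm x v w := by
    change T x v w + a * T' x v w = T x w v + a * T' x w v
    rw [h.symm, h'.symm]
  smooth e he i j := (h.smooth e he i j).add ((h'.smooth e he i j).const_smul a)
  image e he y hy v := by
    change coordVec e y (((comp e g y)⁻¹ * comp e (T + a • T') y) *ᵥ v) ∈ N (point e y)
    rw [comp_add, comp_smul, mul_add, Matrix.mul_smul, add_mulVec, smul_mulVec, ← coordMap_apply,
      map_add, map_smul]
    exact add_mem (h.image e he y hy v) (Submodule.smul_mem _ _ (h'.image e he y hy v))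
  divFree e he y hy i := by
    have hd : ∀ {T : TensorField n M}, IsNullTensor g N T → ∀ i j,
        DifferentiableAt ℝ (fun z => comp e T z i j) y := fun hT i j =>
      ((hT.smooth e he i j).contDiffAt ((isOpen_domain e).mem_nhds hy)).differentiableAt (by simp)
    refine (divergence_add_smul a (hd h) (hd h') i).trans ?_
    rw [h.divFree e he y hy i, h'.divFree e he y hy i, mul_zero, add_zero]

/-- A smooth family of null perturbations `H ρ` with `H 0 = 0`. -/
structure IsNullFamily (g : TensorField n M) (N : SubspaceField n M) (H : ℝ → TensorField n M) :
    Prop where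
  initial : H 0 = 0
  null : ∀ ρ, IsNullTensor g N (H ρ)
  smooth : ∀ e ∈ atlas (EuclideanSpace ℝ (Fin n)) M, ∀ i j,
    ContDiffOn ℝ ∞ (fun q : ℝ × (Fin n → ℝ) => comp e (H q.1) q.2 i j) (Set.univ ×ˢ domain e)

lemma isNullFamily_zero : IsNullFamily g N 0 where
  initial := rfl
  null _ := isNullTensor_zero
  smooth _ _ _ _ := contDiffOn_const (c := (0 : ℝ))

lemma IsNullFamily.add_pow_smul {H : ℝ → TensorField n M} (hH : IsNullFamily g N H)
    {c : TensorField n M} (hc : IsNullTensor g N c) (k : ℕ) :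
    IsNullFamily g N (fun ρ => H ρ + ρ ^ (k + 1) • c) where
  initial := by simp [hH.initial]
  null ρ := (hH.null ρ).add_smul hc _
  smooth e he i j := by
    refine (hH.smooth e he i j).add (ContDiffOn.smul (f := fun q : ℝ × (Fin n → ℝ) => q.1 ^ (k + 1))
      (by fun_prop) ?_)
    exact (hc.smooth e he i j).comp contDiffOn_snd fun _ hq => hq.2

variable [IsManifold (𝓡 n) ∞ M]

lemma exists_coords (x : M) : ∃ e ∈ atlas (EuclideanSpace ℝ (Fin n)) M, ∃ y ∈ domain e,
    point e y = x :=
  ⟨chartAt _ x, chart_mem_atlas _ x, WithLp.ofLp (chartAt (EuclideanSpace ℝ (Fin n)) x x),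
    (chartAt _ x).map_source (mem_chart_source _ x), (chartAt _ x).left_inv (mem_chart_source _ x)⟩

/-- The endomorphism associated with a null tensor. -/
lemma IsNullTensor.exists_dual (hg : IsPseudoRiemannian g) {T : TensorField n M}
    (h : IsNullTensor g N T) (x : M) (v : TangentSpace (𝓡 n) x) :
    ∃ u ∈ N x, ∀ w, T x v w = g x u w := by
  obtain ⟨e, he, y, hy, rfl⟩ := exists_coords (n := n) x
  obtain ⟨v, rfl⟩ := (coordVec_bijective he hy).2 v
  refine ⟨_, h.image e he y hy v, fun w => ?_⟩
  obtain ⟨w, rfl⟩ := (coordVec_bijective he hy).2 w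
  have hdet := (det_comp_ne_zero he hy (hg.nondegenerate _)).isUnit
  have hgt : (comp e g y)ᵀ = comp e g y := comp_transpose e fun v w => hg.symm _ v w
  have hTt : (comp e T y)ᵀ = comp e T y := comp_transpose e fun v w => h.symm _ v w
  have hinv := inv_symm_of_symm hgt (Matrix.mul_nonsing_inv _ hdet)
  rw [apply_coordVec, apply_coordVec, dotProduct_mulVec, dotProduct_mulVec, ← vecMul_transpose,
    vecMul_vecMul, transpose_mul, hinv, hTt, mul_assoc, Matrix.nonsing_inv_mul _ hdet, mul_one]

/-- A null perturbation of a metric is nondegenerate. -/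
lemma IsNullTensor.nondegenerate_add (hg : IsNullRicciWalker g N p) {T : TensorField n M}
    (h : IsNullTensor g N T) (x : M) (v : TangentSpace (𝓡 n) x)
    (hv : ∀ w, (g + T) x v w = 0) : v = 0 := by
  have hv' : ∀ w, g x v w + T x v w = 0 := hv
  obtain ⟨u, hu, hT⟩ := h.exists_dual hg.metric x v
  have h1 : v + u = 0 := hg.metric.nondegenerate x _ fun w => by
    rw [map_add, LinearMap.add_apply, ← hT, hv']
  have hvN : v ∈ N x := by
    rw [eq_neg_of_add_eq_zero_left h1]
    exact neg_mem hu
  refine hg.metric.nondegenerate x v fun w => ?_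
  obtain ⟨u', hu', hT'⟩ := h.exists_dual hg.metric x w
  have h2 := hv' w
  rwa [h.symm, hT', hg.null x u' hu' v hvN, add_zero] at h2

lemma IsNullFamily.isMetricFamily (hg : IsNullRicciWalker g N p) {H : ℝ → TensorField n M}
    (hH : IsNullFamily g N H) (ε : ℝ) : IsMetricFamily g ε (fun ρ => g + H ρ) where
  initial := by rw [hH.initial, add_zero]
  symm ρ _ x v w := by
    change g x v w + H ρ x v w = g x w v + H ρ x w v
    rw [hg.metric.symm, (hH.null ρ).symm]
  nondegenerate ρ _ x v hv := (hH.null ρ).nondegenerate_add hg x v hv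
  smooth e he i j := by
    refine ContDiffOn.add ?_ ((hH.smooth e he i j).mono (Set.prod_mono (Set.subset_univ _) le_rfl))
    exact (hg.metric.smooth e he i j).comp contDiffOn_snd fun _ hq => hq.2

lemma IsMetricFamily.isPseudoRiemannian {G : ℝ → TensorField n M} {ε : ℝ}
    (hG : IsMetricFamily g ε G) {ρ : ℝ} (hρ : ρ ∈ Set.Ioo (-ε) ε) : IsPseudoRiemannian (G ρ) where
  symm := hG.symm ρ hρ
  nondegenerate := hG.nondegenerate ρ hρ
  smooth e he i j := (hG.smooth e he i j).comp (contDiffOn_const.prodMk contDiffOn_id)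
    fun _ hy => ⟨hρ, hy⟩

section Model

variable {H : ℝ → TensorField n M} {e : Chart n M}
  {W : Opens (Fin n → ℝ)} {ε : ℝ} {ti : SmoothFn (ambientDomain W ε)}
  {gm gmi E S gm₁ gmi₁ : Matrix (Fin n) (Fin n) (SmoothFn (ambientDomain W ε))}
  (F : IsFamilyModel g N (fun ρ => g + H ρ) e ti gm gmi E S gm₁ gmi₁)
include F

lemma IsFamilyModel.map_ev_perturb {t : ℝ} {y : Fin n → ℝ} {ρ : ℝ}
    (hz : ambientPoint t y ρ ∈ ambientDomain W ε) : (gm * S).map (ev ⟨_, hz⟩) = comp e (H ρ) y := by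
  have h2 : gm * S = gm₁ - gm := by rw [F.family.eq, add_sub_cancel_left]
  rw [h2, matrix_map_sub, F.map_ev_family t y ρ hz, F.map_ev t y ρ hz, comp_add,
    add_sub_cancel_left]

lemma IsFamilyModel.eq_inv_mul : S = gmi * (gm * S) := by
  rw [← mul_assoc, F.family.walker.inv_mul, one_mul]

lemma IsFamilyModel.image_perturb (hH : IsNullFamily g N H)
    (he : e ∈ atlas (EuclideanSpace ℝ (Fin n)) M) (hsub : (W : Set (Fin n → ℝ)) ⊆ domain e) :
    E * S = S := by
  rw [F.eq_inv_mul]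
  refine ambientDomain_matrix_ext fun t y ρ hz => ?_
  rw [Matrix.map_mul, Matrix.map_mul, F.map_ev_perturb hz, F.map_ev_inv hz]
  ext i j
  have h1 := (hH.null ρ).image e he y (hsub hz.2.1) (Pi.single j 1)
  rw [← F.mem_iff t y ρ hz, mulVec_mulVec, mulVec_single_one, mulVec_single_one] at h1
  exact congrFun h1 i

lemma IsFamilyModel.divg_perturb (hH : IsNullFamily g N H)
    (he : e ∈ atlas (EuclideanSpace ℝ (Fin n)) M) (hsub : (W : Set (Fin n → ℝ)) ⊆ domain e)
    (i : Fin n) : divg (baseD W ε) (chr (baseD W ε) gm gmi) S i = 0 := by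
  have hw := F.family.walker
  rw [F.eq_inv_mul]
  refine ambientDomain_ext fun t y ρ hz => ?_
  have h1 := (isSlice_ambientPoint (n := n) t ρ).divergence_eq
    (fun w hw => (F.map_ev t w ρ hw).symm) hw.symm hw.mul_inv hw.inv_mul
    (fun w hw => (F.map_ev_perturb hw).symm) F.family.symm hz i
  rw [map_zero]
  exact h1.symm.trans ((hH.null ρ).divFree e he y (hsub hz.2.1) i)

end Model

end NullTensors

/-! ### Construction of the ambient metric -/

section Construction

open TopologicalSpace

variable {n : ℕ} {M : Type*} [TopologicalSpace M] [ChartedSpace (EuclideanSpace ℝ (Fin n)) M]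
  {g : TensorField n M} {N : SubspaceField n M} {p : ℕ}

lemma divg_smul {ι R : Type*} [Fintype ι] [DecidableEq ι] [CommRing R] [Algebra ℝ R]
    (D : ι → Derivation ℝ R R) (Γ : ι → Matrix ι ι R) (a : ℝ) (A : Matrix ι ι R) (i : ι) :
    divg D Γ (a • A) i = a • divg D Γ A i := by
  have h : ∀ k, cov D Γ k (a • A) = a • cov D Γ k A := by
    intro k
    have hd : dmat (D k) (a • A) = a • dmat (D k) A := by
      ext i j; exact (D k).map_smul a _
    rw [cov, cov, hd, Matrix.mul_smul, Matrix.smul_mul, ← smul_add, ← smul_sub]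
  simp only [divg, h, Matrix.smul_apply, Finset.smul_sum]

lemma contDiffAt_of_eq_ev {W : Opens (Fin n → ℝ)} {ε : ℝ} {F : ℝ → ℝ}
    {f : SmoothFn (ambientDomain W ε)} {t : ℝ} {y : Fin n → ℝ}
    (h : ∀ ρ (hz : ambientPoint t y ρ ∈ ambientDomain W ε), F ρ = ev ⟨_, hz⟩ f) {ρ : ℝ}
    (hz : ambientPoint t y ρ ∈ ambientDomain W ε) : ContDiffAt ℝ ∞ F ρ := by
  have h1 : F =ᶠ[nhds ρ] extendZero f ∘ fun ρ => ambientPoint t y ρ := by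
    filter_upwards [isOpen_Ioo.mem_nhds (ambientPoint_mem.1 hz).2.2] with σ hσ
    have hz' : ambientPoint t y σ ∈ ambientDomain W ε :=
      ⟨(ambientPoint_mem.1 hz).1, (ambientPoint_mem.1 hz).2.1, hσ⟩
    rw [h σ hz', Function.comp, extendZero_apply f hz', ev_apply]
  refine ContDiffAt.congr_of_eventuallyEq ?_ h1
  have h2 : ContDiff ℝ ∞ (fun ρ => ambientPoint t y ρ) := by
    rw [contDiff_pi]
    rintro (_ | i | _)
    · exact contDiff_const
    · exact contDiff_const
    · exact contDiff_id
  exact ((contDiffOn_extendZero f).contDiffAt ((ambientDomain W ε).2.mem_nhds hz)).comp ρ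
    h2.contDiffAt

lemma IsFamilyModel.ricci_eq {G : ℝ → TensorField n M} {e : Chart n M} {W : Opens (Fin n → ℝ)}
    {ε : ℝ} {ti : SmoothFn (ambientDomain W ε)}
    {gm gmi E S gm₁ gmi₁ : Matrix (Fin n) (Fin n) (SmoothFn (ambientDomain W ε))}
    (F : IsFamilyModel g N G e ti gm gmi E S gm₁ gmi₁) (i j : Fin n) {t : ℝ} {y : Fin n → ℝ} (ρ : ℝ)
    (hz : ambientPoint t y ρ ∈ ambientDomain W ε) : ricci (comp e (G ρ)) y i j
      = ev ⟨_, hz⟩ (ric (baseD W ε) (chr (baseD W ε) gm₁ gmi₁) i j) := by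
  rw [(isSlice_ambientPoint (n := n) t ρ).ricci_eq
    (fun w hw => (F.map_ev_family t w ρ hw).symm) F.family.amb.symm F.family.amb.mul_inv hz]
  rfl

variable [IsManifold (𝓡 n) ∞ M]

lemma exists_model (hn : 2 < n) (hg : IsNullRicciWalker g N p) {H : ℝ → TensorField n M}
    (hH : IsNullFamily g N H) {e : Chart n M} (he : e ∈ atlas (EuclideanSpace ℝ (Fin n)) M)
    {y : Fin n → ℝ} (hy : y ∈ domain e) :
    ∃ W : Opens (Fin n → ℝ), y ∈ W ∧ (W : Set (Fin n → ℝ)) ⊆ domain e ∧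
      ∃ (ti : SmoothFn (ambientDomain W 1)) (gm gmi E S gm₁ gmi₁ : Matrix (Fin n) (Fin n) _),
        IsFamilyModel g N (fun ρ => g + H ρ) e ti gm gmi E S gm₁ gmi₁ := by
  obtain ⟨W, hyW, hsub, hW⟩ := exists_isBaseModel hn hg he hy
  obtain ⟨gm, gmi, E, hB⟩ := hW 1
  obtain ⟨ti, S, gm₁, gmi₁, F⟩ := hB.exists_isFamilyModel he hsub (hH.isMetricFamily hg 1)
  exact ⟨W, hyW, hsub, ti, gm, gmi, E, S, gm₁, gmi₁, F⟩

/-- The derivatives along `ρ = 0` of the Ricci tensors of a family of metrics are tensors. -/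
lemma isTensorial_iteratedDeriv_ricci (hn : 2 < n) (hg : IsNullRicciWalker g N p)
    {H : ℝ → TensorField n M} (hH : IsNullFamily g N H) (k : ℕ) (a : ℝ) :
    IsTensorial n M (fun e y => Matrix.of fun i j =>
      a * iteratedDeriv k (fun ρ => ricci (comp e (g + H ρ)) y i j) 0) := by
  intro e he e' he' y hy
  have hps : ∀ ρ, IsPseudoRiemannian (g + H ρ) := fun ρ =>
    (hH.isMetricFamily hg (|ρ| + 1)).isPseudoRiemannian
      (by constructor <;> [linarith [neg_abs_le ρ]; linarith [le_abs_self ρ]])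
  have hy' := transition_mem_domain hy
  obtain ⟨W, hyW, hsub, ti, gm, gmi, E, S, gm₁, gmi₁, F⟩ := exists_model hn hg hH he' hy'
  have hz := F.base_mem one_pos one_pos hyW
  have hsm : ∀ i j, ContDiffAt ℝ ∞
      (fun ρ => ricci (comp e' (g + H ρ)) (transition e e' y) i j) 0 := fun i j =>
    contDiffAt_of_eq_ev (fun ρ hz => F.ricci_eq i j ρ hz) hz
  have hk : ((k : ℕ∞) : WithTop ℕ∞) ≤ ∞ := by exact_mod_cast le_top
  set J := jacobian e e' y with hJ
  ext i j
  have h1 : (fun ρ => ricci (comp e (g + H ρ)) y i j) = fun ρ => ∑ b, ∑ c,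
      J b i * J c j * ricci (comp e' (g + H ρ)) (transition e e' y) b c := by
    funext ρ
    have h2 := congrFun (congrFun (isTensorial_ricci (hps ρ) e he e' he' y hy) i) j
    refine h2.trans ?_
    simp only [mul_apply, transpose_apply, Finset.sum_mul]
    rw [Finset.sum_comm]
    exact Finset.sum_congr rfl fun b _ => Finset.sum_congr rfl fun c _ => by ring
  have h3 : iteratedDeriv k (fun ρ => ricci (comp e (g + H ρ)) y i j) 0 = ∑ b, ∑ c, J b i * J c j
      * iteratedDeriv k (fun ρ => ricci (comp e' (g + H ρ)) (transition e e' y) b c) 0 := by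
    rw [h1, iteratedDeriv_fun_sum fun b _ => ContDiffAt.sum fun c _ =>
      contDiffAt_const.mul ((hsm b c).of_le hk)]
    refine Finset.sum_congr rfl fun b _ => ?_
    rw [iteratedDeriv_fun_sum fun c _ => contDiffAt_const.mul ((hsm b c).of_le hk)]
    exact Finset.sum_congr rfl fun c _ => iteratedDeriv_const_mul_field _ _
  change a * iteratedDeriv k (fun ρ => ricci (comp e (g + H ρ)) y i j) 0 = _
  rw [h3]
  simp only [mul_apply, transpose_apply, of_apply, Finset.sum_mul, Finset.mul_sum]
  rw [Finset.sum_comm]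
  exact Finset.sum_congr rfl fun b _ => Finset.sum_congr rfl fun c _ => by ring

/-- The derivatives along `ρ = 0` of the Ricci tensors of a family of null perturbations are null
tensors. -/
lemma exists_coefficient (hn : 2 < n) (hg : IsNullRicciWalker g N p)
    {H : ℝ → TensorField n M} (hH : IsNullFamily g N H) (k : ℕ) (a : ℝ) :
    ∃ c : TensorField n M, IsNullTensor g N c ∧
      ∀ e ∈ atlas (EuclideanSpace ℝ (Fin n)) M, ∀ y ∈ domain e, ∀ i j, comp e c y i j
        = a * iteratedDeriv k (fun ρ => ricci (comp e (g + H ρ)) y i j) 0 := by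
  obtain ⟨c, hc⟩ := (isTensorial_iteratedDeriv_ricci hn hg hH k a).exists_comp
  have hcij : ∀ e ∈ atlas (EuclideanSpace ℝ (Fin n)) M, ∀ y ∈ domain e, ∀ i j, comp e c y i j
        = a * iteratedDeriv k (fun ρ => ricci (comp e (g + H ρ)) y i j) 0 :=
    fun e he y hy i j => congrFun (congrFun (hc e he y hy) i) j
  -- the coefficient in terms of the ring of smooth functions
  have key : ∀ e ∈ atlas (EuclideanSpace ℝ (Fin n)) M, ∀ y ∈ domain e,
      ∃ W : Opens (Fin n → ℝ), y ∈ W ∧ (W : Set (Fin n → ℝ)) ⊆ domain e ∧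
      ∃ gm gmi E A : Matrix (Fin n) (Fin n) (SmoothFn (ambientDomain W 1)),
        IsBaseModel g N e gm gmi E ∧ Aᵀ = A ∧ E * (gmi * A) = gmi * A ∧
        (∀ i, divg (baseD W 1) (chr (baseD W 1) gm gmi) (gmi * A) i = 0) ∧
        ∀ w (hz : ambientPoint 1 w 0 ∈ ambientDomain W 1), comp e c w = A.map (ev ⟨_, hz⟩) := by
    intro e he y hy
    obtain ⟨W, hyW, hsub, ti, gm, gmi, E, S, gm₁, gmi₁, F⟩ := exists_model hn hg hH he hy
    have hS := F.image_perturb hH he hsub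
    have hdiv := F.divg_perturb hH he hsub
    set Rc := ric (baseD W 1) (chr (baseD W 1) gm₁ gmi₁) with hRc
    set B := (dmat (radialD W 1))^[k] Rc with hB
    have hn := F.family.ric_nullEnd hS hdiv
    have hBi : gmi * B = (dmat (radialD W 1))^[k] (gmi * Rc) :=
      (iterate_dmat_mul F.family.D_r_gi k).symm
    have hRt : Rcᵀ = Rc := ric_symm F.family.amb.symm F.family.amb.inv_mul F.family.amb.mul_inv
      F.family.walker.comm F.family.amb.lc
    have hdB : ∀ i, divg (baseD W 1) (chr (baseD W 1) gm gmi) (gmi * B) i = 0 := by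
      intro i
      rw [hBi]
      refine (F.divg_iterate _ k i).trans ?_
      have h0 : divg (baseD W 1) (chr (baseD W 1) gm gmi) (gmi * Rc) i = 0 :=
        F.family.divg_ric hS hdiv i
      rw [h0]
      exact Function.iterate_fixed (map_zero _) k
    refine ⟨W, hyW, hsub, gm, gmi, E, algebraMap ℝ (SmoothFn (ambientDomain W 1)) a • B,
      F.toIsBaseModel, ?_, ?_, ?_, ?_⟩
    · rw [transpose_smul, hB, ← iterate_dmat_transpose, hRt]
    · rw [Matrix.mul_smul, Matrix.mul_smul, hBi, ← iterate_dmat_mul F.D_r_E]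
      exact congrArg (fun X => _ • (dmat (radialD W 1))^[k] X) hn.image
    · intro i
      rw [Matrix.mul_smul, algebraMap_smul, divg_smul, hdB, smul_zero]
    · intro w hz
      ext i j
      rw [hcij e he w (hsub hz.2.1), Matrix.map_apply, Matrix.smul_apply, smul_eq_mul, map_mul,
        AlgHom.commutes, hB, iterate_dmat_apply]
      exact congrArg (a * ·) (iteratedDeriv_eq_ev (fun ρ hz => F.ricci_eq i j ρ hz) k 0 hz)
  refine ⟨c, ⟨fun x v w => ?_, fun e he i j => ?_, fun e he y hy v => ?_, fun e he y hy i => ?_⟩,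
    hcij⟩
  · obtain ⟨e, he, y, hy, rfl⟩ := exists_coords (n := n) x
    obtain ⟨v, rfl⟩ := (coordVec_bijective he hy).2 v
    obtain ⟨w, rfl⟩ := (coordVec_bijective he hy).2 w
    obtain ⟨W, hyW, hsub, gm, gmi, E, A, hB, hA, -, -, hcA⟩ := key e he y hy
    have hz : ambientPoint 1 y 0 ∈ ambientDomain W 1 := ⟨one_pos, hyW, by simp [ambientPoint]⟩
    have hct : (comp e c y)ᵀ = comp e c y := by rw [hcA y hz, ← transpose_map, hA]
    rw [apply_coordVec, apply_coordVec, dotProduct_mulVec, ← mulVec_transpose, hct, dotProduct_comm]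
  · intro y hy
    obtain ⟨W, hyW, hsub, gm, gmi, E, A, hB, hA, -, -, hcA⟩ := key e he y hy
    refine ContDiffAt.contDiffWithinAt ?_
    have hρ : (0 : ℝ) ∈ Set.Ioo (-1 : ℝ) 1 := by simp
    refine ((contDiffOn_slice (A i j) one_pos hρ).contDiffAt
      (W.2.mem_nhds hyW)).congr_of_eventuallyEq ?_
    filter_upwards [W.2.mem_nhds hyW] with w hw
    have hz : ambientPoint 1 w 0 ∈ ambientDomain W 1 := ⟨one_pos, hw, hρ⟩
    rw [hcA w hz, extendZero_apply _ hz]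
    rfl
  · obtain ⟨W, hyW, hsub, gm, gmi, E, A, hB, hA, hE, -, hcA⟩ := key e he y hy
    have hz : ambientPoint 1 y 0 ∈ ambientDomain W 1 := ⟨one_pos, hyW, by simp [ambientPoint]⟩
    change coordVec e y (((comp e g y)⁻¹ * comp e c y) *ᵥ v) ∈ N (point e y)
    rw [hcA y hz, ← hB.map_ev 1 y 0 hz, inv_eq_map_ev hB.walker.mul_inv, ← Matrix.map_mul,
      ← hB.mem_iff 1 y 0 hz, mulVec_mulVec, ← Matrix.map_mul, hE]
  · obtain ⟨W, hyW, hsub, gm, gmi, E, A, hB, hA, -, hd, hcA⟩ := key e he y hy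
    have hz : ambientPoint 1 y 0 ∈ ambientDomain W 1 := ⟨one_pos, hyW, by simp [ambientPoint]⟩
    have h1 := (isSlice_ambientPoint (n := n) 1 0).divergence_eq
      (fun w hw => (hB.map_ev 1 w 0 hw).symm) hB.walker.symm hB.walker.mul_inv hB.walker.inv_mul
      (fun w hw => hcA w hw) hA hz i
    refine h1.trans ?_
    exact (congrArg _ (hd i)).trans (map_zero _)

end Construction

/-! ### Solving the equations order by order -/

section Recursion

open TopologicalSpace

variable {n : ℕ} {M : Type*} [TopologicalSpace M] [ChartedSpace (EuclideanSpace ℝ (Fin n)) M]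
  {g : TensorField n M} {N : SubspaceField n M} {p : ℕ}

/-- A family of null perturbations, polynomial of degree at most `k` in `ρ` as far as the
derivatives along `ρ = 0` are concerned, for which the Fefferman-Graham equations hold to
order `k`. -/
structure IsApproxSolution (g : TensorField n M) (N : SubspaceField n M) (k : ℕ)
    (H : ℝ → TensorField n M) : Prop extends IsNullFamily g N H where
  taylor : ∀ e ∈ atlas (EuclideanSpace ℝ (Fin n)) M, ∀ y ∈ domain e, ∀ i j, ∀ m > k,
    iteratedDeriv m (fun ρ => comp e (H ρ) y i j) 0 = 0
  ricci : ∀ j < k, RicciDerivVanishes (fun ρ => g + H ρ) j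

lemma isApproxSolution_zero : IsApproxSolution g N 0 0 where
  toIsNullFamily := isNullFamily_zero
  taylor e _ y _ i j m hm := by
    change iteratedDeriv m (fun _ => (0 : ℝ)) 0 = 0
    rw [iteratedDeriv_const]
    split_ifs <;> rfl
  ricci j hj := absurd hj (Nat.not_lt_zero j)

lemma IsNullFamily.contDiffAt {H : ℝ → TensorField n M} (hH : IsNullFamily g N H) {e : Chart n M}
    (he : e ∈ atlas (EuclideanSpace ℝ (Fin n)) M) {y : Fin n → ℝ} (hy : y ∈ domain e) (i j : Fin n)
    (ρ : ℝ) : ContDiffAt ℝ ∞ (fun ρ => comp e (H ρ) y i j) ρ := by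
  have h1 := (hH.smooth e he i j).contDiffAt (x := (ρ, y))
    ((isOpen_univ.prod (isOpen_domain e)).mem_nhds ⟨trivial, hy⟩)
  exact h1.comp ρ (contDiffAt_id.prodMk contDiffAt_const)

variable [IsManifold (𝓡 n) ∞ M]

/-- Away from the critical order, approximate solutions can be improved. -/
lemma IsApproxSolution.exists_succ (hn : 2 < n) (hg : IsNullRicciWalker g N p) {k : ℕ}
    {H : ℝ → TensorField n M} (hH : IsApproxSolution g N k H) (hk : (n : ℝ) / 2 - 1 ≠ k) :
    ∃ H', IsApproxSolution g N (k + 1) H' := by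
  -- `ρ^(k+1) c` contributes `(k+1) (k - (n/2 - 1)) ρ^k c` to the equations, and the derivative of
  -- order `k` brings the factor `k!`
  set b : ℝ := k.factorial * (((k : ℝ) + 1) * (k - ((n : ℝ) / 2 - 1))) with hb
  have hb0 : b ≠ 0 := mul_ne_zero (by exact_mod_cast k.factorial_ne_zero)
    (mul_ne_zero (by positivity) (sub_ne_zero.2 hk.symm))
  obtain ⟨c, hc, hcR⟩ := exists_coefficient hn hg hH.toIsNullFamily k (-b⁻¹)
  have hk' : ∀ m : ℕ, ((m : ℕ∞) : WithTop ℕ∞) ≤ ∞ := fun m => by exact_mod_cast le_top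
  have hH' := hH.toIsNullFamily.add_pow_smul hc k
  refine ⟨fun ρ => H ρ + ρ ^ (k + 1) • c, hH', ?_, ?_⟩
  · intro e he y hy i j m hm
    have h1 : (fun ρ => comp e (H ρ + ρ ^ (k + 1) • c) y i j)
        = fun ρ => comp e (H ρ) y i j + ρ ^ (k + 1) * comp e c y i j := rfl
    rw [h1, iteratedDeriv_fun_add ((hH.contDiffAt he hy i j 0).of_le (hk' m)) (by fun_prop),
      hH.taylor e he y hy i j m (by omega), iteratedDeriv_mul_const_field,
      iteratedDeriv_fun_pow_zero, if_neg (by omega), Nat.cast_zero, zero_mul, add_zero]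
  · intro j hj e he t ht y hy a a'
    obtain ⟨W, hyW, hsub, hW⟩ := exists_isBaseModel hn hg he hy
    obtain ⟨gm, gmi, E, hB⟩ := hW 1
    obtain ⟨ti, S, gm₁, gmi₁, F₁⟩ := hB.exists_isFamilyModel he hsub
      (hH.toIsNullFamily.isMetricFamily hg 1)
    obtain ⟨ti', S', gm₂, gmi₂, F₂⟩ := hB.exists_isFamilyModel he hsub (hH'.isMetricFamily hg 1)
    have hS := F₁.image_perturb hH.toIsNullFamily he hsub
    have hS' := F₂.image_perturb hH' he hsub
    have hC : ∀ i j, ContDiffOn ℝ ∞ (fun q : ℝ × (Fin n → ℝ) => comp e c q.2 i j)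
        (Set.Ioo (-1) 1 ×ˢ W) := fun i j =>
      ((hc.smooth e he i j).mono hsub).comp contDiffOn_snd fun _ hq => hq.2
    set C : Matrix (Fin n) (Fin n) (SmoothFn (ambientDomain W 1)) :=
      liftMat (fun _ y => comp e c y) hC with hCdef
    have hCr : dmat (radialD W 1) C = 0 := by
      ext1 i j
      exact partialD_r_eq_zero (fun _ y => comp e c y i j) fun t y ρ hz => rfl
    have h₂ : gm₂ = gm₁ + coordFn W 1 (Sum.inr (Sum.inr ())) ^ (k + 1) • C := by
      refine ambientDomain_matrix_ext fun t y ρ hz => ?_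
      rw [matrix_map_add, F₂.map_ev_family t y ρ hz, F₁.map_ev_family t y ρ hz, ← add_assoc]
      ext i j
      rw [Matrix.add_apply, Matrix.map_apply, Matrix.smul_apply, smul_eq_mul, map_mul, map_pow]
      rfl
    have hIH := (F₁.ambRic_mem_iff one_pos k).2 fun j hj t ht y hy a b =>
      hH.ricci j hj e he t ht y (hsub hy) a b
    have hblock := F₁.family.ambBlock_mem_succ F₂.family hS hS' (k := k) hCr h₂
      (fun i j t y hz => by
        have hRic := iteratedDeriv_eq_ev (fun ρ hz => F₁.ricci_eq i j ρ hz) k 0 hz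
        rw [map_add, map_smul, smul_eq_mul, Fintype.card_fin, ← hb]
        have h1 : ev ⟨_, hz⟩ (C i j) = comp e c y i j := rfl
        have h2 := hcR e he y (hsub hz.2.1) i j
        rw [hRic] at h2
        rw [h1, h2, ← mul_assoc, mul_neg, mul_inv_cancel₀ hb0, neg_one_mul]
        exact neg_add_cancel _)
      (fun i j t y hz => by
        have h1 := iteratedDeriv_eq_ev (F := fun ρ => comp e (g + H ρ) y i j) (f := gm₁ i j)
          (fun ρ hz => congrFun (congrFun (F₁.map_ev_family t y ρ hz).symm i) j) (k + 1) 0 hz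
        refine h1.symm.trans ?_
        have h2 : (fun ρ => comp e (g + H ρ) y i j)
            = fun ρ => comp e g y i j + comp e (H ρ) y i j := rfl
        rw [h2, iteratedDeriv_const_add (Nat.succ_pos k)]
        exact hH.taylor e he y (hsub hz.2.1) i j (k + 1) (Nat.lt_succ_self k))
      (fun i j => hIH _ _)
    refine (F₂.ambRic_mem_iff one_pos (k + 1)).1 (fun a a' => ?_) j hj t ht y hyW a a'
    by_cases h : ∃ i j, a = Sum.inr (Sum.inl i) ∧ a' = Sum.inr (Sum.inl j)
    · obtain ⟨i, j, rfl, rfl⟩ := h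
      exact hblock i j
    · rw [F₂.family.ambRic_eq_zero hS' (F₂.divg_perturb hH' he hsub) a a' fun i j hij =>
        h ⟨i, j, hij⟩]
      exact zero_mem _

lemma exists_isApproxSolution (hn : 2 < n) (hg : IsNullRicciWalker g N p) {k : ℕ}
    (hk : k ≤ n / 2 - 1) : ∃ H, IsApproxSolution g N k H := by
  induction k with
  | zero => exact ⟨0, isApproxSolution_zero⟩
  | succ k ih =>
    obtain ⟨H, hH⟩ := ih (by omega)
    refine hH.exists_succ hn hg fun h => ?_
    have h1 : (n : ℝ) = ((2 * (k + 1) : ℕ) : ℝ) := by push_cast; linarith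
    have h2 : n = 2 * (k + 1) := by exact_mod_cast h1
    omega

/-- A family of null perturbations solving the Fefferman-Graham equations below the critical order
is an ambient metric in normal form: the obstruction is null, hence trace-free. -/
lemma IsApproxSolution.isAmbientMetric (hn : 2 < n) (hg : IsNullRicciWalker g N p) (heven : Even n)
    {H : ℝ → TensorField n M} (hH : IsApproxSolution g N (n / 2 - 1) H) :
    IsAmbientMetric g 1 (fun ρ => g + H ρ) := by
  have hG := hH.toIsNullFamily.isMetricFamily hg 1
  refine ⟨⟨hG.initial, hG.symm, hG.nondegenerate, hG.smooth,
    fun hodd => absurd heven (Nat.not_even_iff_odd.2 hodd), fun _ k hk => hH.ricci k hk⟩, ?_⟩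
  intro _ e he t ht y hy
  obtain ⟨W, hyW, hsub, ti, gm, gmi, E, S, gm₁, gmi₁, F⟩ :=
    exists_model hn hg hH.toIsNullFamily he hy
  have hz := F.base_mem one_pos ht hyW
  have hw := F.family.walker
  have hS := F.image_perturb hH.toIsNullFamily he hsub
  have hdiv := F.divg_perturb hH.toIsNullFamily he hsub
  have hnull := F.family.ambBlock_nullEnd hS hdiv
  set B := ambBlock (partialD (Ω := ambientDomain W 1))
      (coordFn W 1 (Sum.inl ())) ti (coordFn W 1 (Sum.inr (Sum.inr ()))) gm₁ gmi₁
      (chr (baseD W 1) gm₁ gmi₁) with hB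
  have htr : (gmi * (dmat (radialD W 1))^[n / 2 - 1] B).trace = 0 := by
    rw [← iterate_dmat_mul F.family.D_r_gi, trace]
    simp only [diag_apply, iterate_dmat_apply]
    have h1 : ∑ i, (radialD W 1)^[n / 2 - 1] ((gmi * B) i i)
        = (radialD W 1)^[n / 2 - 1] (gmi * B).trace := by
      rw [trace]
      generalize n / 2 - 1 = k
      induction k with
      | zero => rfl
      | succ k ih =>
        simp only [Function.iterate_succ_apply'] at ih ⊢
        rw [← ih, map_sum]
    rw [h1, hnull.trace_eq_zero hw]
    exact Function.iterate_fixed (map_zero _) _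
  have hBt : Bᵀ = B := by
    have := F.family.ambRic_symm
    ext1 i j
    exact congrFun (congrFun this (Sum.inr (Sum.inl i))) (Sum.inr (Sum.inl j))
  rw [F.leadingRicci_eq hz, ← hB]
  set L := (dmat (radialD W 1))^[n / 2 - 1] B with hL
  have hLt : Lᵀ = L := by rw [hL, ← iterate_dmat_transpose, hBt]
  have h2 : metricTrace (comp e g y) (L.map (ev ⟨_, hz⟩)) = 0 := by
    refine Eq.trans ?_ ((congrArg (ev ⟨_, hz⟩) htr).trans (map_zero _))
    rw [metricTrace, ← F.map_ev_inv hz, trace, map_sum]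
    refine Finset.sum_congr rfl fun i _ => ?_
    rw [diag_apply, mul_apply, map_sum]
    refine Finset.sum_congr rfl fun j _ => ?_
    rw [map_mul, Matrix.map_apply, Matrix.map_apply, ← transpose_apply L, hLt]
  have h3 : ∀ (s : ℝ) (A : Matrix (Fin n) (Fin n) ℝ),
      metricTrace (comp e g y) (s • A) = s * metricTrace (comp e g y) A := by
    intro s A
    simp only [metricTrace, Matrix.smul_apply, smul_eq_mul, Finset.mul_sum]
    exact Finset.sum_congr rfl fun i _ => Finset.sum_congr rfl fun j _ => by ring
  have h4 : ((((n / 2 - 1).factorial : ℝ)⁻¹) • L).map (ev ⟨_, hz⟩)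
      = (((n / 2 - 1).factorial : ℝ)⁻¹) • L.map (ev ⟨_, hz⟩) := by
    ext i j
    exact map_smul (ev ⟨_, hz⟩) _ (L i j)
  rw [h4, h3, h2, mul_zero]

/-- All Taylor coefficients of a family of null perturbations are null and divergence-free. -/
lemma IsNullFamily.taylorCoeff (hn : 2 < n) (hg : IsNullRicciWalker g N p) {H : ℝ → TensorField n M}
    (hH : IsNullFamily g N H) (m : ℕ) :
    ImageIn g N (taylorCoeff H m) ∧ DivergenceFree g (taylorCoeff H m) := by
  have hh : ∀ ρ x, H ρ x = (g + H ρ) x - g x := fun ρ x =>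
    (add_sub_cancel_left (g x) (H ρ x)).symm
  constructor
  · intro e he y hy
    obtain ⟨W, hyW, hsub, ti, gm, gmi, E, S, gm₁, gmi₁, F⟩ := exists_model hn hg hH he hy
    refine F.taylorCoeff_image one_pos hh (fun i j => ?_) hyW
    rw [F.image_perturb hH he hsub, sub_self]
    exact zero_mem _
  · intro e he y hy i
    obtain ⟨W, hyW, hsub, ti, gm, gmi, E, S, gm₁, gmi₁, F⟩ := exists_model hn hg hH he hy
    refine F.divergence_taylorCoeff one_pos hh ?_ hyW
    rw [F.divg_perturb hH he hsub i]
    exact zero_mem _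

end Recursion

end AmbientWalker

end

theorem mainTheorem2 (n : ℕ) (hn : 2 < n) (M : Type*) [TopologicalSpace M] [T2Space M]
    [SecondCountableTopology M] [ChartedSpace (EuclideanSpace ℝ (Fin n)) M]
    [IsManifold (𝓡 n) ∞ M]
    (g : AmbientWalker.TensorField n M) (N : AmbientWalker.SubspaceField n M) (p : ℕ)
    (hg : AmbientWalker.IsNullRicciWalker g N p) :
    (∀ (ε : ℝ) (G h : ℝ → AmbientWalker.TensorField n M), 0 < ε →
      AmbientWalker.SolvesFeffermanGraham g ε G → (∀ ρ x, h ρ x = G ρ x - g x) →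
        (Odd n → ∀ m : ℕ, 1 ≤ m →
          AmbientWalker.ImageIn g N (AmbientWalker.taylorCoeff h m) ∧
          AmbientWalker.DivergenceFree g (AmbientWalker.taylorCoeff h m)) ∧
        (Even n →
          (∀ m : ℕ, 1 ≤ m → m ≤ n / 2 - 1 →
            AmbientWalker.ImageIn g N (AmbientWalker.taylorCoeff h m) ∧
            AmbientWalker.DivergenceFree g (AmbientWalker.taylorCoeff h m)) ∧
          ∀ c : ℝ, c ≠ 0 →
            AmbientWalker.ImageIn g N (AmbientWalker.obstruction c G))) ∧
    (Even n → ∃ (ε : ℝ) (G h : ℝ → AmbientWalker.TensorField n M), 0 < ε ∧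
      AmbientWalker.IsAmbientMetric g ε G ∧ (∀ ρ x, h ρ x = G ρ x - g x) ∧
        ∀ m : ℕ, 1 ≤ m →
          AmbientWalker.ImageIn g N (AmbientWalker.taylorCoeff h m) ∧
          AmbientWalker.DivergenceFree g (AmbientWalker.taylorCoeff h m)) := by
  constructor
  · intro ε G h hε hG hh
    have hF := hG.isMetricFamily
    refine ⟨fun hodd m _ => ?_, fun heven => ⟨fun m _ hm => ?_, fun c _ => ?_⟩⟩
    · refine AmbientWalker.taylorCoeff_of_ricciDerivVanishes hn hg hε hF hh (fun j _ hj => ?_)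
        fun j _ => hG.ricci_odd hodd j
      exact Nat.not_even_iff_odd.2 hodd ⟨j + 1, by omega⟩
    · exact AmbientWalker.taylorCoeff_of_ricciDerivVanishes hn hg hε hF hh
        (fun j hj hj' => by omega) fun j hj => hG.ricci_even heven j (by omega)
    · exact AmbientWalker.imageIn_obstruction hn hg hε hF heven (hG.ricci_even heven) c
  · intro heven
    obtain ⟨H, hH⟩ := AmbientWalker.exists_isApproxSolution hn hg (le_refl (n / 2 - 1))
    exact ⟨1, fun ρ => g + H ρ, H, one_pos, hH.isAmbientMetric hn hg heven,
      fun ρ x => (add_sub_cancel_left (g x) (H ρ x)).symm,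
      fun m _ => hH.toIsNullFamily.taylorCoeff hn hg m⟩
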